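/- **Setting.** Let $P$ be a connected rectilinear polygon on the integer grid (holes are allowed), given by the integer coordinates of the vertices of its simple, pairwise disjoint boundary curves. Let $A$ be its area, i.e. the number of grid squares in $P$. Let $\mathcal E=\{e_1,\dots,e_k\}$, $k\ge 1$, be distinct grid squares outside $P$, the *exits*; for every exit a nonempty list of squares of $P$ that share a side with it is given, and the exit can be entered from exactly these squares. At time $0$ there is one person in every square of $P$. In every time step each person in $P$ stays, moves to a square of $P$ that shares a side with the current one, or moves into an exit that can be entered from the current square; a person in an exit leaves. At no time are two persons in the same square or in the same exit. The moves of one step can be ordered so that each leads into an exit or into a square that is empty by then (so persons may follow one another, but may not exchange places directly or around a cycle). There is no other restriction; in particular, the persons who pass through a square need not all continue in the same direction (the flow is *non-confluent*). An *evacuation within $T$ steps* is a choice of routes of all persons by which everybody has reached an exit after at most $T$ steps. It is *optimal* if no evacuation within fewer than $T$ steps exists. **Theorem.** (1) There are an algorithm (a program for a random access machine over the integers with unit-cost addition, subtraction, comparison and indirect addressing, and without multiplication) and a polynomial $p$ such that, for every $P$ and $\mathcal E$ as above, given as the list of the coordinates of the vertices of $P$, of the exits, and of the squares from which each exit can be entered,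 the algorithm halts after at most $p(A+T)$ steps with an optimal evacuation as its output, listed route by route. Here $T$ is the number of steps of an optimal evacuation (in particular, an evacuation exists). (2) For $T\ge 0$ let $G_T$ be the following network, in which all capacities are $1$. It has a source $s$, a sink $t$ and, for every square of $P$ and every exit $q$ and every $1\le i\le T$, vertices $\mathrm{in}_i(q)$ and $\mathrm{out}_i(q)$. Its arcs are $s\to \mathrm{in}_1(c)$ for all squares $c$ of $P$ (for $T\ge1$); $\mathrm{in}_i(q)\to\mathrm{out}_i(q)$ for all $q$ and $i$; $\mathrm{out}_i(c)\to\mathrm{in}_{i+1}(c')$ for $i<T$ and squares $c,c'$ of $P$ that are equal or share a side; $\mathrm{out}_i(c)\to\mathrm{in}_i(e)$ if the exit $e$ can be entered from $c$; and $\mathrm{out}_i(e)\to t$ for all exits $e$. For every $P$, $\mathcal E$ as above and every $T$, there is an evacuation within $T$ steps if and only if $G_T$ has an integral maximum flow of value $A$. -/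

import Mathlib

/-! ### A random access machine with a step count -/

namespace RAM

/-- A machine state: integer registers, and an integer memory that can be addressed indirectly. -/
structure State where
  reg : ℕ → ℤ
  mem : ℤ → ℤ

/-- Expressions: integer literals, registers, memory reads, sums, differences and comparisons.
There is no multiplication, so that `t` unit-cost steps only ever lengthen a number by
`O(t)` bits and unit cost is polynomially related to Turing machine time. -/
inductive Expr where
  | lit (c : ℤ)
  | reg (x : ℕ)
  | mem (a : Expr)
  | add (a b : Expr)
  | sub (a b : Expr)
  | lt (a b : Expr)
  | eq (a b : Expr)

/-- The value of an expression; comparisons have the value `1` (true) or `0` (false). -/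
def Expr.eval (s : State) : Expr → ℤ
  | .lit c => c
  | .reg x => s.reg x
  | .mem a => s.mem (a.eval s)
  | .add a b => a.eval s + b.eval s
  | .sub a b => a.eval s - b.eval s
  | .lt a b => if a.eval s < b.eval s then 1 else 0
  | .eq a b => if a.eval s = b.eval s then 1 else 0

/-- The number of elementary operations needed to evaluate an expression. -/
def Expr.cost : Expr → ℕ
  | .lit _ => 1
  | .reg _ => 1
  | .mem a => a.cost + 1
  | .add a b => a.cost + b.cost + 1
  | .sub a b => a.cost + b.cost + 1
  | .lt a b => a.cost + b.cost + 1
  | .eq a b => a.cost + b.cost + 1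

/-- Programs. -/
inductive Prog where
  | skip
  | assign (x : ℕ) (e : Expr)
  | store (a e : Expr)
  | seq (p q : Prog)
  | ite (e : Expr) (p q : Prog)
  | loop (e : Expr) (p : Prog)

/-- Write a value into a register. -/
def State.setReg (s : State) (x : ℕ) (v : ℤ) : State :=
  { s with reg := Function.update s.reg x v }

/-- Write a value into a memory cell. -/
def State.setMem (s : State) (a v : ℤ) : State :=
  { s with mem := Function.update s.mem a v }

/-- `Exec p s n s'`: started in the state `s`, the program `p` halts in the state `s'` after
exactly `n` steps. `ite e p q` runs `p` if `e` is nonzero and `q` otherwise; `loop e p` repeats `p`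
as long as `e` is nonzero. -/
inductive Exec : Prog → State → ℕ → State → Prop where
  | skip (s : State) : Exec .skip s 1 s
  | assign (x : ℕ) (e : Expr) (s : State) :
      Exec (.assign x e) s (e.cost + 1) (s.setReg x (e.eval s))
  | store (a e : Expr) (s : State) :
      Exec (.store a e) s (a.cost + e.cost + 1) (s.setMem (a.eval s) (e.eval s))
  | seq {p q : Prog} {s s' s'' : State} {m n : ℕ} :
      Exec p s m s' → Exec q s' n s'' → Exec (.seq p q) s (m + n) s''
  | iteTrue {e : Expr} {p q : Prog} {s s' : State} {n : ℕ} :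
      e.eval s ≠ 0 → Exec p s n s' → Exec (.ite e p q) s (e.cost + 1 + n) s'
  | iteFalse {e : Expr} {p q : Prog} {s s' : State} {n : ℕ} :
      e.eval s = 0 → Exec q s n s' → Exec (.ite e p q) s (e.cost + 1 + n) s'
  | loopTrue {e : Expr} {p : Prog} {s s' s'' : State} {m n : ℕ} :
      e.eval s ≠ 0 → Exec p s m s' → Exec (.loop e p) s' n s'' →
        Exec (.loop e p) s (e.cost + 1 + m + n) s''
  | loopFalse {e : Expr} {p : Prog} {s : State} :
      e.eval s = 0 → Exec (.loop e p) s (e.cost + 1) s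

/-- The start state on a given input word: its length is in register `0`, its entries are in the
memory cells `0, 1, 2, …`, and everything else is `0`. -/
def inputState (w : List ℤ) : State where
  reg := fun x => if x = 0 then (w.length : ℤ) else 0
  mem := fun a => if 0 ≤ a then w.getD a.toNat 0 else 0

/-- The output word of a state: its length is in register `0`, its entries are in the memory cells
`0, 1, 2, …`. -/
def outputWord (s : State) : List ℤ :=
  (List.range (s.reg 0).toNat).map fun i => s.mem i

/-- On the input word `w` the program `p` halts after exactly `n` steps with output word `v`. -/
def Computes (p : Prog) (w : List ℤ) (n : ℕ) (v : List ℤ) : Prop :=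
  ∃ s, Exec p (inputState w) n s ∧ outputWord s = v

end RAM

/-! ### Flow networks -/

/-- A finite directed network with capacities. -/
structure FlowNetwork (V : Type) where
  source : V
  sink : V
  arcs : Finset (V × V)
  cap : V × V → ℝ

namespace FlowNetwork

/-- A flow respects the capacities and is conserved at every vertex but the source and the sink. -/
def IsFlow {V : Type} [DecidableEq V] (N : FlowNetwork V) (f : V × V → ℝ) : Prop :=
  (∀ a ∈ N.arcs, 0 ≤ f a ∧ f a ≤ N.cap a) ∧
  ∀ v, v ≠ N.source → v ≠ N.sink →
    ∑ a ∈ N.arcs with a.2 = v, f a = ∑ a ∈ N.arcs with a.1 = v, f a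

/-- The value of a flow: the net amount that leaves the source. -/
def value {V : Type} [DecidableEq V] (N : FlowNetwork V) (f : V × V → ℝ) : ℝ :=
  ∑ a ∈ N.arcs with a.1 = N.source, f a - ∑ a ∈ N.arcs with a.2 = N.source, f a

/-- A maximum flow. -/
def IsMaxFlow {V : Type} [DecidableEq V] (N : FlowNetwork V) (f : V × V → ℝ) : Prop :=
  N.IsFlow f ∧ ∀ g, N.IsFlow g → N.value g ≤ N.value f

/-- All arcs carry an integral amount. -/
def IsIntegral {V : Type} (N : FlowNetwork V) (f : V × V → ℝ) : Prop :=
  ∀ a ∈ N.arcs, ∃ z : ℤ, f a = z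

end FlowNetwork

/-! ### Grid polygons with exits -/

namespace Evac

/-- The grid square `(i, j)` is `[i, i + 1] × [j, j + 1]`. -/
abbrev Square := ℤ × ℤ

/-- Two grid squares are neighbours if they share a side. -/
def Adj (s s' : Square) : Prop :=
  |s.1 - s'.1| + |s.2 - s'.2| = 1

instance : DecidableRel Adj := fun s s' =>
  inferInstanceAs (Decidable (|s.1 - s'.1| + |s.2 - s'.2| = 1))

/-- The graph of all grid squares. -/
def gridGraph : SimpleGraph Square where
  Adj := Adj
  symm := ⟨fun s s' h => by
    unfold Adj at h ⊢
    rw [abs_sub_comm s'.1 s.1, abs_sub_comm s'.2 s.2]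
    exact h⟩
  loopless := ⟨fun s h => by simp [Adj] at h⟩

/-- The data of an evacuation problem: the closed boundary curves of a polygon (one for every
connected component of the boundary, so just one if there are no holes), each as its cyclic list of
vertices, and the exits, each as a grid square together with the list of the squares of the polygon
from which one can move into it. -/
structure Building where
  rings : List (List (ℤ × ℤ))
  exits : List (Square × List Square)

/-- The edges of a closed polygonal curve, each from one vertex to the next. -/
def ringEdges (r : List (ℤ × ℤ)) : List ((ℤ × ℤ) × (ℤ × ℤ)) :=
  r.zip (r.rotate 1)

/-- The lattice point `p` lies on the axis-parallel edge `e`, and is not its final point. -/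
def OnEdge (p : ℤ × ℤ) (e : (ℤ × ℤ) × (ℤ × ℤ)) : Prop :=
  p ≠ e.2 ∧ min e.1.1 e.2.1 ≤ p.1 ∧ p.1 ≤ max e.1.1 e.2.1 ∧
    min e.1.2 e.2.2 ≤ p.2 ∧ p.2 ≤ max e.1.2 e.2.2

namespace Building

/-- All boundary edges. -/
def edges (B : Building) : List ((ℤ × ℤ) × (ℤ × ℤ)) :=
  B.rings.flatMap ringEdges

/-- The edge `e` is vertical and is crossed by the horizontal ray that runs to the left from the
centre of the square `s`. -/
def CrossesRay (s : Square) (e : (ℤ × ℤ) × (ℤ × ℤ)) : Prop :=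
  e.1.1 = e.2.1 ∧ e.1.1 ≤ s.1 ∧ min e.1.2 e.2.2 ≤ s.2 ∧ s.2 < max e.1.2 e.2.2

instance (s : Square) : DecidablePred (CrossesRay s) := fun e =>
  inferInstanceAs (Decidable
    (e.1.1 = e.2.1 ∧ e.1.1 ≤ s.1 ∧ min e.1.2 e.2.2 ≤ s.2 ∧ s.2 < max e.1.2 e.2.2))

/-- A lower bound for all coordinates of vertices. -/
def lo (B : Building) : ℤ :=
  (B.rings.flatten.flatMap fun p => [p.1, p.2]).foldr min 0

/-- An upper bound for all coordinates of vertices. -/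
def hi (B : Building) : ℤ :=
  (B.rings.flatten.flatMap fun p => [p.1, p.2]).foldr max 0

/-- The grid squares inside the polygon, by the even-odd rule: a square is inside if a ray from its
centre crosses the boundary an odd number of times. -/
noncomputable def cells (B : Building) : Finset Square :=
  (Finset.Ico B.lo B.hi ×ˢ Finset.Ico B.lo B.hi).filter fun s =>
    Odd (B.edges.countP fun e => decide (CrossesRay s e))

/-- The area of the polygon. -/
noncomputable def area (B : Building) : ℕ := B.cells.card

/-- The exit squares. -/
def exitSquares (B : Building) : Finset Square := (B.exits.map Prod.fst).toFinset

/-- One can move from the square `s` into the exit `e`. -/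
def CanEnter (B : Building) (s e : Square) : Prop :=
  ∃ x ∈ B.exits, x.1 = e ∧ s ∈ x.2

instance (B : Building) (s e : Square) : Decidable (B.CanEnter s e) :=
  inferInstanceAs (Decidable (∃ x ∈ B.exits, x.1 = e ∧ s ∈ x.2))

/-- The boundary curves are those of a rectilinear grid polygon, possibly with holes, and the exits
are grid squares that border the polygon from outside. -/
structure IsValid (B : Building) : Prop where
  /-- Every boundary curve has at least four vertices. -/
  four_le : ∀ r ∈ B.rings, 4 ≤ r.length
  /-- Every edge is horizontal or vertical. -/
  rectilinear : ∀ e ∈ B.edges, e.1.1 = e.2.1 ∨ e.1.2 = e.2.2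
  /-- Every edge has positive length. -/
  nondegenerate : ∀ e ∈ B.edges, e.1 ≠ e.2
  /-- The boundary curves are simple and pairwise disjoint: as edges do not contain their final
  points here, this says that edges meet only where one of them ends and the next one begins. -/
  simple : B.edges.Pairwise fun e e' => ∀ p, ¬ (OnEdge p e ∧ OnEdge p e')
  /-- The polygon is connected (and not empty). -/
  connected : (gridGraph.induce (B.cells : Set Square)).Connected
  /-- There is at least one exit. -/
  exits_ne_nil : B.exits ≠ []
  /-- The exits are distinct. -/
  exits_nodup : (B.exits.map Prod.fst).Nodup
  /-- The exits are outside the polygon. -/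
  exits_outside : ∀ x ∈ B.exits, x.1 ∉ B.cells
  /-- Every exit can be entered from somewhere. -/
  entries_ne_nil : ∀ x ∈ B.exits, x.2 ≠ []
  /-- The squares from which an exit can be entered are listed once. -/
  entries_nodup : ∀ x ∈ B.exits, x.2.Nodup
  /-- They are squares of the polygon that border the exit. -/
  entries_adj : ∀ x ∈ B.exits, ∀ s ∈ x.2, s ∈ B.cells ∧ Adj s x.1

/-- The input word that describes a building by the coordinates of its vertices and exits. -/
def encode (B : Building) : List ℤ :=
  ((B.rings.length : ℤ) ::
    B.rings.flatMap fun r => (r.length : ℤ) :: r.flatMap fun p => [p.1, p.2]) ++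
  ((B.exits.length : ℤ) ::
    B.exits.flatMap fun x =>
      x.1.1 :: x.1.2 :: (x.2.length : ℤ) :: x.2.flatMap fun p => [p.1, p.2])

end Building

/-! ### Evacuations -/

/-- The route of one person: the squares where the person is at times `0, 1, …, m`. The last one is
an exit, the others are squares of the polygon. In each step the person stays or moves to a
neighbouring square, and in the last step moves into the exit. -/
def IsRoute (B : Building) (r : List Square) : Prop :=
  ∃ (q : List Square) (s e : Square), r = q ++ [s, e] ∧
    (∀ c ∈ q ++ [s], c ∈ B.cells) ∧
    (q ++ [s]).IsChain (fun c c' => c = c' ∨ Adj c c') ∧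
    B.CanEnter s e

/-- An evacuation (with a non-confluent flow) in at most `T` time steps, as the list of the routes
of all persons. `r[t]?` is the place at time `t` of the person with route `r`; it is
`none` when that person has left. -/
structure IsEvacuation (B : Building) (T : ℕ) (R : List (List Square)) : Prop where
  isRoute : ∀ r ∈ R, IsRoute B r
  /-- At time `0` there is a person in every square of the polygon. -/
  occupied : ∀ c ∈ B.cells, ∃ r ∈ R, r[0]? = some c
  /-- No two persons are in the same square or in the same exit at the same time. -/
  disjoint : R.Pairwise fun r r' => ∀ (t : ℕ) (c : Square), ¬ (r[t]? = some c ∧ r'[t]? = some c)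
  /-- The moves of one time step can be made in some order such that each of them leads into
  an exit or into a square that is empty by then: persons can follow one another, but cannot exchange
  their places directly or around a cycle. -/
  acyclic : ∀ t : ℕ, ∃ rank : Square → ℕ, ∀ r ∈ R, ∀ c c' : Square,
    r[t]? = some c → r[t + 1]? = some c' → c ≠ c' → rank c' < rank c
  /-- After `T` steps everybody is in an exit or has left. -/
  inTime : ∀ r ∈ R, r.length ≤ T + 1

/-- The evacuation `R` takes at most `T` time steps, and no evacuation takes fewer than `T`. -/
def IsOptimalEvacuation (B : Building) (T : ℕ) (R : List (List Square)) : Prop :=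
  IsEvacuation B T R ∧ ∀ T' R', IsEvacuation B T' R' → T ≤ T'

/-- The output word that describes a list of routes. -/
def encodeRoutes (R : List (List Square)) : List ℤ :=
  (R.length : ℤ) :: R.flatMap fun r => (r.length : ℤ) :: r.flatMap fun p => [p.1, p.2]

/-! ### The time-expanded network -/

/-- Vertices of the time-expanded network: a source, a sink, and an in-vertex and an out-vertex
for every square and every copy of the polygon. -/
inductive NetVertex where
  | source
  | sink
  | inn (s : Square) (i : ℕ)
  | out (s : Square) (i : ℕ)
  deriving DecidableEq

open NetVertex in
/-- The time-expanded network with `T` copies (numbered `0, …, T - 1`) of the polygon and its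
exits. All capacities are `1`. -/
noncomputable def timeExpanded (B : Building) (T : ℕ) : FlowNetwork NetVertex where
  source := source
  sink := sink
  arcs :=
    -- from the source to the squares of the first copy
    (B.cells.image fun c => (source, inn c 0)) ∪
    -- through every square and exit of every copy
    (((B.cells ∪ B.exitSquares) ×ˢ Finset.range T).image fun x => (inn x.1 x.2, out x.1 x.2)) ∪
    -- from every square to itself and its neighbours in the next copy
    (((B.cells ×ˢ B.cells ×ˢ Finset.range T).filter fun x =>
        (x.1 = x.2.1 ∨ Adj x.1 x.2.1) ∧ x.2.2 + 1 < T).image fun x =>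
      (out x.1 x.2.2, inn x.2.1 (x.2.2 + 1))) ∪
    -- from the squares next to an exit into it
    (((B.cells ×ˢ B.exitSquares ×ˢ Finset.range T).filter fun x =>
        B.CanEnter x.1 x.2.1).image fun x => (out x.1 x.2.2, inn x.2.1 x.2.2)) ∪
    -- from the exits to the sink
    ((B.exitSquares ×ˢ Finset.range T).image fun x => (out x.1 x.2, sink))
  cap := fun _ => 1

end Evac

/-! Everything passes through one combinatorial object, the scheme (`IsScheme`). For each time it
lists the squares that are vacated, and it assigns to them distinct next places. It says nothing
about an order of the moves, and moves around cycles are allowed. An evacuation yields a scheme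
(`IsEvacuation.exists_isScheme`). Conversely, persons on a cycle of moves may as well stay where
they are: together they fill the same squares at the next time, so the sets of vacated squares need
not change, and no cycle is left (`IsScheme.uncycle`, `isAcyclicScheme_uncycle`). Tracing the moves
from time 0 then gives the routes of an evacuation (`IsScheme.isEvacuation`). Hence the condition on
the order of the moves never costs time. Some scheme always exists: the polygon is connected, and
persons can leave one by one through a single exit (`exists_isScheme_of_potential`).

For the network, a scheme in which nobody appears out of nothing is a 0-1 flow that saturates all
arcs at the source (`IsScheme.exists_flow`). These arcs form a cut of capacity `B.area`, so such a
flow is maximum. Conversely, the arc inside each square lets at most one unit pass per copy, so an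
integral flow of that value can be read as a scheme (`exists_isScheme_of_flow`).

For the algorithm, a scheme for `T` steps is a matching of all left vertices in the bipartite graph
`timeArcs`. Square `c` at time `i` is matched either to its next place at time `i + 1` or, if it is
empty, to its own copy at time `i`. An arrival occupies the right vertex that an empty square would
need, so whoever arrives must be moved on (`IsScheme.exists_isMatching`, `isScheme_of_isMatching`).
In a scheme, squares may also be vacated where nobody has arrived; these phantom persons are
harmless, since only the persons present at time 0 are traced.

The matchings are found by an auction with integer prices. A free left vertex takes its cheapest
neighbour of price below `nL` and raises that price by one. The total price is at most `nL * nR`, so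
bids run out, and if a free vertex is then priced out, an unused price level exhibits a violation of
Hall's condition (`Auction.Inv.not_isMatching`). The times `1, 2, …` are tried in turn; the first
success is optimal because every evacuation gives a matching (`exists_least_time`).

The running time has to be polynomial in area and time although the coordinates may be arbitrarily
large. Across each unit side of the boundary the even-odd parity changes, so every vertex touches a
square of the polygon. This bounds the length of the input, and by connectedness also the box that
has to be searched, in terms of the area (`exists_cell_near`, `abs_sub_lt`). The program is written
in a small array language whose loops are all capped by variables that stay constant; such commands
compile to machine code of polynomial cost (`Cmd.exec_compile`). Only the search over the time is a
raw machine loop (`exec_search`). -/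

/-! ### A structured array language that compiles to the random access machine -/

namespace ArrLang

set_option linter.unusedSectionVars false

/-- Stores of the array language: integer variables, and arrays indexed by the integers. -/
structure Store (V A : Type) where
  var : V → ℤ
  arr : A → ℤ → ℤ

/-- Expressions of the array language. -/
inductive Ex (V A : Type) where
  | lit (c : ℤ)
  | var (x : V)
  | arr (a : A) (i : Ex V A)
  | add (a b : Ex V A)
  | sub (a b : Ex V A)
  | lt (a b : Ex V A)
  | eq (a b : Ex V A)

/-- Commands of the array language. `rep x v cap c` runs `c` for `x = 0, 1, …` while `x` is below both
`v` and `cap`. -/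
inductive Cmd (V A : Type) where
  | skip
  | set (x : V) (e : Ex V A)
  | put (a : A) (i e : Ex V A)
  | seq (c d : Cmd V A)
  | ite (e : Ex V A) (c d : Cmd V A)
  | rep (x v cap : V) (c : Cmd V A)

variable {V A : Type}

instance : Add (Ex V A) := ⟨.add⟩
instance : Sub (Ex V A) := ⟨.sub⟩
instance (n : ℕ) [n.AtLeastTwo] : OfNat (Ex V A) n := ⟨.lit n⟩
instance : Zero (Ex V A) := ⟨.lit 0⟩
instance : One (Ex V A) := ⟨.lit 1⟩
instance : Coe V (Ex V A) := ⟨.var⟩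

scoped infixr:40 " ;; " => Cmd.seq
scoped infix:45 " ::= " => Cmd.set
scoped infix:60 " ≺ " => Ex.lt
scoped infix:60 " ≐ " => Ex.eq

variable [DecidableEq V] [DecidableEq A]

/-- Assign a value to a variable. -/
def Store.setVar (s : Store V A) (x : V) (z : ℤ) : Store V A :=
  { s with var := Function.update s.var x z }

/-- Write a value into an array. -/
def Store.setArr (s : Store V A) (a : A) (i z : ℤ) : Store V A :=
  { s with arr := Function.update s.arr a (Function.update (s.arr a) i z) }

@[simp] theorem Store.setVar_arr (s : Store V A) (x : V) (z : ℤ) : (s.setVar x z).arr = s.arr := rfl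

@[simp] theorem Store.setArr_var (s : Store V A) (a : A) (i z : ℤ) :
    (s.setArr a i z).var = s.var := rfl

@[simp] theorem Store.setVar_var (s : Store V A) (x y : V) (z : ℤ) :
    (s.setVar x z).var y = if y = x then z else s.var y := by
  simp [Store.setVar, Function.update_apply]

theorem Store.setArr_arr (s : Store V A) (a b : A) (i z : ℤ) :
    (s.setArr a i z).arr b = if b = a then Function.update (s.arr a) i z else s.arr b := by
  simp [Store.setArr, Function.update_apply]

@[simp] theorem Store.setArr_arr_apply (s : Store V A) (a b : A) (i j z : ℤ) :
    (s.setArr a i z).arr b j = if b = a ∧ j = i then z else s.arr b j := by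
  rw [Store.setArr_arr]
  by_cases h : b = a
  · subst h; simp [Function.update_apply]
  · simp [h]

/-- The value of an expression. -/
def Ex.val (s : Store V A) : Ex V A → ℤ
  | .lit c => c
  | .var x => s.var x
  | .arr a i => s.arr a (i.val s)
  | .add a b => a.val s + b.val s
  | .sub a b => a.val s - b.val s
  | .lt a b => if a.val s < b.val s then 1 else 0
  | .eq a b => if a.val s = b.val s then 1 else 0


/-- The effect of a command. -/
def Cmd.den : Cmd V A → Store V A → Store V A
  | .skip, s => s
  | .set x e, s => s.setVar x (e.val s)
  | .put a i e, s => s.setArr a (i.val s) (e.val s)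
  | .seq c d, s => d.den (c.den s)
  | .ite e c d, s => if e.val s ≠ 0 then c.den s else d.den s
  | .rep x v cap c, s =>
      (fun s => (c.den s).setVar x ((c.den s).var x + 1))^[(min (s.var v) (s.var cap)).toNat]
        (s.setVar x 0)

/-- The variables that a command may change. -/
def Cmd.vars : Cmd V A → List V
  | .skip => []
  | .set x _ => [x]
  | .put _ _ _ => []
  | .seq c d => c.vars ++ d.vars
  | .ite _ c d => c.vars ++ d.vars
  | .rep x _ _ c => x :: c.vars

/-- The arrays that a command may change. -/
def Cmd.arrs : Cmd V A → List A
  | .skip => []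
  | .set _ _ => []
  | .put a _ _ => [a]
  | .seq c d => c.arrs ++ d.arrs
  | .ite _ c d => c.arrs ++ d.arrs
  | .rep _ _ _ c => c.arrs

/-- All loops are capped by variables from the list `l`, which are never changed, and loop counters and
loop bounds are not changed in the body of the loop. -/
def Cmd.wf (l : List V) : Cmd V A → Bool
  | .skip => true
  | .set x _ => x ∉ l
  | .put _ _ _ => true
  | .seq c d => c.wf l && d.wf l
  | .ite _ c d => c.wf l && d.wf l
  | .rep x v cap c =>
      cap ∈ l && x ∉ l && x ∉ c.vars && v ∉ c.vars && x ≠ v && c.wf l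

/-- Outside the variables and arrays that `c` may change, the stores agree. -/
structure Frame (c : Cmd V A) (s s' : Store V A) : Prop where
  var : ∀ x, x ∉ c.vars → s'.var x = s.var x
  arr : ∀ a, a ∉ c.arrs → s'.arr a = s.arr a

theorem Cmd.den_frame (c : Cmd V A) (s : Store V A) : Frame c s (c.den s) := by
  induction c generalizing s with
  | skip => exact ⟨fun _ _ => rfl, fun _ _ => rfl⟩
  | set x e =>
    refine ⟨fun y hy => ?_, fun _ _ => rfl⟩
    simp only [Cmd.vars, List.mem_singleton] at hy
    simp [Cmd.den, hy]
  | put a i e =>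
    refine ⟨fun _ _ => rfl, fun b hb => ?_⟩
    simp only [Cmd.arrs, List.mem_singleton] at hb
    simp [Cmd.den, Store.setArr_arr, hb]
  | seq c d hc hd =>
    refine ⟨fun y hy => ?_, fun b hb => ?_⟩
    · simp only [Cmd.vars, List.mem_append, not_or] at hy
      rw [Cmd.den, (hd _).var y hy.2, (hc _).var y hy.1]
    · simp only [Cmd.arrs, List.mem_append, not_or] at hb
      rw [Cmd.den, (hd _).arr b hb.2, (hc _).arr b hb.1]
  | ite e c d hc hd =>
    refine ⟨fun y hy => ?_, fun b hb => ?_⟩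
    · simp only [Cmd.vars, List.mem_append, not_or] at hy
      rw [Cmd.den]; split_ifs
      exacts [(hc _).var y hy.1, (hd _).var y hy.2]
    · simp only [Cmd.arrs, List.mem_append, not_or] at hb
      rw [Cmd.den]; split_ifs
      exacts [(hc _).arr b hb.1, (hd _).arr b hb.2]
  | rep x v cap c hc =>
    refine ⟨fun y hy => ?_, fun b hb => ?_⟩
    · simp only [Cmd.vars, List.mem_cons, not_or] at hy
      rw [Cmd.den]
      generalize (min (s.var v) (s.var cap)).toNat = n
      induction n with
      | zero => simp [hy.1]
      | succ n ih =>
        rw [Function.iterate_succ_apply', Store.setVar_var, if_neg hy.1, (hc _).var y hy.2, ih]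
    · simp only [Cmd.arrs] at hb
      rw [Cmd.den]
      generalize (min (s.var v) (s.var cap)).toNat = n
      induction n with
      | zero => simp
      | succ n ih =>
        rw [Function.iterate_succ_apply', Store.setVar_arr, (hc _).arr b hb, ih]

/-- The body does not touch the counter, so the counter equals the number of completed rounds; the
rest is the frame property of the body, iterated. -/
theorem iterate_rep (x v cap : V) (c : Cmd V A) (hx : x ∉ c.vars) (s : Store V A) (k : ℕ) :
    let s' := (fun s => (c.den s).setVar x ((c.den s).var x + 1))^[k] (s.setVar x 0)
    s'.var x = k ∧ Frame (.rep x v cap c) s s' := by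
  induction k with
  | zero =>
    refine ⟨by simp, fun y hy => ?_, fun _ _ => rfl⟩
    simp only [Cmd.vars, List.mem_cons, not_or] at hy
    simp [hy.1]
  | succ k ih =>
    simp only [Function.iterate_succ_apply']
    obtain ⟨h1, h2⟩ := ih
    have hf := c.den_frame ((fun s => (c.den s).setVar x ((c.den s).var x + 1))^[k] (s.setVar x 0))
    refine ⟨?_, fun y hy => ?_, fun a ha => ?_⟩
    · simp only [Store.setVar_var, if_true]
      rw [hf.var x hx, h1]; push_cast; ring
    · have hy' := hy
      simp only [Cmd.vars, List.mem_cons, not_or] at hy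
      simp only [Store.setVar_var, if_neg hy.1]
      rw [hf.var y hy.2, h2.var y hy']
    · simp only [Store.setVar_arr]
      rw [hf.arr a ha, h2.arr a ha]

/-- The invariant rule for loops. -/
theorem rep_induction {x v cap : V} {c : Cmd V A} {s : Store V A} (I : ℕ → Store V A → Prop)
    (n : ℕ) (hx : x ∉ c.vars) (hn : s.var v = n) (hcap : s.var v ≤ s.var cap)
    (h0 : I 0 (s.setVar x 0))
    (hs : ∀ k < n, ∀ s', I k s' → s'.var x = k → Frame (.rep x v cap c) s s' →
      I (k + 1) ((c.den s').setVar x (k + 1))) :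
    I n ((Cmd.rep x v cap c).den s) := by
  -- By `hcap` the loop is not cut short: caps matter for the running time only, and each use of the
  -- rule has to show that they are large enough.
  rw [Cmd.den, min_eq_left hcap, hn, Int.toNat_natCast]
  have key : ∀ k ≤ n,
      I k ((fun s => (c.den s).setVar x ((c.den s).var x + 1))^[k] (s.setVar x 0)) := by
    intro k
    induction k with
    | zero => exact fun _ => h0
    | succ k ih =>
      intro hk
      obtain ⟨h1, h2⟩ := iterate_rep x v cap c hx s k
      have := hs k hk _ (ih (by omega)) h1 h2
      rw [Function.iterate_succ_apply']
      rwa [(c.den_frame _).var x hx, h1]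
  exact key n le_rfl

/-! #### Compilation -/

/-- The expression `32 * e`. -/
def mul32 (e : RAM.Expr) : RAM.Expr :=
  let d : RAM.Expr → RAM.Expr := fun e => .add e e
  d (d (d (d (d e))))

theorem mul32_eval (e : RAM.Expr) (σ : RAM.State) : (mul32 e).eval σ = 32 * e.eval σ := by
  simp only [mul32, RAM.Expr.eval]; ring

/-- Compilation of expressions. -/
def Ex.compile (iv : V → ℕ) (ia : A → ℤ) : Ex V A → RAM.Expr
  | .lit c => .lit c
  | .var x => .reg (iv x)
  | .arr a i => .mem (.add (mul32 (i.compile iv ia)) (.lit (ia a)))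
  | .add a b => .add (a.compile iv ia) (b.compile iv ia)
  | .sub a b => .sub (a.compile iv ia) (b.compile iv ia)
  | .lt a b => .lt (a.compile iv ia) (b.compile iv ia)
  | .eq a b => .eq (a.compile iv ia) (b.compile iv ia)

/-- Compilation of commands. -/
def Cmd.compile (iv : V → ℕ) (ia : A → ℤ) : Cmd V A → RAM.Prog
  | .skip => .skip
  | .set x e => .assign (iv x) (e.compile iv ia)
  | .put a i e => .store (.add (mul32 (i.compile iv ia)) (.lit (ia a))) (e.compile iv ia)
  | .seq c d => .seq (c.compile iv ia) (d.compile iv ia)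
  | .ite e c d => .ite (e.compile iv ia) (c.compile iv ia) (d.compile iv ia)
  | .rep x v cap c =>
      .seq (.assign (iv x) (.lit 0))
        (.loop (.eq (.add (.lt (.reg (iv x)) (.reg (iv v))) (.lt (.reg (iv x)) (.reg (iv cap))))
            (.lit 2))
          (.seq (c.compile iv ia) (.assign (iv x) (.add (.reg (iv x)) (.lit 1)))))

/-- The machine state `σ` represents the store `s`. -/
structure Sim (iv : V → ℕ) (ia : A → ℤ) (s : Store V A) (σ : RAM.State) : Prop where
  var : ∀ x, σ.reg (iv x) = s.var x
  arr : ∀ a i, σ.mem (32 * i + ia a) = s.arr a i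


theorem Ex.compile_eval {iv : V → ℕ} {ia : A → ℤ} {s : Store V A} {σ : RAM.State}
    (h : Sim iv ia s σ) (e : Ex V A) : (e.compile iv ia).eval σ = e.val s := by
  induction e with
  | lit c => rfl
  | var x => exact h.var x
  | arr a i hi => simp only [Ex.compile, RAM.Expr.eval, mul32_eval, hi, h.arr, Ex.val]
  | add a b ha hb => simp only [Ex.compile, RAM.Expr.eval, ha, hb, Ex.val]
  | sub a b ha hb => simp only [Ex.compile, RAM.Expr.eval, ha, hb, Ex.val]
  | lt a b ha hb => simp only [Ex.compile, RAM.Expr.eval, ha, hb, Ex.val]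
  | eq a b ha hb => simp only [Ex.compile, RAM.Expr.eval, ha, hb, Ex.val]

theorem Sim.setVar {iv : V → ℕ} {ia : A → ℤ} (hv : Function.Injective iv) {s : Store V A}
    {σ : RAM.State} (h : Sim iv ia s σ) (x : V) (z : ℤ) :
    Sim iv ia (s.setVar x z) (σ.setReg (iv x) z) := by
  refine ⟨fun y => ?_, fun a i => h.arr a i⟩
  simp only [RAM.State.setReg, Function.update_apply, hv.eq_iff, Store.setVar_var, h.var]

/-- The arrays are interleaved in memory. Their offsets are distinct residues in `[0, 32)`, so the
address `32 * i + ia a` determines both the array and the index. -/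
theorem Sim.setArr {iv : V → ℕ} {ia : A → ℤ} (ha : Function.Injective ia)
    (hlo : ∀ a, 0 ≤ ia a) (hhi : ∀ a, ia a < 32) {s : Store V A}
    {σ : RAM.State} (h : Sim iv ia s σ) (a : A) (i z : ℤ) :
    Sim iv ia (s.setArr a i z) (σ.setMem (32 * i + ia a) z) := by
  refine ⟨fun y => h.var y, fun b j => ?_⟩
  have : 32 * j + ia b = 32 * i + ia a ↔ b = a ∧ j = i := by
    constructor
    · intro e
      have := hlo a; have := hhi a; have := hlo b; have := hhi b
      have h1 : j = i := by omega
      exact ⟨ha (by omega), h1⟩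
    · rintro ⟨rfl, rfl⟩; rfl
  simp only [RAM.State.setMem, Function.update_apply, this, Store.setArr_arr_apply, h.arr]

/-- Induction on the command: assignments have constant cost, bounds add under composition and
branching, and a loop multiplies by at most its cap and so raises the exponent by one. The numbers
`K` and `d` depend on the command alone. It suffices that `N` bounds the capping variables at the
start, as well-formed commands never change them. -/
theorem Cmd.exec_compile {iv : V → ℕ} {ia : A → ℤ} (hv : Function.Injective iv)
    (ha : Function.Injective ia) (hlo : ∀ a, 0 ≤ ia a) (hhi : ∀ a, ia a < 32) {l : List V}
    (c : Cmd V A) (hc : c.wf l) :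
    ∃ K d : ℕ, ∀ (N : ℕ) (s : Store V A) (σ : RAM.State), (∀ v ∈ l, s.var v ≤ N) → Sim iv ia s σ →
      ∃ n σ', RAM.Exec (c.compile iv ia) σ n σ' ∧ Sim iv ia (c.den s) σ' ∧ n ≤ K * (N + 1) ^ d := by
  have keep : ∀ (c : Cmd V A), c.wf l → ∀ v ∈ l, v ∉ c.vars := by
    intro c hc v hvl
    induction c with
    | skip => simp [Cmd.vars]
    | set x e =>
      simp only [Cmd.wf, decide_eq_true_eq] at hc
      simp only [Cmd.vars, List.mem_singleton]
      rintro rfl; exact hc hvl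
    | put a i e => simp [Cmd.vars]
    | seq c d h1 h2 | ite e c d h1 h2 =>
      simp only [Cmd.wf, Bool.and_eq_true] at hc
      simp only [Cmd.vars, List.mem_append, not_or]
      exact ⟨h1 hc.1, h2 hc.2⟩
    | rep x v cap c h =>
      simp only [Cmd.wf, Bool.and_eq_true, decide_eq_true_eq] at hc
      simp only [Cmd.vars, List.mem_cons, not_or]
      exact ⟨by rintro rfl; exact hc.1.1.1.1.2 hvl, h hc.2⟩
  have join : ∀ K K' d d' N : ℕ,
      K * (N + 1) ^ d + K' * (N + 1) ^ d' ≤ (K + K') * (N + 1) ^ (d + d') := by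
    intro K K' d d' N
    rw [add_mul]
    gcongr <;> omega
  induction c with
  | skip => exact ⟨1, 0, fun N s σ _ h => ⟨1, σ, .skip σ, h, by simp⟩⟩
  | set x e =>
    refine ⟨(e.compile iv ia).cost + 1, 0, fun N s σ _ h =>
      ⟨_, _, .assign (iv x) (e.compile iv ia) σ, ?_, by simp⟩⟩
    rw [Ex.compile_eval h]
    exact h.setVar hv x _
  | put a i e =>
    refine ⟨_, 0, fun N s σ _ h =>
      ⟨_, _, .store (.add (mul32 (i.compile iv ia)) (.lit (ia a))) (e.compile iv ia) σ, ?_,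
        by rw [pow_zero, mul_one]⟩⟩
    rw [Ex.compile_eval h]
    simp only [RAM.Expr.eval, mul32_eval, Ex.compile_eval h]
    exact h.setArr ha hlo hhi a _ _
  | seq c d h1 h2 =>
    simp only [Cmd.wf, Bool.and_eq_true] at hc
    obtain ⟨K, m, h1⟩ := h1 hc.1
    obtain ⟨K', m', h2⟩ := h2 hc.2
    refine ⟨K + K', m + m', fun N s σ hl h => ?_⟩
    obtain ⟨n, σ', he, hs, hn⟩ := h1 N s σ hl h
    obtain ⟨n', σ'', he', hs', hn'⟩ := h2 N (c.den s) σ' (fun v hvl => by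
      rw [(c.den_frame s).var v (keep c hc.1 v hvl)]; exact hl v hvl) hs
    exact ⟨_, _, .seq he he', hs', (add_le_add hn hn').trans (join _ _ _ _ _)⟩
  | ite e c d h1 h2 =>
    simp only [Cmd.wf, Bool.and_eq_true] at hc
    obtain ⟨K, m, h1⟩ := h1 hc.1
    obtain ⟨K', m', h2⟩ := h2 hc.2
    refine ⟨(e.compile iv ia).cost + 1 + (K + K'), 0 + (m + m'), fun N s σ hl h => ?_⟩
    have hle := join ((e.compile iv ia).cost + 1) (K + K') 0 (m + m') N
    have hle' := join K K' m m' N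
    have he := Ex.compile_eval h e
    by_cases h0 : e.val s = 0
    · obtain ⟨n, σ', hx, hs, hn⟩ := h2 N s σ hl h
      refine ⟨_, _, .iteFalse (he.trans h0) hx, ?_, ?_⟩
      · simpa [Cmd.den, h0] using hs
      · rw [pow_zero, mul_one] at hle; omega
    · obtain ⟨n, σ', hx, hs, hn⟩ := h1 N s σ hl h
      refine ⟨_, _, .iteTrue (by rwa [he]) hx, ?_, ?_⟩
      · simpa [Cmd.den, h0] using hs
      · rw [pow_zero, mul_one] at hle; omega
  | rep x v cap c hc' =>
    have hkeep := keep _ hc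
    simp only [Cmd.wf, Bool.and_eq_true, decide_eq_true_eq] at hc
    obtain ⟨⟨⟨⟨⟨hcap, hxl⟩, hxc⟩, hvc⟩, hxv⟩, hwf⟩ := hc
    obtain ⟨K, m, h1⟩ := hc' hwf
    have hxcap : x ≠ cap := by rintro rfl; exact hxl hcap
    -- The machine has no conjunction; two comparisons both hold exactly if their values add up to
    -- 2.
    set E : RAM.Expr := .eq (.add (.lt (.reg (iv x)) (.reg (iv v)))
      (.lt (.reg (iv x)) (.reg (iv cap)))) (.lit 2) with hE
    refine ⟨K + 40, m + 1, fun N s σ hl h => ?_⟩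
    set f : Store V A → Store V A := fun s => (c.den s).setVar x ((c.den s).var x + 1) with hf
    set n := (min (s.var v) (s.var cap)).toNat with hn
    have hnN : n ≤ N := by have := hl cap hcap; omega
    -- Here `j` is the number of rounds still to come. A round costs 14 in addition to its body, and
    -- the last, failing test costs 10.
    have loop : ∀ j ≤ n, ∀ σ, Sim iv ia (f^[n - j] (s.setVar x 0)) σ →
        ∃ t σ', RAM.Exec (.loop E (.seq (c.compile iv ia)
          (.assign (iv x) (.add (.reg (iv x)) (.lit 1))))) σ t σ' ∧
          Sim iv ia (f^[n] (s.setVar x 0)) σ' ∧ t ≤ j * (K * (N + 1) ^ m + 20) + 10 := by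
      intro j
      induction j with
      | zero =>
        intro _ σ hσ
        obtain ⟨h2, h3⟩ := iterate_rep x v cap c hxc s n
        refine ⟨_, σ, .loopFalse ?_, hσ, by simp [hE, RAM.Expr.cost]⟩
        have e1 : (f^[n] (s.setVar x 0)).var v = s.var v := h3.var v (by
          simp only [Cmd.vars, List.mem_cons, not_or]; exact ⟨Ne.symm hxv, hvc⟩)
        have e2 : (f^[n] (s.setVar x 0)).var cap = s.var cap := h3.var cap (hkeep cap hcap)
        simp only [hE, RAM.Expr.eval]
        have h2' : (f^[n] (s.setVar x 0)).var x = n := h2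
        simp only [hσ.var, Nat.sub_zero, e1, e2, h2']
        split_ifs <;> omega
      | succ j ih =>
        intro hj σ hσ
        obtain ⟨h2, h3⟩ := iterate_rep x v cap c hxc s (n - (j + 1))
        set s₁ := f^[n - (j + 1)] (s.setVar x 0) with hs₁
        obtain ⟨t, σ₁, hex, hsim, ht⟩ := h1 N s₁ σ (fun w hw => by
          rw [h3.var w (hkeep w hw)]; exact hl w hw) hσ
        have hsim2 := hsim.setVar hv x ((c.den s₁).var x + 1)
        have hstep : f^[n - j] (s.setVar x 0) = f s₁ := by
          rw [hs₁, ← Function.iterate_succ_apply' f]; congr 2; omega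
        obtain ⟨t', σ₂, hex', hsim', ht'⟩ := ih (by omega) _ (by rw [hstep]; exact hsim2)
        have hcond : E.eval σ ≠ 0 := by
          have e1 : s₁.var v = s.var v := h3.var v (by
            simp only [Cmd.vars, List.mem_cons, not_or]; exact ⟨Ne.symm hxv, hvc⟩)
          have e2 : s₁.var cap = s.var cap := h3.var cap (hkeep cap hcap)
          simp only [hE, RAM.Expr.eval]
          simp only [hσ.var, e1, e2, h2]
          split_ifs <;> omega
        have hasg : RAM.Exec (.assign (iv x) (.add (.reg (iv x)) (.lit 1))) σ₁ 4
            (σ₁.setReg (iv x) ((c.den s₁).var x + 1)) := by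
          have := RAM.Exec.assign (iv x) (.add (.reg (iv x)) (.lit 1)) σ₁
          simp only [RAM.Expr.eval, RAM.Expr.cost, hsim.var] at this
          exact this
        refine ⟨_, _, .loopTrue hcond (.seq hex hasg) hex', hsim', ?_⟩
        have : E.cost = 9 := rfl
        rw [this]
        rw [add_mul j 1]
        omega
    obtain ⟨t, σ', hex, hsim, ht⟩ := loop n le_rfl (σ.setReg (iv x) 0) (by
      rw [Nat.sub_self]; exact h.setVar hv x 0)
    have h0 := RAM.Exec.assign (iv x) (.lit 0) σ
    simp only [RAM.Expr.eval, RAM.Expr.cost] at h0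
    refine ⟨_, _, .seq h0 hex, hsim, ?_⟩
    have h5 : n * (K * (N + 1) ^ m + 20) ≤ N * (K * (N + 1) ^ m + 20) := by gcongr
    have h6 : 1 ≤ (N + 1) ^ m := Nat.one_le_pow _ _ (by omega)
    calc 1 + 1 + t ≤ N * (K * (N + 1) ^ m + 20) + 12 := by omega
      _ ≤ (N + 1) * (K * (N + 1) ^ m + 40 * (N + 1) ^ m) := by nlinarith
      _ = (K + 40) * (N + 1) ^ (m + 1) := by ring

end ArrLang

/-! ### Evacuation schemes -/

namespace Evac

/-- A person in the square `c` of the polygon may be in the place `q` one time step later. -/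
def Step (B : Building) (c q : Square) : Prop :=
  (q ∈ B.cells ∧ (c = q ∨ Adj c q)) ∨ B.CanEnter c q

/-- A scheme that evacuates the squares in `S` within `T` steps: at time `i` the squares in `D i` are
vacated, the person in `c` going to `σ i c`. -/
structure IsScheme (B : Building) (S : Finset Square) (T : ℕ) (D : ℕ → Finset Square)
    (σ : ℕ → Square → Square) : Prop where
  start : D 0 = S
  sub : ∀ i, D i ⊆ B.cells
  step : ∀ i, ∀ c ∈ D i, Step B c (σ i c)
  next : ∀ i, ∀ c ∈ D i, σ i c ∈ B.cells → σ i c ∈ D (i + 1)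
  inj : ∀ i, Set.InjOn (σ i) (D i)
  done : D T = ∅

/-- The relation on squares given by the actual moves at time `i`. -/
def Moves (D : ℕ → Finset Square) (σ : ℕ → Square → Square) (i : ℕ) (c d : Square) : Prop :=
  c ∈ D i ∧ σ i c = d ∧ c ≠ d

/-- No moves around a cycle. -/
def IsAcyclicScheme (D : ℕ → Finset Square) (σ : ℕ → Square → Square) : Prop :=
  ∀ i c, ¬ Relation.TransGen (Moves D σ i) c c

/-- The place at time `t` of the person who starts in `c`. -/
def traj (σ : ℕ → Square → Square) (c : Square) : ℕ → Square
  | 0 => c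
  | t + 1 => σ t (traj σ c t)

/-- The time when the person who starts in `c` reaches an exit. -/
noncomputable def exitTime (B : Building) (σ : ℕ → Square → Square) (c : Square) : ℕ :=
  sInf {t | traj σ c t ∉ B.cells}

/-- The route of the person who starts in `c`. -/
noncomputable def route (B : Building) (σ : ℕ → Square → Square) (c : Square) : List Square :=
  (List.range (exitTime B σ c + 1)).map (traj σ c)

theorem Building.IsValid.exit_notMem {B : Building} (hB : B.IsValid) {s e : Square}
    (h : B.CanEnter s e) : e ∉ B.cells := by
  obtain ⟨x, hx, rfl, -⟩ := h
  exact hB.exits_outside x hx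

theorem Building.IsValid.entry_mem {B : Building} (hB : B.IsValid) {s e : Square}
    (h : B.CanEnter s e) : s ∈ B.cells := by
  obtain ⟨x, hx, rfl, h⟩ := h
  exact (hB.entries_adj x hx s h).1

theorem Building.IsValid.cells_nonempty {B : Building} (hB : B.IsValid) : B.cells.Nonempty := by
  obtain ⟨⟨x, hx⟩⟩ := hB.connected.nonempty
  exact ⟨x, hx⟩

/-! ### The routes traced by a scheme -/

section Scheme

variable {B : Building} {S : Finset Square} {T : ℕ} {D : ℕ → Finset Square}
  {σ : ℕ → Square → Square}

theorem IsScheme.traj_mem (h : IsScheme B S T D σ) {c : Square} (hc : c ∈ S) (t : ℕ)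
    (ht : ∀ u ≤ t, traj σ c u ∈ B.cells) : traj σ c t ∈ D t := by
  induction t with
  | zero => rw [h.start]; exact hc
  | succ t ih => exact h.next t _ (ih fun u hu => ht u (by omega)) (ht _ le_rfl)

theorem traj_mem_of_lt {c : Square} {t : ℕ} (ht : t < exitTime B σ c) : traj σ c t ∈ B.cells := by
  have := Nat.notMem_of_lt_sInf ht
  simpa using this

theorem IsScheme.exists_exit (h : IsScheme B S T D σ) {c : Square} (hc : c ∈ S) :
    ∃ t ≤ T, traj σ c t ∉ B.cells := by
  by_contra! hcon
  have := h.traj_mem hc T hcon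
  simp [h.done] at this

theorem IsScheme.exitTime_le (h : IsScheme B S T D σ) {c : Square} (hc : c ∈ S) :
    exitTime B σ c ≤ T := by
  obtain ⟨t, ht, hx⟩ := h.exists_exit hc
  exact (Nat.sInf_le hx).trans ht

theorem IsScheme.traj_exitTime (h : IsScheme B S T D σ) {c : Square} (hc : c ∈ S) :
    traj σ c (exitTime B σ c) ∉ B.cells := by
  obtain ⟨t, -, hx⟩ := h.exists_exit hc
  exact Nat.sInf_mem (s := {t | traj σ c t ∉ B.cells}) ⟨t, hx⟩

theorem IsScheme.traj_mem_of_lt (h : IsScheme B S T D σ) {c : Square} (hc : c ∈ S) {t : ℕ}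
    (ht : t < exitTime B σ c) : traj σ c t ∈ D t :=
  h.traj_mem hc t fun _ hu => Evac.traj_mem_of_lt (hu.trans_lt ht)

theorem IsScheme.exitTime_pos (h : IsScheme B S T D σ) {c : Square} (hc : c ∈ S) :
    0 < exitTime B σ c := by
  rcases Nat.eq_zero_or_pos (exitTime B σ c) with h0 | h0
  · have := h.traj_exitTime hc
    rw [h0] at this
    exact absurd (h.sub 0 (h.start ▸ hc)) this
  · exact h0

/-- Injectivity of the moves is applied backwards in time: two persons who are in one place were in
one place a step earlier, and so on down to time 0. -/
theorem IsScheme.traj_inj (h : IsScheme B S T D σ) {c d : Square} (hc : c ∈ S) (hd : d ∈ S) (t : ℕ)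
    (h1 : t ≤ exitTime B σ c) (h2 : t ≤ exitTime B σ d) (he : traj σ c t = traj σ d t) : c = d := by
  induction t with
  | zero => exact he
  | succ t ih =>
    exact ih (by omega) (by omega) (h.inj t (h.traj_mem_of_lt hc (by omega))
      (h.traj_mem_of_lt hd (by omega)) he)

theorem route_getElem? (c : Square) (t : ℕ) (x : Square) :
    (route B σ c)[t]? = some x ↔ t ≤ exitTime B σ c ∧ traj σ c t = x := by
  rw [route, List.getElem?_map]
  by_cases ht : t ≤ exitTime B σ c
  · rw [List.getElem?_range (by omega)]; simp [ht]
  · rw [List.getElem?_eq_none (by simp; omega)]; simp [ht]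

theorem IsScheme.isRoute (hB : B.IsValid) (h : IsScheme B S T D σ) {c : Square} (hc : c ∈ S) :
    IsRoute B (route B σ c) := by
  obtain ⟨m, hm⟩ : ∃ m, exitTime B σ c = m + 1 := ⟨_, (Nat.succ_pred (h.exitTime_pos hc).ne').symm⟩
  have heq : (List.range m).map (traj σ c) ++ [traj σ c m] = (List.range (m + 1)).map (traj σ c) := by
    rw [List.range_succ, List.map_append]; rfl
  refine ⟨(List.range m).map (traj σ c), traj σ c m, traj σ c (m + 1), ?_, ?_, ?_, ?_⟩
  · rw [route, hm, List.range_succ, List.range_succ]; simp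
  · rw [heq]
    intro x hx
    simp only [List.mem_map, List.mem_range] at hx
    obtain ⟨t, ht, rfl⟩ := hx
    exact Evac.traj_mem_of_lt (by omega)
  · rw [heq, List.isChain_iff_getElem]
    intro i hi
    simp only [List.length_map, List.length_range] at hi
    simp only [List.getElem_map, List.getElem_range]
    rcases h.step i _ (h.traj_mem_of_lt hc (t := i) (by omega)) with h1 | h1
    · exact h1.2
    · exfalso
      have hmem : σ i (traj σ c i) ∈ B.cells :=
        Evac.traj_mem_of_lt (B := B) (σ := σ) (c := c) (t := i + 1) (by omega)
      exact hB.exit_notMem h1 hmem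
  · rcases h.step m _ (h.traj_mem_of_lt hc (t := m) (by omega)) with h1 | h1
    · have := h.traj_exitTime hc
      rw [hm] at this
      exact absurd h1.1 this
    · exact h1

/-- The list `l` leaves the order of the routes free, since the program outputs them in the order of
its own numbering of the squares. -/
theorem IsScheme.isEvacuation (hB : B.IsValid) (h : IsScheme B B.cells T D σ) (ha : IsAcyclicScheme D σ)
    (l : List Square) (hl : l.Nodup) (hmem : ∀ c, c ∈ l ↔ c ∈ B.cells) :
    IsEvacuation B T (l.map (route B σ)) where
  isRoute r hr := by
    obtain ⟨c, hc, rfl⟩ := List.mem_map.1 hr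
    exact h.isRoute hB ((hmem c).1 hc)
  occupied c hc := ⟨_, List.mem_map_of_mem ((hmem c).2 hc), (route_getElem? c 0 c).2 ⟨by omega, rfl⟩⟩
  disjoint := by
    rw [List.pairwise_map]
    refine hl.imp_of_mem fun {c d} hc hd hne t x => ?_
    rw [route_getElem?, route_getElem?]
    rintro ⟨⟨h1, h2⟩, h3, h4⟩
    exact hne (h.traj_inj ((hmem c).1 hc) ((hmem d).1 hd) t h1 h3 (h2.trans h4.symm))
  acyclic t := by
    -- The rank of a square is the number of squares that can be reached from it by moves. By
    -- acyclicity this set shrinks strictly along a move, and it is finite since all its members are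
    -- end points of moves.
    refine ⟨fun c => {d | Relation.TransGen (Moves D σ t) c d}.ncard, fun r hr c c' h1 h2 hne => ?_⟩
    obtain ⟨a, hal, rfl⟩ := List.mem_map.1 hr
    rw [route_getElem?] at h1 h2
    obtain ⟨-, rfl⟩ := h1
    obtain ⟨h2, rfl⟩ := h2
    have hm : Moves D σ t (traj σ a t) (traj σ a (t + 1)) :=
      ⟨h.traj_mem_of_lt ((hmem a).1 hal) h2, rfl, hne⟩
    refine Set.ncard_lt_ncard ⟨fun d hd => Relation.TransGen.head hm hd, fun hsub => ?_⟩ ?_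
    · exact ha t _ (hsub (Relation.TransGen.single hm))
    · refine ((D t).image (σ t)).finite_toSet.subset fun d hd => ?_
      obtain ⟨b, -, hb⟩ := Relation.TransGen.tail'_iff.1 hd
      simp only [Finset.coe_image, Set.mem_image]
      exact ⟨b, hb.1, hb.2.1⟩
  inTime r hr := by
    obtain ⟨c, hc, rfl⟩ := List.mem_map.1 hr
    have := h.exitTime_le ((hmem c).1 hc)
    simp [route]; omega

/-! #### Removing cycles -/

/-- The square `c` is on a cycle of the map `f`, all of it in `D`. -/
def OnCycle (D : Finset Square) (f : Square → Square) (c : Square) : Prop :=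
  ∃ k, 0 < k ∧ (∀ j < k, f^[j] c ∈ D) ∧ f^[k] c = c

/-- A cycle in `D` has at most as many members as `D`. -/
theorem OnCycle.exists_le_card {D : Finset Square} {f : Square → Square} {c : Square}
    (h : OnCycle D f c) : ∃ k ≤ D.card, 0 < k ∧ (∀ j < k, f^[j] c ∈ D) ∧ f^[k] c = c := by
  obtain ⟨k, hk, hD, hc⟩ := h
  have hper : c ∈ Function.periodicPts f := ⟨k, hk, hc⟩
  have hle : Function.minimalPeriod f c ≤ k := Function.IsPeriodicPt.minimalPeriod_le hk hc
  -- The iterates below the minimal period are distinct members of `D`.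
  refine ⟨Function.minimalPeriod f c, ?_, Function.minimalPeriod_pos_of_mem_periodicPts hper,
    fun j hj => hD j (by omega), Function.iterate_minimalPeriod⟩
  have := Finset.card_le_card_of_injOn (s := Finset.range (Function.minimalPeriod f c)) (t := D)
    (fun j => f^[j] c) (fun j hj => hD j (by simp at hj; omega)) (by
      intro a ha b hb
      exact Function.iterate_injOn_Iio_minimalPeriod (by simpa using ha) (by simpa using hb))
  simpa using this

open Classical in
/-- Persons on a cycle stay where they are. -/
noncomputable def uncycle (D : ℕ → Finset Square) (σ : ℕ → Square → Square) (i : ℕ) (c : Square) :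
    Square :=
  if OnCycle (D i) (σ i) c then c else σ i c

theorem OnCycle.mem {D : Finset Square} {f : Square → Square} {c : Square} (h : OnCycle D f c) :
    c ∈ D := by
  obtain ⟨k, hk, hD, -⟩ := h
  exact hD 0 hk

/-- A member of a cycle has a predecessor on the cycle. -/
theorem OnCycle.pred {D : Finset Square} {f : Square → Square} {c : Square} (h : OnCycle D f c) :
    ∃ d, OnCycle D f d ∧ f d = c := by
  obtain ⟨k, hk, hD, hc⟩ := h
  obtain ⟨k, rfl⟩ : ∃ m, k = m + 1 := ⟨k - 1, by omega⟩
  refine ⟨f^[k] c, ⟨k + 1, hk, fun j hj => ?_, ?_⟩, by rw [← Function.iterate_succ_apply' f, hc]⟩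
  · rcases j with - | j
    · exact hD k (by omega)
    · have : f^[j + 1] (f^[k] c) = f^[j] c := by
        rw [← Function.iterate_add_apply, show j + 1 + k = j + (k + 1) by omega,
          Function.iterate_add_apply, hc]
      rw [this]; exact hD j (by omega)
  · rw [← Function.iterate_add_apply, show k + 1 + k = k + (k + 1) by omega,
      Function.iterate_add_apply, hc]

/-- The map `σ i` permutes the squares of a cycle, so the same squares are filled if these persons
stay. Nobody else moves into a cycle: each of its members already has a predecessor on it, and `σ i`
is injective. -/
theorem IsScheme.uncycle (h : IsScheme B S T D σ) :
    IsScheme B S T D (uncycle D σ) where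
  start := h.start
  sub := h.sub
  step i c hc := by
    unfold Evac.uncycle
    split_ifs
    · exact Or.inl ⟨h.sub i hc, Or.inl rfl⟩
    · exact h.step i c hc
  next i c hc hm := by
    unfold Evac.uncycle at hm ⊢
    split_ifs at hm ⊢ with hcyc
    · obtain ⟨d, hd, hdc⟩ := hcyc.pred
      have := h.next i d hd.mem (by rw [hdc]; exact h.sub i hc)
      rwa [hdc] at this
    · exact h.next i c hc hm
  inj i c hc d hd he := by
    have aux : ∀ c d, d ∈ D i → OnCycle (D i) (σ i) c → c = σ i d → OnCycle (D i) (σ i) d := by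
      intro c d hd hcyc he
      obtain ⟨b, hb, hbc⟩ := hcyc.pred
      rwa [h.inj i hd hb.mem (he.symm.trans hbc.symm)]
    unfold Evac.uncycle at he
    split_ifs at he with h1 h2 h2
    · exact he
    · exact absurd (aux c d hd h1 he) h2
    · exact absurd (aux d c hc h2 he.symm) h1
    · exact h.inj i hc hd he
  done := h.done

/-- A cycle of moves that remain would be a cycle of `σ i` inside `D i`, but persons on such a cycle
stay. -/
theorem isAcyclicScheme_uncycle : IsAcyclicScheme D (uncycle D σ) := by
  intro i c hc
  have key : ∀ d, Relation.TransGen (Moves D (Evac.uncycle D σ) i) c d →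
      ∃ k, 0 < k ∧ (∀ j < k, (σ i)^[j] c ∈ D i) ∧ (σ i)^[k] c = d := by
    have one : ∀ a b, Moves D (Evac.uncycle D σ) i a b → a ∈ D i ∧ σ i a = b := by
      rintro a b ⟨h1, h2, h3⟩
      unfold Evac.uncycle at h2
      split_ifs at h2
      · exact absurd h2 h3
      · exact ⟨h1, h2⟩
    intro d hd
    induction hd with
    | single h =>
      obtain ⟨h1, h2⟩ := one _ _ h
      exact ⟨1, one_pos, fun j hj => by obtain rfl : j = 0 := by omega
                                        exact h1, h2⟩
    | tail _ h ih =>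
      obtain ⟨h1, h2⟩ := one _ _ h
      obtain ⟨k, hk, h3, h4⟩ := ih
      refine ⟨k + 1, by omega, fun j hj => ?_, by rw [Function.iterate_succ_apply', h4, h2]⟩
      rcases Nat.lt_succ_iff_lt_or_eq.1 hj with hj | rfl
      · exact h3 j hj
      · rwa [h4]
  have hcyc : OnCycle (D i) (σ i) c := key c hc
  obtain ⟨b, hb, -⟩ := Relation.TransGen.head'_iff.1 hc
  obtain ⟨-, h2, h3⟩ := hb
  unfold Evac.uncycle at h2
  rw [if_pos hcyc] at h2
  exact h3 h2

theorem IsScheme.exists_isEvacuation (hB : B.IsValid) (h : IsScheme B B.cells T D σ) :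
    ∃ R, IsEvacuation B T R :=
  ⟨_, h.uncycle.isEvacuation hB isAcyclicScheme_uncycle B.cells.toList (Finset.nodup_toList _)
    (by simp)⟩

end Scheme

/-! #### From evacuations to schemes -/

theorem IsRoute.getElem? {B : Building} {r : List Square} (h : IsRoute B r) {t : ℕ} {c : Square}
    (hc : r[t]? = some c) :
    (c ∈ B.cells ∧ ∃ d, r[t + 1]? = some d ∧ Step B c d) ∨
      (r.length = t + 1 ∧ ∃ s, B.CanEnter s c) := by
  obtain ⟨q, s, e, rfl, hcell, hchain, hent⟩ := h
  have hlen : (q ++ [s, e]).length = q.length + 2 := by simp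
  have ht : t < q.length + 2 := by
    by_contra hcon
    rw [List.getElem?_eq_none (by omega)] at hc
    simp at hc
  have heq : q ++ [s, e] = (q ++ [s]) ++ [e] := by simp
  have hget : ∀ u, u ≤ q.length → ∀ x, (q ++ [s, e])[u]? = some x → (q ++ [s])[u]? = some x := by
    intro u hu x hx
    rwa [heq, List.getElem?_append_left (by simp; omega)] at hx
  rcases Nat.lt_or_ge t (q.length + 1) with h1 | h1
  · left
    have hc' := hget t (by omega) c hc
    refine ⟨hcell c (List.mem_of_getElem? hc'), ?_⟩
    rcases Nat.lt_or_ge t q.length with h2 | h2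
    · have hl : t + 1 < (q ++ [s]).length := by simp; omega
      refine ⟨(q ++ [s])[t + 1], ?_, Or.inl ⟨hcell _ (List.getElem_mem _), ?_⟩⟩
      · rw [heq, List.getElem?_append_left hl, List.getElem?_eq_getElem hl]
      · have := (List.isChain_iff_getElem.1 hchain) t hl
        rw [List.getElem?_eq_getElem (by omega)] at hc'
        simp only [Option.some.injEq] at hc'
        rwa [hc'] at this
    · obtain rfl : t = q.length := by omega
      simp only [List.getElem?_append_right le_rfl, Nat.sub_self, List.getElem?_cons_zero,
        Option.some.injEq] at hc
      subst hc
      exact ⟨e, by simp, Or.inr hent⟩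
  · right
    obtain rfl : t = q.length + 1 := by omega
    refine ⟨hlen, s, ?_⟩
    simp at hc
    rwa [← hc]

-- Occupied squares and next places are read off the routes; by disjointness, the route through a
-- place at a given time is unique. The additional conclusion, that every square vacated later is
-- entered from one vacated a step before, is what conservation of flow will need.
open Classical in
theorem IsEvacuation.exists_isScheme {B : Building} (hB : B.IsValid) {T : ℕ} {R : List (List Square)}
    (h : IsEvacuation B T R) :
    ∃ D σ, IsScheme B B.cells T D σ ∧ ∀ i, ∀ c ∈ D (i + 1), ∃ d ∈ D i, σ i d = c := by
  have hex : ∀ i c, (∃ r ∈ R, r[i]? = some c) → c ∈ B.cells →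
      ∃ d, Step B c d ∧ ∃ r ∈ R, r[i]? = some c ∧ r[i + 1]? = some d := by
    rintro i c ⟨r, hr, hrc⟩ hc
    rcases (h.isRoute r hr).getElem? hrc with ⟨-, d, hd, hs⟩ | ⟨-, s, hs⟩
    · exact ⟨d, hs, r, hr, hrc, hd⟩
    · exact absurd hc (hB.exit_notMem hs)
  have huniq : ∀ (i : ℕ) (c : Square), ∀ r ∈ R, ∀ r' ∈ R, r[i]? = some c → r'[i]? = some c → r = r' := by
    intro i c r hr r' hr' h1 h2
    by_contra hne
    have : Std.Symm fun r r' : List Square =>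
        ∀ (t : ℕ) (c : Square), ¬ (r[t]? = some c ∧ r'[t]? = some c) :=
      ⟨fun a b hab t c hc => hab t c ⟨hc.2, hc.1⟩⟩
    exact h.disjoint.forall hr hr' hne i c ⟨h1, h2⟩
  let D : ℕ → Finset Square := fun i => B.cells.filter fun c => ∃ r ∈ R, r[i]? = some c
  have hD : ∀ i c, c ∈ D i ↔ c ∈ B.cells ∧ ∃ r ∈ R, r[i]? = some c := fun i c => by simp [D]
  let σ : ℕ → Square → Square := fun i c =>
    if hc : (∃ r ∈ R, r[i]? = some c) ∧ c ∈ B.cells then (hex i c hc.1 hc.2).choose else c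
  have hσ : ∀ i, ∀ c ∈ D i, Step B c (σ i c) ∧
      ∃ r ∈ R, r[i]? = some c ∧ r[i + 1]? = some (σ i c) := by
    intro i c hc
    have hc' := ((hD i c).1 hc).symm
    have : σ i c = (hex i c hc'.1 hc'.2).choose := dif_pos hc'
    rw [this]
    exact (hex i c hc'.1 hc'.2).choose_spec
  refine ⟨D, σ, ⟨?_, fun i => Finset.filter_subset _ _, fun i c hc => (hσ i c hc).1, ?_, ?_, ?_⟩, ?_⟩
  · exact Finset.filter_true_of_mem fun c hc => h.occupied c hc
  · intro i c hc hm
    obtain ⟨r, hr, -, h2⟩ := (hσ i c hc).2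
    exact (hD _ _).2 ⟨hm, r, hr, h2⟩
  · intro i c hc d hd he
    obtain ⟨r, hr, h1, h2⟩ := (hσ i c hc).2
    obtain ⟨r', hr', h1', h2'⟩ := (hσ i d hd).2
    obtain rfl := huniq (i + 1) _ r hr r' hr' h2 (by rw [he]; exact h2')
    simpa [h1] using h1'
  -- Somebody in the polygon at time `T` would also have a place at time `T + 1`, on a route with at
  -- least `T + 2` entries.
  · rw [Finset.eq_empty_iff_forall_notMem]
    intro c hc
    obtain ⟨r, hr, h1, h2⟩ := (hσ T c hc).2
    have := (List.getElem?_eq_some_iff.1 h2).1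
    have := h.inTime r hr
    omega
  · intro i c hc
    obtain ⟨hc, r, hr, hrc⟩ := (hD _ _).1 hc
    have hi : i < r.length := by
      have := (List.getElem?_eq_some_iff.1 hrc).1
      omega
    have hi' : r[i]? = some r[i] := List.getElem?_eq_getElem hi
    rcases (h.isRoute r hr).getElem? hi' with ⟨hm, -⟩ | ⟨hl, -⟩
    · have hd : r[i] ∈ D i := (hD _ _).2 ⟨hm, r, hr, hi'⟩
      refine ⟨r[i], hd, ?_⟩
      obtain ⟨r', hr', h1, h2⟩ := (hσ i _ hd).2
      obtain rfl := huniq i _ r hr r' hr' hi' h1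
      rw [hrc] at h2
      exact (Option.some.inj h2).symm
    · have := (List.getElem?_eq_some_iff.1 hrc).1
      omega

/-! #### Existence -/

/-- In each step only one person of least potential moves. If the potential is 0, an exit can be
entered; otherwise the neighbour of smaller potential is empty by minimality. In both cases `∑ (d c
+ 1)` decreases; the `+ 1` makes this true for departures at potential 0. -/
theorem exists_isScheme_of_potential {B : Building} (hB : B.IsValid) (d : Square → ℕ)
    (h0 : ∀ c ∈ B.cells, d c = 0 → ∃ e, B.CanEnter c e)
    (h1 : ∀ c ∈ B.cells, 0 < d c → ∃ c' ∈ B.cells, Adj c c' ∧ d c' < d c) (S : Finset Square)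
    (hS : S ⊆ B.cells) : ∃ T D σ, IsScheme B S T D σ := by
  induction hn : ∑ c ∈ S, (d c + 1) using Nat.strong_induction_on generalizing S with
  | _ n ih =>
  subst hn
  rcases S.eq_empty_or_nonempty with rfl | hne
  · exact ⟨0, fun _ => ∅, fun _ c => c, by constructor <;> simp⟩
  obtain ⟨c, hc, hmin⟩ := S.exists_min_image d hne
  have hsum : ∑ x ∈ S, (d x + 1) = ∑ x ∈ S.erase c, (d x + 1) + (d c + 1) :=
    (Finset.sum_erase_add _ _ hc).symm
  -- A step in which only the person in `c` moves, to `q`, is put in front of a scheme for the set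
  -- `S'` that results.
  have cons : ∀ q S', S' ⊆ B.cells → Step B c q → (∀ x ∈ S, x ≠ c → x ∈ S' ∧ x ≠ q) →
      (q ∈ B.cells → q ∈ S') → ∑ x ∈ S', (d x + 1) < ∑ x ∈ S, (d x + 1) →
      ∃ T D σ, IsScheme B S T D σ := by
    intro q S' hS' hq hx hqS hlt
    obtain ⟨T, D, σ, h⟩ := ih _ hlt S' hS' rfl
    refine ⟨T + 1, fun i => Nat.casesOn i S D, fun i => Nat.casesOn i (Function.update id c q) σ,
      rfl, ?_, ?_, ?_, ?_, h.done⟩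
    · rintro (- | i)
      exacts [hS, h.sub i]
    · rintro (- | i) x hxS
      · show Step B x (Function.update id c q x)
        by_cases hxc : x = c
        · subst hxc; simpa using hq
        · rw [Function.update_of_ne hxc]; exact Or.inl ⟨hS hxS, Or.inl rfl⟩
      · exact h.step i x hxS
    · rintro (- | i) x hxS hm
      · change Function.update id c q x ∈ B.cells at hm
        show Function.update id c q x ∈ D 0
        rw [h.start]
        by_cases hxc : x = c
        · subst hxc
          simp only [Function.update_self] at hm ⊢
          exact hqS hm
        · rw [Function.update_of_ne hxc]; exact (hx x hxS hxc).1
      · exact h.next i x hxS hm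
    · rintro (- | i)
      · intro x hxS y hyS he
        change Function.update id c q x = Function.update id c q y at he
        by_cases hxc : x = c <;> by_cases hyc : y = c
        · rw [hxc, hyc]
        · rw [hxc, Function.update_self, Function.update_of_ne hyc] at he
          exact absurd he.symm (hx y hyS hyc).2
        · rw [hyc, Function.update_self, Function.update_of_ne hxc] at he
          exact absurd he (hx x hxS hxc).2
        · rwa [Function.update_of_ne hxc, Function.update_of_ne hyc] at he
      · exact h.inj i
  rcases Nat.eq_zero_or_pos (d c) with hd | hd
  · obtain ⟨e, he⟩ := h0 c (hS hc) hd
    have hne := hB.exit_notMem he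
    refine cons e (S.erase c) ((Finset.erase_subset _ _).trans hS) (Or.inr he)
      (fun x hx hxc => ⟨Finset.mem_erase.2 ⟨hxc, hx⟩, ?_⟩) (fun h => absurd h hne) (by omega)
    rintro rfl; exact hne (hS hx)
  · obtain ⟨c', hc', hadj, hlt⟩ := h1 c (hS hc) hd
    have hc'S : c' ∉ S := fun h => by have := hmin c' h; omega
    refine cons c' (insert c' (S.erase c))
      (Finset.insert_subset hc' ((Finset.erase_subset _ _).trans hS)) (Or.inl ⟨hc', Or.inr hadj⟩)
      (fun x hx hxc => ⟨Finset.mem_insert_of_mem (Finset.mem_erase.2 ⟨hxc, hx⟩), ?_⟩)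
      (fun _ => Finset.mem_insert_self _ _) ?_
    · rintro rfl; exact hc'S hx
    · rw [Finset.sum_insert (fun h => hc'S (Finset.mem_of_mem_erase h))]; omega

/-- The distance within the polygon from one fixed entry square serves as the potential; the first
step of a shortest walk lowers it. -/
theorem exists_isScheme {B : Building} (hB : B.IsValid) : ∃ T D σ, IsScheme B B.cells T D σ := by
  obtain ⟨x, hx⟩ := List.exists_mem_of_ne_nil _ hB.exits_ne_nil
  obtain ⟨s, hs⟩ := List.exists_mem_of_ne_nil _ (hB.entries_ne_nil x hx)
  have hsc := (hB.entries_adj x hx s hs).1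
  let G := gridGraph.induce (B.cells : Set Square)
  obtain ⟨s', hs'⟩ : ∃ s' : (B.cells : Set Square), s'.1 = s := ⟨⟨s, hsc⟩, rfl⟩
  classical
  let d : Square → ℕ := fun c => if h : c ∈ B.cells then G.dist ⟨c, h⟩ s' else 0
  have hd : ∀ c (h : c ∈ B.cells), d c = G.dist ⟨c, h⟩ s' := fun c h => dif_pos h
  refine exists_isScheme_of_potential hB d (fun c hc h => ?_) (fun c hc h => ?_) _ subset_rfl
  · rw [hd c hc] at h
    have := (hB.connected.dist_eq_zero_iff).1 h
    obtain rfl : c = s := (congrArg Subtype.val this).trans hs'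
    exact ⟨x.1, x, hx, rfl, hs⟩
  · rw [hd c hc] at h ⊢
    obtain ⟨w, hw⟩ := hB.connected.exists_walk_length_eq_dist ⟨c, hc⟩ s'
    cases w with
    | nil => simp [G] at h
    | @cons _ v _ hadj p =>
      refine ⟨v.1, v.2, hadj, ?_⟩
      rw [hd v.1 v.2, show G.dist ⟨c, hc⟩ s' = _ from hw.symm]
      have := SimpleGraph.dist_le p
      simp only [SimpleGraph.Walk.length_cons]
      exact Nat.lt_succ_of_le this

end Evac

/-! ### Evacuations and flows in the time-expanded network -/

namespace Evac

open NetVertex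

/-! ### The arcs at each vertex of the network, and the cut at the source -/

section Arcs

variable {B : Building} {T : ℕ}

theorem source_arc {v : NetVertex} :
    (source, v) ∈ (timeExpanded B T).arcs ↔ ∃ c ∈ B.cells, v = inn c 0 := by
  simp [timeExpanded, eq_comm]

theorem inn_arc {q : Square} {i : ℕ} {v : NetVertex} :
    (inn q i, v) ∈ (timeExpanded B T).arcs ↔
      (q ∈ B.cells ∨ q ∈ B.exitSquares) ∧ i < T ∧ v = out q i := by
  simp only [timeExpanded, Finset.mem_union, Finset.mem_image, Finset.mem_filter,
    Finset.mem_product, Finset.mem_range, Prod.mk.injEq]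
  constructor
  · rintro ((((h | h) | h) | h) | h)
    · simp at h
    · obtain ⟨⟨a, j⟩, ⟨h1, h2⟩, h6, rfl⟩ := h
      simp only [inn.injEq] at h6
      obtain ⟨rfl, rfl⟩ := h6
      exact ⟨h1, h2, rfl⟩
    · simp at h
    · simp at h
    · simp at h
  · rintro ⟨h1, h2, rfl⟩
    exact Or.inl (Or.inl (Or.inl (Or.inr ⟨(q, i), ⟨h1, h2⟩, rfl, rfl⟩)))

theorem arc_inn {q : Square} {i : ℕ} {v : NetVertex} :
    (v, inn q i) ∈ (timeExpanded B T).arcs ↔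
      (q ∈ B.cells ∧ i = 0 ∧ v = source) ∨
      (q ∈ B.cells ∧ ∃ c ∈ B.cells, ∃ j, i = j + 1 ∧ i < T ∧ (c = q ∨ Adj c q) ∧ v = out c j) ∨
      (q ∈ B.exitSquares ∧ i < T ∧ ∃ c ∈ B.cells, B.CanEnter c q ∧ v = out c i) := by
  simp only [timeExpanded, Finset.mem_union, Finset.mem_image, Finset.mem_filter,
    Finset.mem_product, Finset.mem_range, Prod.mk.injEq]
  constructor
  · rintro ((((h | h) | h) | h) | h)
    · obtain ⟨a, hc, rfl, h⟩ := h
      simp only [inn.injEq] at h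
      obtain ⟨rfl, rfl⟩ := h
      exact Or.inl ⟨hc, rfl, rfl⟩
    · simp at h
    · obtain ⟨⟨a, a', j⟩, ⟨⟨h1, h2, h3⟩, h4, h5⟩, rfl, h6⟩ := h
      simp only [inn.injEq] at h6
      obtain ⟨rfl, rfl⟩ := h6
      exact Or.inr (Or.inl ⟨h2, _, h1, j, rfl, h5, h4, rfl⟩)
    · obtain ⟨⟨a, a', j⟩, ⟨⟨h1, h2, h3⟩, h4⟩, rfl, h6⟩ := h
      simp only [inn.injEq] at h6
      obtain ⟨rfl, rfl⟩ := h6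
      exact Or.inr (Or.inr ⟨h2, h3, _, h1, h4, rfl⟩)
    · simp at h
  · rintro (⟨h1, rfl, rfl⟩ | ⟨h1, c, h2, j, rfl, h3, h4, rfl⟩ | ⟨h1, h2, c, h3, h4, rfl⟩)
    · exact Or.inl (Or.inl (Or.inl (Or.inl ⟨q, h1, rfl, rfl⟩)))
    · exact Or.inl (Or.inl (Or.inr ⟨(c, q, j), ⟨⟨h2, h1, Nat.lt_of_succ_lt h3⟩, h4, h3⟩, rfl, rfl⟩))
    · exact Or.inl (Or.inr ⟨(c, q, i), ⟨⟨h3, h1, h2⟩, h4⟩, rfl, rfl⟩)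

theorem out_arc {q : Square} {i : ℕ} {v : NetVertex} :
    (out q i, v) ∈ (timeExpanded B T).arcs ↔
      (q ∈ B.cells ∧ ∃ c ∈ B.cells, i + 1 < T ∧ (q = c ∨ Adj q c) ∧ v = inn c (i + 1)) ∨
      (q ∈ B.cells ∧ i < T ∧ ∃ e ∈ B.exitSquares, B.CanEnter q e ∧ v = inn e i) ∨
      (q ∈ B.exitSquares ∧ i < T ∧ v = sink) := by
  simp only [timeExpanded, Finset.mem_union, Finset.mem_image, Finset.mem_filter,
    Finset.mem_product, Finset.mem_range, Prod.mk.injEq]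
  constructor
  · rintro ((((h | h) | h) | h) | h)
    · simp at h
    · simp at h
    · obtain ⟨⟨a, a', j⟩, ⟨⟨h1, h2, h3⟩, h4, h5⟩, h6, rfl⟩ := h
      simp only [out.injEq] at h6
      obtain ⟨rfl, rfl⟩ := h6
      exact Or.inl ⟨h1, _, h2, h5, h4, rfl⟩
    · obtain ⟨⟨a, a', j⟩, ⟨⟨h1, h2, h3⟩, h4⟩, h6, rfl⟩ := h
      simp only [out.injEq] at h6
      obtain ⟨rfl, rfl⟩ := h6
      exact Or.inr (Or.inl ⟨h1, h3, _, h2, h4, rfl⟩)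
    · obtain ⟨⟨a, j⟩, ⟨h1, h2⟩, h6, rfl⟩ := h
      simp only [out.injEq] at h6
      obtain ⟨rfl, rfl⟩ := h6
      exact Or.inr (Or.inr ⟨h1, h2, rfl⟩)
  · rintro (⟨h1, c, h2, h3, h4, rfl⟩ | ⟨h1, h2, e, h3, h4, rfl⟩ | ⟨h1, h2, rfl⟩)
    · exact Or.inl (Or.inl (Or.inr ⟨(q, c, i), ⟨⟨h1, h2, Nat.lt_of_succ_lt h3⟩, h4, h3⟩, rfl, rfl⟩))
    · exact Or.inl (Or.inr ⟨(q, e, i), ⟨⟨h1, h3, h2⟩, h4⟩, rfl, rfl⟩)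
    · exact Or.inr ⟨(q, i), ⟨h1, h2⟩, rfl, rfl⟩

theorem arc_out {q : Square} {i : ℕ} {v : NetVertex} :
    (v, out q i) ∈ (timeExpanded B T).arcs ↔
      (q ∈ B.cells ∨ q ∈ B.exitSquares) ∧ i < T ∧ v = inn q i := by
  cases v with
  | source => simp [source_arc]
  | sink => simp [timeExpanded]
  | inn q' j =>
    simp only [inn_arc, out.injEq, inn.injEq]
    constructor <;> (rintro ⟨h1, h2, rfl, rfl⟩; exact ⟨h1, h2, rfl, rfl⟩)
  | out q' j => simp [out_arc]

theorem arc_source {v : NetVertex} : (v, source) ∉ (timeExpanded B T).arcs := by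
  simp [timeExpanded]

theorem timeExpanded_value (f : NetVertex × NetVertex → ℝ) :
    (timeExpanded B T).value f = ∑ c ∈ B.cells, f (source, inn c 0) := by
  have h1 : (timeExpanded B T).arcs.filter (fun a => a.2 = (timeExpanded B T).source) = ∅ := by
    rw [Finset.filter_eq_empty_iff]
    rintro ⟨u, v⟩ ha rfl
    exact arc_source ha
  have h2 : (timeExpanded B T).arcs.filter (fun a => a.1 = (timeExpanded B T).source) =
      B.cells.image fun c => (source, inn c 0) := by
    ext ⟨u, v⟩
    simp only [Finset.mem_filter, Finset.mem_image, Prod.mk.injEq]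
    constructor
    · rintro ⟨ha, rfl⟩
      obtain ⟨c, hc, rfl⟩ := source_arc.1 ha
      exact ⟨c, hc, rfl, rfl⟩
    · rintro ⟨c, hc, rfl, rfl⟩
      exact ⟨source_arc.2 ⟨c, hc, rfl⟩, rfl⟩
  rw [FlowNetwork.value, h1, h2, Finset.sum_empty, sub_zero, Finset.sum_image]
  intro a _ b _ h
  simpa using h

/-- The arcs at the source are a cut of capacity `B.area`. Hence a flow that attains this value is
automatically maximum. -/
theorem value_le_area {f : NetVertex × NetVertex → ℝ} (hf : (timeExpanded B T).IsFlow f) :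
    (timeExpanded B T).value f ≤ B.area := by
  rw [timeExpanded_value]
  calc ∑ c ∈ B.cells, f (source, inn c 0) ≤ ∑ c ∈ B.cells, (1 : ℝ) :=
        Finset.sum_le_sum fun c hc => (hf.1 _ (source_arc.2 ⟨c, hc, rfl⟩)).2
    _ = B.area := by simp [Building.area]

end Arcs

theorem mem_exitSquares {B : Building} {e : Square} :
    e ∈ B.exitSquares ↔ ∃ x ∈ B.exits, x.1 = e := by
  simp [Building.exitSquares]

theorem Building.CanEnter.mem_exitSquares {B : Building} {s e : Square} (h : B.CanEnter s e) :
    e ∈ B.exitSquares := by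
  obtain ⟨x, hx, rfl, -⟩ := h
  exact Evac.mem_exitSquares.2 ⟨x, hx, rfl⟩

theorem Building.IsValid.exitSquare_notMem {B : Building} (hB : B.IsValid) {e : Square}
    (h : e ∈ B.exitSquares) : e ∉ B.cells := by
  obtain ⟨x, hx, rfl⟩ := mem_exitSquares.1 h
  exact hB.exits_outside x hx

theorem sum_indicator_eq_one {α : Type*} [DecidableEq α] (s : Finset α) (p : α → Prop)
    [DecidablePred p] (a : α) (ha : a ∈ s) (hp : p a) (hu : ∀ b ∈ s, p b → b = a) :
    ∑ b ∈ s, (if p b then (1 : ℝ) else 0) = 1 := by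
  rw [Finset.sum_eq_single a (fun b hb hne => if_neg fun h => hne (hu b hb h))
    (fun h => absurd ha h), if_pos hp]

theorem sum_indicator_eq_zero {α : Type*} (s : Finset α) (p : α → Prop)
    [DecidablePred p] (hu : ∀ b ∈ s, ¬ p b) :
    ∑ b ∈ s, (if p b then (1 : ℝ) else 0) = 0 :=
  Finset.sum_eq_zero fun b hb => if_neg (hu b hb)

/-- The arcs that the persons of a scheme use. -/
def Uses (B : Building) (D : ℕ → Finset Square) (σ : ℕ → Square → Square) :
    NetVertex × NetVertex → Prop
  | (source, inn c _) => c ∈ B.cells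
  | (inn q i, out _ _) => q ∈ D i ∨ (q ∈ B.exitSquares ∧ ∃ d ∈ D i, σ i d = q)
  | (out c i, inn q _) => c ∈ D i ∧ σ i c = q
  | (out e i, sink) => ∃ d ∈ D i, σ i d = e
  | _ => False

-- The flow is the indicator of the arcs that are used. Each inner vertex lies on the path of
-- exactly one person or of none: uniqueness of the incoming arc is injectivity of the moves, and
-- its existence at later times is `tight`.
open Classical in
theorem IsScheme.exists_flow {B : Building} (hB : B.IsValid) {T : ℕ} {D : ℕ → Finset Square}
    {σ : ℕ → Square → Square} (h : IsScheme B B.cells T D σ)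
    (tight : ∀ i, ∀ c ∈ D (i + 1), ∃ d ∈ D i, σ i d = c) :
    ∃ f : NetVertex × NetVertex → ℝ, (timeExpanded B T).IsFlow f ∧
      (timeExpanded B T).IsIntegral f ∧ (timeExpanded B T).value f = B.area := by
  -- Emptiness of `D T` spreads to all later times by `tight`, so all arcs in use belong to existing
  -- copies.
  have hlt : ∀ i, ∀ c ∈ D i, i < T := by
    intro i c hc
    by_contra! hcon
    have : ∀ k, D (T + k) = ∅ := by
      intro k
      induction k with
      | zero => exact h.done
      | succ k ih =>
        rw [Finset.eq_empty_iff_forall_notMem]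
        intro c hc
        obtain ⟨d, hd, -⟩ := tight (T + k) c hc
        rw [ih] at hd; simp at hd
    have h2 := this (i - T)
    rw [Nat.add_sub_cancel' hcon] at h2
    rw [h2] at hc; simp at hc
  let f : NetVertex × NetVertex → ℝ := fun a => if Uses B D σ a then 1 else 0
  -- Conservation for an indicator. The proposition `P` says that the vertex is in use; then both
  -- sums are 1, and otherwise both are 0.
  have key : ∀ v, ∀ (P : Prop), 
      (P → (∃ u, (u, v) ∈ (timeExpanded B T).arcs ∧ Uses B D σ (u, v)) ∧
        ∃ w, (v, w) ∈ (timeExpanded B T).arcs ∧ Uses B D σ (v, w)) →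
      (∀ u, (u, v) ∈ (timeExpanded B T).arcs → Uses B D σ (u, v) → P) → 
      (∀ w, (v, w) ∈ (timeExpanded B T).arcs → Uses B D σ (v, w) → P) → 
      (∀ u u', (u, v) ∈ (timeExpanded B T).arcs → Uses B D σ (u, v) →
        (u', v) ∈ (timeExpanded B T).arcs → Uses B D σ (u', v) → u' = u) →
      (∀ u u', (v, u) ∈ (timeExpanded B T).arcs → Uses B D σ (v, u) →
        (v, u') ∈ (timeExpanded B T).arcs → Uses B D σ (v, u') → u' = u) →
      ∑ a ∈ (timeExpanded B T).arcs with a.2 = v, f a =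
        ∑ a ∈ (timeExpanded B T).arcs with a.1 = v, f a := by
    intro v P h1 h2 h3 h4 h5
    by_cases hP : P
    · obtain ⟨⟨u, hu, hu'⟩, w, hw, hw'⟩ := h1 hP
      refine (sum_indicator_eq_one
        ((timeExpanded B T).arcs.filter fun a => a.2 = v) (Uses B D σ) (u, v) (Finset.mem_filter.2 ⟨hu, rfl⟩) hu' ?_).trans
        (sum_indicator_eq_one ((timeExpanded B T).arcs.filter fun a => a.1 = v)
          (Uses B D σ) (v, w) (Finset.mem_filter.2 ⟨hw, rfl⟩) hw' ?_).symm
      · rintro ⟨x, y⟩ hb hx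
        obtain ⟨hb', rfl⟩ := Finset.mem_filter.1 hb
        rw [h4 _ _ hu hu' hb' hx]
      · rintro ⟨x, y⟩ hb hx
        obtain ⟨hb', rfl⟩ := Finset.mem_filter.1 hb
        rw [h5 _ _ hw hw' hb' hx]
    · refine (sum_indicator_eq_zero _ (Uses B D σ) ?_).trans
        (sum_indicator_eq_zero _ (Uses B D σ) ?_).symm
      · rintro ⟨x, y⟩ hb hx
        obtain ⟨hb', rfl⟩ := Finset.mem_filter.1 hb
        exact hP (h2 _ hb' hx)
      · rintro ⟨x, y⟩ hb hx
        obtain ⟨hb', rfl⟩ := Finset.mem_filter.1 hb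
        exact hP (h3 _ hb' hx)
  refine ⟨f, ⟨fun a _ => ?_, fun v hv1 hv2 => ?_⟩, fun a _ => ?_, ?_⟩
  · show 0 ≤ (if Uses B D σ a then (1 : ℝ) else 0) ∧ (if Uses B D σ a then (1 : ℝ) else 0) ≤ 1
    split_ifs <;> norm_num
  · cases v with
    | source => exact absurd rfl hv1
    | sink => exact absurd rfl hv2
    | inn q i =>
      refine key _ (q ∈ D i ∨ (q ∈ B.exitSquares ∧ ∃ d ∈ D i, σ i d = q)) ?_ ?_ ?_ ?_ ?_
      · intro hq
        constructor
        · rcases hq with hq | ⟨hq, d, hd, hdq⟩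
          · rcases i with - | i
            · exact ⟨source, arc_inn.2 (Or.inl ⟨h.sub _ hq, rfl, rfl⟩), h.sub _ hq⟩
            · obtain ⟨d, hd, rfl⟩ := tight i q hq
              refine ⟨out d i, arc_inn.2 (Or.inr (Or.inl ⟨h.sub _ hq, d, h.sub _ hd, i, rfl,
                hlt _ _ hq, ?_, rfl⟩)), hd, rfl⟩
              rcases h.step i d hd with h1 | h1
              · exact h1.2
              · exact absurd (h.sub _ hq) (hB.exit_notMem h1)
          · refine ⟨out d i, arc_inn.2 (Or.inr (Or.inr ⟨hq, hlt _ _ hd, d, h.sub _ hd, ?_, rfl⟩)),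
              hd, hdq⟩
            rcases h.step i d hd with h1 | h1
            · exact absurd (hdq ▸ h1.1) (hB.exitSquare_notMem hq)
            · exact hdq ▸ h1
        · refine ⟨out q i, inn_arc.2 ⟨?_, ?_, rfl⟩, hq⟩
          · rcases hq with hq | ⟨hq, -⟩
            exacts [Or.inl (h.sub _ hq), Or.inr hq]
          · rcases hq with hq | ⟨-, d, hd, -⟩
            exacts [hlt _ _ hq, hlt _ _ hd]
      · intro u hu hU
        rcases arc_inn.1 hu with ⟨h1, rfl, rfl⟩ | ⟨h1, c, hc, j, rfl, h2, h3, rfl⟩ |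
          ⟨h1, h2, c, hc, h3, rfl⟩
        · exact Or.inl (by rw [h.start]; exact h1)
        · obtain ⟨h4, rfl⟩ := hU
          exact Or.inl (h.next _ _ h4 h1)
        · exact Or.inr ⟨h1, c, hU.1, hU.2⟩
      · intro w hw hU
        obtain ⟨-, -, rfl⟩ := inn_arc.1 hw
        exact hU
      · intro u u' hu hU hu' hU'
        rcases arc_inn.1 hu with ⟨h1, rfl, rfl⟩ | ⟨h1, c, hc, j, rfl, h2, h3, rfl⟩ |
          ⟨h1, h2, c, hc, h3, rfl⟩ <;>
        rcases arc_inn.1 hu' with ⟨h1', h2', rfl⟩ | ⟨h1', c', hc', j', h4', h2', h3', rfl⟩ |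
          ⟨h1', h2', c', hc', h3', rfl⟩
        · rfl
        · omega
        · exact absurd h1 (hB.exitSquare_notMem h1')
        · omega
        · obtain rfl : j = j' := by omega
          rw [h.inj j hU'.1 hU.1 (hU'.2.trans hU.2.symm)]
        · exact absurd h1 (hB.exitSquare_notMem h1')
        · exact absurd h1' (hB.exitSquare_notMem h1)
        · exact absurd h1' (hB.exitSquare_notMem h1)
        · rw [h.inj i hU'.1 hU.1 (hU'.2.trans hU.2.symm)]
      · intro u u' hu _ hu' _
        rw [(inn_arc.1 hu).2.2, (inn_arc.1 hu').2.2]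
    | out q i =>
      refine key _ (q ∈ D i ∨ (q ∈ B.exitSquares ∧ ∃ d ∈ D i, σ i d = q)) ?_ ?_ ?_ ?_ ?_
      · intro hq
        constructor
        · refine ⟨inn q i, arc_out.2 ⟨?_, ?_, rfl⟩, hq⟩
          · rcases hq with hq | ⟨hq, -⟩
            exacts [Or.inl (h.sub _ hq), Or.inr hq]
          · rcases hq with hq | ⟨-, d, hd, -⟩
            exacts [hlt _ _ hq, hlt _ _ hd]
        · rcases hq with hq | ⟨hq, d, hd, hdq⟩
          · rcases h.step i q hq with h1 | h1
            · exact ⟨inn (σ i q) (i + 1), out_arc.2 (Or.inl ⟨h.sub _ hq, _, h1.1,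
                hlt _ _ (h.next _ _ hq h1.1), h1.2, rfl⟩), hq, rfl⟩
            · exact ⟨inn (σ i q) i, out_arc.2 (Or.inr (Or.inl ⟨h.sub _ hq, hlt _ _ hq, _,
                h1.mem_exitSquares, h1, rfl⟩)), hq, rfl⟩
          · exact ⟨sink, out_arc.2 (Or.inr (Or.inr ⟨hq, hlt _ _ hd, rfl⟩)), d, hd, hdq⟩
      · intro u hu hU
        obtain ⟨-, -, rfl⟩ := arc_out.1 hu
        exact hU
      · intro w hw hU
        rcases out_arc.1 hw with ⟨h1, c, h2, h3, h4, rfl⟩ | ⟨h1, h2, e, h3, h4, rfl⟩ | ⟨h1, h2, rfl⟩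
        · exact Or.inl hU.1
        · exact Or.inl hU.1
        · exact Or.inr ⟨h1, hU⟩
      · intro u u' hu _ hu' _
        rw [(arc_out.1 hu).2.2, (arc_out.1 hu').2.2]
      · intro u u' hu hU hu' hU'
        rcases out_arc.1 hu with ⟨h1, c, h2, h3, h4, rfl⟩ | ⟨h1, h2, e, h3, h4, rfl⟩ |
          ⟨h1, h2, rfl⟩ <;>
        rcases out_arc.1 hu' with ⟨h1', c', h2', h3', h4', rfl⟩ | ⟨h1', h2', e', h3', h4', rfl⟩ |
          ⟨h1', h2', rfl⟩
        · rw [← hU.2, ← hU'.2]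
        · rw [← hU.2] at h2
          rw [← hU'.2] at h3'
          exact absurd h2 (hB.exitSquare_notMem h3')
        · exact absurd h1 (hB.exitSquare_notMem h1')
        · rw [← hU'.2] at h2'
          rw [← hU.2] at h3
          exact absurd h2' (hB.exitSquare_notMem h3)
        · rw [← hU.2, ← hU'.2]
        · exact absurd h1 (hB.exitSquare_notMem h1')
        · exact absurd h1' (hB.exitSquare_notMem h1)
        · exact absurd h1' (hB.exitSquare_notMem h1)
        · rfl
  · by_cases hU : Uses B D σ a
    · exact ⟨1, by simp [f, hU]⟩
    · exact ⟨0, by simp [f, hU]⟩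
  · rw [timeExpanded_value, Building.area, Finset.cast_card]
    exact Finset.sum_congr rfl fun c hc => if_pos hc

/-- Integrality and unit capacities make the flow 0-1, and its value forces every arc at the source
to carry 1. An in-vertex has a single outgoing arc, so at most one unit enters it: nobody meets
anybody. The squares vacated at time `i` are those whose internal arc in copy `i` carries a unit. -/
theorem exists_isScheme_of_flow {B : Building} (hB : B.IsValid) {T : ℕ}
    {f : NetVertex × NetVertex → ℝ} (hf : (timeExpanded B T).IsFlow f)
    (hint : (timeExpanded B T).IsIntegral f) (hval : (timeExpanded B T).value f = B.area) :
    ∃ D σ, IsScheme B B.cells T D σ := by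
  classical
  obtain ⟨hcap, hcons⟩ := hf
  have h01 : ∀ a ∈ (timeExpanded B T).arcs, f a ≠ 0 → f a = 1 := by
    intro a ha hne
    obtain ⟨z, hz⟩ := hint a ha
    obtain ⟨h1, h2⟩ := hcap a ha
    change f a ≤ 1 at h2
    rw [hz] at h1 h2 hne ⊢
    have : (0 : ℤ) ≤ z := by exact_mod_cast h1
    have : z ≤ 1 := by exact_mod_cast h2
    have : z ≠ 0 := by rintro rfl; simp at hne
    obtain rfl : z = 1 := by omega
    simp
  have hsrc : ∀ c ∈ B.cells, f (source, inn c 0) = 1 := by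
    rw [timeExpanded_value, Building.area, Finset.cast_card] at hval
    exact (Finset.sum_eq_sum_iff_of_le fun c hc => (hcap _ (source_arc.2 ⟨c, hc, rfl⟩)).2).1 hval
  -- Whatever enters an in-vertex has to leave by the internal arc, if there is one.
  have hin_le : ∀ q i, ∑ a ∈ (timeExpanded B T).arcs with a.2 = inn q i, f a ≤ 
      if (inn q i, out q i) ∈ (timeExpanded B T).arcs then f (inn q i, out q i) else 0 := by
    intro q i
    rw [hcons (inn q i) (by simp [timeExpanded]) (by simp [timeExpanded])]
    split_ifs with hm
    · apply le_of_eq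
      refine Finset.sum_eq_single_of_mem _ (Finset.mem_filter.2 ⟨hm, rfl⟩) ?_
      rintro ⟨u, v⟩ ha hne
      obtain ⟨ha', rfl⟩ := Finset.mem_filter.1 ha
      exact absurd (by rw [(inn_arc.1 ha').2.2]) hne
    · apply le_of_eq
      refine Finset.sum_eq_zero ?_
      rintro ⟨u, v⟩ ha
      obtain ⟨ha, rfl⟩ := Finset.mem_filter.1 ha
      have := (inn_arc.1 ha).2.2
      subst this
      exact absurd ha hm
  -- If the internal arc does not exist, no unit can enter. This settles `T = 0`, where the arcs at
  -- the source lead to dead ends.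
  have hpass : ∀ q i u, (u, inn q i) ∈ (timeExpanded B T).arcs → f (u, inn q i) = 1 →
      (inn q i, out q i) ∈ (timeExpanded B T).arcs ∧ f (inn q i, out q i) = 1 := by
    intro q i u hu hu1
    have h1 := hin_le q i
    have h2 : f (u, inn q i) ≤ ∑ a ∈ (timeExpanded B T).arcs with a.2 = inn q i, f a :=
      Finset.single_le_sum (f := f) (fun a ha => (hcap a (Finset.mem_filter.1 ha).1).1)
        (Finset.mem_filter.2 ⟨hu, rfl⟩)
    rw [hu1] at h2
    split_ifs at h1 with hm
    · exact ⟨hm, h01 _ hm (by linarith)⟩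
    · linarith
  have huniq : ∀ q i u u', (u, inn q i) ∈ (timeExpanded B T).arcs → f (u, inn q i) = 1 →
      (u', inn q i) ∈ (timeExpanded B T).arcs → f (u', inn q i) = 1 → u = u' := by
    intro q i u u' hu hu1 hu' hu1'
    by_contra hne
    have h1 := hin_le q i
    rw [if_pos (hpass q i u hu hu1).1, (hpass q i u hu hu1).2] at h1
    have h2 : ∑ a ∈ {(u, inn q i), (u', inn q i)}, f a ≤
        ∑ a ∈ (timeExpanded B T).arcs with a.2 = inn q i, f a := by
      refine Finset.sum_le_sum_of_subset_of_nonneg ?_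
        (fun a ha _ => (hcap a (Finset.mem_filter.1 ha).1).1)
      intro a ha
      simp only [Finset.mem_insert, Finset.mem_singleton] at ha
      rcases ha with rfl | rfl
      exacts [Finset.mem_filter.2 ⟨hu, rfl⟩, Finset.mem_filter.2 ⟨hu', rfl⟩]
    rw [Finset.sum_pair (by simpa using hne), hu1, hu1'] at h2
    linarith
  let D : ℕ → Finset Square := fun i => B.cells.filter fun c =>
    (inn c i, out c i) ∈ (timeExpanded B T).arcs ∧ f (inn c i, out c i) = 1
  have hD : ∀ i c, c ∈ D i ↔ c ∈ B.cells ∧ (inn c i, out c i) ∈ (timeExpanded B T).arcs ∧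
    f (inn c i, out c i) = 1 := fun i c => by simp [D]
  have hnext : ∀ i c, ∃ q, c ∈ D i →
      ∃ j, (out c i, inn q j) ∈ (timeExpanded B T).arcs ∧ f (out c i, inn q j) = 1 := by
    intro i c
    by_cases hc : c ∈ D i
    swap
    · exact ⟨c, fun h => absurd h hc⟩
    obtain ⟨hcell, hm, h1⟩ := (hD i c).1 hc
    have hcons' := hcons (out c i) (by simp [timeExpanded]) (by simp [timeExpanded])
    have h2 : f (inn c i, out c i) ≤ ∑ a ∈ (timeExpanded B T).arcs with a.2 = out c i, f a :=
      Finset.single_le_sum (f := f) (fun a ha => (hcap a (Finset.mem_filter.1 ha).1).1)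
        (Finset.mem_filter.2 ⟨hm, rfl⟩)
    have hne : ∑ a ∈ (timeExpanded B T).arcs with a.1 = out c i, f a ≠ 0 := by
      rw [← hcons']; linarith
    obtain ⟨⟨u, v⟩, ha, hav⟩ := Finset.exists_ne_zero_of_sum_ne_zero hne
    obtain ⟨ha, rfl⟩ := Finset.mem_filter.1 ha
    have hv1 := h01 _ ha hav
    rcases out_arc.1 ha with ⟨h1, c', h2, h3, h4, rfl⟩ | ⟨h1, h2, e, h3, h4, rfl⟩ | ⟨h1, h2, rfl⟩
    · exact ⟨c', fun _ => ⟨_, ha, hv1⟩⟩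
    · exact ⟨e, fun _ => ⟨_, ha, hv1⟩⟩
    · exact absurd hcell (hB.exitSquare_notMem h1)
  choose σ hσ using hnext
  have harc : ∀ i c q j, (out c i, inn q j) ∈ (timeExpanded B T).arcs →
      Step B c q ∧ (q ∈ B.cells → j = i + 1) ∧ (q ∉ B.cells → j = i) := by
    intro i c q j ha
    rcases out_arc.1 ha with ⟨h1, c', h2, h3, h4, h5⟩ | ⟨h1, h2, e, h3, h4, h5⟩ | ⟨h1, h2, h5⟩
    · simp only [inn.injEq] at h5
      obtain ⟨rfl, rfl⟩ := h5
      exact ⟨Or.inl ⟨h2, h4⟩, fun _ => rfl, fun h => absurd h2 h⟩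
    · simp only [inn.injEq] at h5
      obtain ⟨rfl, rfl⟩ := h5
      exact ⟨Or.inr h4, fun h => absurd h (hB.exitSquare_notMem h3), fun _ => rfl⟩
    · cases h5
  refine ⟨D, σ, ?_, fun i => Finset.filter_subset _ _, fun i c hc => ?_, fun i c hc hm => ?_,
    fun i c hc d hd he => ?_, ?_⟩
  · exact Finset.filter_true_of_mem fun c hc =>
      hpass c 0 source (source_arc.2 ⟨c, hc, rfl⟩) (hsrc c hc)
  · obtain ⟨j, h1, -⟩ := hσ i c hc
    exact (harc _ _ _ _ h1).1
  · obtain ⟨j, h1, h2⟩ := hσ i c hc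
    obtain rfl := (harc _ _ _ _ h1).2.1 hm
    exact (hD _ _).2 ⟨hm, hpass _ _ _ h1 h2⟩
  · obtain ⟨j, h1, h2⟩ := hσ i c hc
    obtain ⟨k, h3, h4⟩ := hσ i d hd
    rw [← he] at h3 h4
    -- The copy in which a move ends is determined by its target: the next copy for a square of the
    -- polygon, the present one for an exit.
    have hjk : j = k := by
      by_cases hm : σ i c ∈ B.cells
      · rw [(harc _ _ _ _ h1).2.1 hm, (harc _ _ _ _ h3).2.1 hm]
      · rw [(harc _ _ _ _ h1).2.2 hm, (harc _ _ _ _ h3).2.2 hm]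
    subst hjk
    have := huniq _ _ _ _ h1 h2 h3 h4
    simpa using this
  -- The copies have numbers below `T`, so there is no internal arc for time `T`.
  · rw [Finset.eq_empty_iff_forall_notMem]
    intro c hc
    have := (inn_arc.1 ((hD _ _).1 hc).2.1).2.1
    omega

theorem exists_isEvacuation_iff_exists_flow {B : Building} (hB : B.IsValid) (T : ℕ) :
    (∃ R, IsEvacuation B T R) ↔
      ∃ f : NetVertex × NetVertex → ℝ, (timeExpanded B T).IsMaxFlow f ∧
        (timeExpanded B T).IsIntegral f ∧ (timeExpanded B T).value f = B.area := by
  constructor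
  · rintro ⟨R, hR⟩
    obtain ⟨D, σ, h, ht⟩ := hR.exists_isScheme hB
    obtain ⟨f, h1, h2, h3⟩ := h.exists_flow hB ht
    exact ⟨f, ⟨h1, fun g hg => by rw [h3]; exact value_le_area hg⟩, h2, h3⟩
  · rintro ⟨f, h1, h2, h3⟩
    obtain ⟨D, σ, h⟩ := exists_isScheme_of_flow hB h1.1 h2 h3
    exact h.exists_isEvacuation hB

end Evac

/-! ### An auction algorithm for bipartite matching -/

namespace Auction

/-- A matching of all left vertices `0, …, nL - 1` along edges from the list `E`. -/
def IsMatching (E : List (ℤ × ℤ)) (nL : ℕ) (m : ℤ → ℤ) : Prop :=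
  (∀ u : ℤ, 0 ≤ u → u < nL → (u, m u) ∈ E) ∧
    ∀ u v : ℤ, 0 ≤ u → u < nL → 0 ≤ v → v < nL → m u = m v → u = v

/-- The invariant of the auction: `owner` and `mate` (with the value `-1` for `none`) describe a
partial matching, only matched vertices have a positive price, and every matched left vertex has an
almost cheapest neighbour. -/
structure Inv (E : List (ℤ × ℤ)) (nL nR : ℕ) (price owner mate : ℤ → ℤ) : Prop where
  mate_edge : ∀ u : ℤ, 0 ≤ u → u < nL → mate u ≠ -1 → (u, mate u) ∈ E ∧ owner (mate u) = u
  owner_mate : ∀ r : ℤ, 0 ≤ r → r < nR → owner r ≠ -1 →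
    0 ≤ owner r ∧ owner r < nL ∧ mate (owner r) = r
  price_nonneg : ∀ r : ℤ, 0 ≤ r → r < nR → 0 ≤ price r
  price_free : ∀ r : ℤ, 0 ≤ r → r < nR → owner r = -1 → price r = 0
  price_le : ∀ r : ℤ, 0 ≤ r → r < nR → price r ≤ nL
  slack : ∀ u : ℤ, 0 ≤ u → u < nL → mate u ≠ -1 → ∀ r, (u, r) ∈ E → price (mate u) ≤ price r + 1

/-- The left vertex `u` outbids the present owner of `r`. -/
def bidMate (owner mate : ℤ → ℤ) (u r : ℤ) : ℤ → ℤ :=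
  Function.update (if 0 ≤ owner r then Function.update mate (owner r) (-1) else mate) u r

section

variable {E : List (ℤ × ℤ)} {nL nR : ℕ} {price owner mate : ℤ → ℤ}

/-- Prices only rise, so all who keep their mates keep their slack. The bidder ends up with a price
one above the minimum, which is just what the slack permits, and the displaced owner becomes
unmatched. Since bids are made only at prices below `nL`, no price exceeds `nL`. -/
theorem Inv.bid (hE : ∀ e ∈ E, 0 ≤ e.2 ∧ e.2 < nR) (h : Inv E nL nR price owner mate) {u r : ℤ}
    (hu0 : 0 ≤ u) (hu : u < nL) (hmu : mate u = -1) (hur : (u, r) ∈ E) (hr : price r < nL)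
    (hmin : ∀ r', (u, r') ∈ E → price r ≤ price r') :
    Inv E nL nR (Function.update price r (price r + 1)) (Function.update owner r u)
      (bidMate owner mate u r) := by
  obtain ⟨hr0, hrR⟩ := hE _ hur
  simp only at hr0 hrR
  have howner : owner r ≠ -1 → 0 ≤ owner r ∧ owner r < nL ∧ mate (owner r) = r :=
    h.owner_mate r hr0 hrR
  have hm : ∀ v, bidMate owner mate u r v =
      if v = u then r else if 0 ≤ owner r ∧ v = owner r then -1 else mate v := by
    intro v
    unfold bidMate
    rw [Function.update_apply]
    split_ifs with h1 h2 h3 h3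
    · rfl
    · rw [h3.2, Function.update_self]
    · rw [Function.update_of_ne fun h4 => h3 ⟨h2, h4⟩]
    · exact absurd h3.1 h2
    · rfl
  constructor
  · intro v hv0 hv hne
    rw [hm] at hne ⊢
    split_ifs at hne ⊢ with h1 h2
    · subst h1; exact ⟨hur, by simp⟩
    · exact absurd rfl hne
    · obtain ⟨h3, h4⟩ := h.mate_edge v hv0 hv hne
      refine ⟨h3, ?_⟩
      rw [Function.update_apply]
      split_ifs with h5
      · rw [h5] at h4
        exact absurd ⟨by omega, h4.symm⟩ h2
      · exact h4
  · intro r' h0 h1 hne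
    rw [Function.update_apply] at hne ⊢
    split_ifs at hne ⊢ with h2
    · exact ⟨hu0, hu, by rw [hm, if_pos rfl, h2]⟩
    · obtain ⟨h3, h4, h5⟩ := h.owner_mate r' h0 h1 hne
      refine ⟨h3, h4, ?_⟩
      rw [hm]
      have h6 : owner r' ≠ u := by rintro h6; rw [h6, hmu] at h5; omega
      rw [if_neg h6, if_neg, h5]
      rintro ⟨h7, h8⟩
      have := (howner (by omega)).2.2
      rw [← h8, h5] at this
      exact h2 this
  · intro r' h0 h1
    have := h.price_nonneg r' h0 h1
    have := h.price_nonneg r hr0 hrR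
    rw [Function.update_apply]; split_ifs <;> omega
  · intro r' h0 h1 h2
    rw [Function.update_apply] at h2 ⊢
    split_ifs at h2 ⊢ with h3
    · omega
    · exact h.price_free r' h0 h1 h2
  · intro r' h0 h1
    have := h.price_le r' h0 h1
    rw [Function.update_apply]; split_ifs <;> omega
  · intro v hv0 hv hne r' hr'
    have hle : price r' ≤ Function.update price r (price r + 1) r' := by
      rw [Function.update_apply]; split_ifs with h1
      · subst h1; omega
      · exact le_rfl
    rw [hm] at hne ⊢
    split_ifs at hne ⊢ with h1 h2
    · subst h1
      have := hmin r' hr'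
      rw [Function.update_self]; omega
    · exact absurd rfl hne
    · have h3 := h.slack v hv0 hv hne r' hr'
      have h4 : mate v ≠ r := by
        intro h4
        have := (h.mate_edge v hv0 hv hne).2
        rw [h4] at this
        exact h2 ⟨by omega, this.symm⟩
      rw [Function.update_of_ne h4]; omega

theorem Inv.sum_price_le (h : Inv E nL nR price owner mate) :
    ∑ r ∈ Finset.Ico (0 : ℤ) nR, price r ≤ nR * nL := by
  have := Finset.sum_le_card_nsmul (Finset.Ico (0 : ℤ) nR) price nL fun r hr => by
    rw [Finset.mem_Ico] at hr; exact h.price_le r hr.1 hr.2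
  simpa using this

/-- The total price measures progress: it is bounded by `Inv.sum_price_le`, so only boundedly many
bids can be made. -/
theorem sum_price_bid {r : ℤ} (hr0 : 0 ≤ r) (hr : r < nR) :
    ∑ x ∈ Finset.Ico (0 : ℤ) nR, Function.update price r (price r + 1) x =
      ∑ x ∈ Finset.Ico (0 : ℤ) nR, price x + 1 := by
  have hm : r ∈ Finset.Ico (0 : ℤ) nR := Finset.mem_Ico.2 ⟨hr0, hr⟩
  rw [Finset.sum_update_of_mem hm, Finset.sdiff_singleton_eq_erase, ← Finset.add_sum_erase _ _ hm]
  ring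

/-- If some unmatched vertex can no longer bid, then there is no matching. -/
theorem Inv.not_isMatching (hE : ∀ e ∈ E, 0 ≤ e.2 ∧ e.2 < nR) (h : Inv E nL nR price owner mate)
    {u : ℤ} (hu0 : 0 ≤ u) (hu : u < nL) (hmu : mate u = -1)
    (hstuck : ∀ r, (u, r) ∈ E → (nL : ℤ) ≤ price r) (m : ℤ → ℤ) : ¬ IsMatching E nL m := by
  rintro ⟨hm, hinj⟩
  have hown : ∀ r : ℤ, 0 ≤ r → r < nR → 0 < price r →
      0 ≤ owner r ∧ owner r < nL ∧ mate (owner r) = r := fun r h0 h1 h2 =>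
    h.owner_mate r h0 h1 fun h3 => by have := h.price_free r h0 h1 h3; omega
  -- Positive prices occur only at right vertices with an owner, and owners are different from `u`,
  -- so there are at most `nL - 1` of them. Hence one of the levels `1, …, nL` is not the price of
  -- anything.
  obtain ⟨k, hk1, hkL, hk⟩ : ∃ k : ℤ, 1 ≤ k ∧ k ≤ nL ∧ ∀ r : ℤ, 0 ≤ r → r < nR → price r ≠ k := by
    by_contra! hcon
    choose! r hr0 hr1 hr2 using hcon
    have := Finset.card_le_card_of_injOn (s := Finset.Icc (1 : ℤ) nL)
      (t := (Finset.Ico (0 : ℤ) nL).erase u) (fun k => owner (r k)) (fun k hk => by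
        simp only [Finset.coe_Icc, Set.mem_Icc] at hk
        obtain ⟨h1, h2, h3⟩ := hown (r k) (hr0 k hk.1 hk.2) (hr1 k hk.1 hk.2)
          (by rw [hr2 k hk.1 hk.2]; omega)
        have := hr0 k hk.1 hk.2
        simp only [Finset.coe_erase, Finset.coe_Ico, Set.mem_sdiff, Set.mem_Ico,
          Set.mem_singleton_iff]
        refine ⟨⟨h1, h2⟩, fun h4 => ?_⟩
        rw [h4, hmu] at h3; omega) (by
        intro a ha b hb hab
        simp only [Finset.coe_Icc, Set.mem_Icc] at ha hb
        have h1 := (hown (r a) (hr0 a ha.1 ha.2) (hr1 a ha.1 ha.2)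
          (by rw [hr2 a ha.1 ha.2]; omega)).2.2
        have h2 := (hown (r b) (hr0 b hb.1 hb.2) (hr1 b hb.1 hb.2)
          (by rw [hr2 b hb.1 hb.2]; omega)).2.2
        simp only at hab
        rw [hab, h2] at h1
        rw [← hr2 a ha.1 ha.2, ← hr2 b hb.1 hb.2, h1])
    rw [Finset.card_erase_of_mem (Finset.mem_Ico.2 ⟨hu0, hu⟩)] at this
    simp at this
    omega
  -- The set `S` violates Hall's condition: all its neighbours lie in `R`, but the owners of `R` are
  -- in `S` without `u`.
  let S : Finset ℤ := (Finset.Ico (0 : ℤ) nL).filter fun v =>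
    v = u ∨ (mate v ≠ -1 ∧ k < price (mate v))
  let R : Finset ℤ := (Finset.Ico (0 : ℤ) nR).filter fun r => k < price r
  have h1 : S.card ≤ R.card := by
    refine Finset.card_le_card_of_injOn m (fun v hv => ?_) fun v hv w hw he => ?_
    · simp only [S, Finset.coe_filter, Finset.mem_Ico, Set.mem_ofPred_eq] at hv
      obtain ⟨⟨hv0, hv1⟩, hv⟩ := hv
      have he := hm v hv0 hv1
      obtain ⟨hr0, hr1⟩ := hE _ he
      simp only [R, Finset.coe_filter, Finset.mem_Ico, Set.mem_ofPred_eq]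
      refine ⟨⟨hr0, hr1⟩, ?_⟩
      -- A neighbour of `u` costs at least `nL`, and one of another member of `S` at least the price
      -- of its mate minus 1; so it costs at least `k`. As no price equals `k`, it costs more.
      have hne := hk _ hr0 hr1
      simp only at hne
      rcases hv with rfl | ⟨h2, h3⟩
      · have := hstuck _ he; omega
      · have := h.slack v hv0 hv1 h2 _ he; omega
    · simp only [S, Finset.coe_filter, Finset.mem_Ico, Set.mem_ofPred_eq] at hv hw
      exact hinj v w hv.1.1 hv.1.2 hw.1.1 hw.1.2 he
  have h2 : R.card ≤ (S.erase u).card := by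
    refine Finset.card_le_card_of_injOn owner (fun r hr => ?_) fun r hr r' hr' he => ?_
    · simp only [R, Finset.coe_filter, Finset.mem_Ico, Set.mem_ofPred_eq] at hr
      obtain ⟨⟨hr0, hr1⟩, hr⟩ := hr
      obtain ⟨h3, h4, h5⟩ := hown r hr0 hr1 (by omega)
      simp only [S, Finset.coe_erase, Finset.coe_filter, Finset.mem_Ico, Set.mem_sdiff,
        Set.mem_ofPred_eq, Set.mem_singleton_iff]
      refine ⟨⟨⟨h3, h4⟩, Or.inr ⟨by omega, by rwa [h5]⟩⟩, fun h6 => ?_⟩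
      rw [h6, hmu] at h5; omega
    · simp only [R, Finset.coe_filter, Finset.mem_Ico, Set.mem_ofPred_eq] at hr hr'
      have h3 := (hown r hr.1.1 hr.1.2 (by omega)).2.2
      have h4 := (hown r' hr'.1.1 hr'.1.2 (by omega)).2.2
      rw [← h3, ← h4, he]
  have hmem : u ∈ S := Finset.mem_filter.2 ⟨Finset.mem_Ico.2 ⟨hu0, hu⟩, Or.inl rfl⟩
  rw [Finset.card_erase_of_mem hmem] at h2
  have := Finset.card_pos.2 ⟨u, hmem⟩
  omega

/-- A complete auction yields a matching. -/
theorem Inv.isMatching (h : Inv E nL nR price owner mate)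
    (hdone : ∀ u : ℤ, 0 ≤ u → u < nL → mate u ≠ -1) : IsMatching E nL mate := by
  refine ⟨fun u h0 h1 => (h.mate_edge u h0 h1 (hdone u h0 h1)).1, fun u v h0 h1 h2 h3 he => ?_⟩
  rw [← (h.mate_edge u h0 h1 (hdone u h0 h1)).2, he, (h.mate_edge v h2 h3 (hdone v h2 h3)).2]

end

end Auction

/-! ### Schemes as bipartite matchings -/

namespace Evac

/-- A numbering of the squares of the polygon by `0, …, A - 1`, and of the exits by `A, …, M - 1`. -/
structure IsNumbering (B : Building) (A M : ℕ) (X : ℤ → Square) : Prop where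
  le : A ≤ M
  mem_cells : ∀ s, s ∈ B.cells ↔ ∃ c : ℕ, c < A ∧ X c = s
  inj : ∀ a b : ℕ, a < M → b < M → X a = X b → a = b
  notMem_cells : ∀ q : ℕ, A ≤ q → q < M → X q ∉ B.cells
  exit : ∀ s e, B.CanEnter s e → ∃ q : ℕ, q < M ∧ X q = e

/-- The pairs `(c, q)` such that one can go from the square number `c` to the place number `q`. -/
def IsArcList (B : Building) (A M : ℕ) (X : ℤ → Square) (l : List (ℤ × ℤ)) : Prop :=
  ∀ u r, (u, r) ∈ l ↔ ∃ c q : ℕ, c < A ∧ q < M ∧ Step B (X c) (X q) ∧ u = c ∧ r = q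

/-- The edges that concern the persons who vacate a square at time `i`: from `(i, c)` to `(i + 1, q)`
if one can go from `c` to `q`, and from `(i, c)` to `(i, c)` if `0 < i`, for the case that there is
nobody in `c`. -/
def layer (A M T : ℕ) (l : List (ℤ × ℤ)) (i : ℕ) : List (ℤ × ℤ) :=
  (l.filter fun b => (A : ℤ) ≤ b.2 ∨ i + 1 < T).map
      (fun b => ((i * A + b.1 : ℤ), ((i + 1) * M + b.2 : ℤ))) ++
    if 0 < i then (List.range A).map fun c : ℕ => ((i * A + c : ℤ), (i * M + c : ℤ)) else []

/-- The bipartite graph whose matchings are the schemes for `T` time steps. -/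
def timeArcs (A M T : ℕ) (l : List (ℤ × ℤ)) : List (ℤ × ℤ) :=
  (List.range T).flatMap (layer A M T l)

section Matching

variable {B : Building} {A M T : ℕ} {X : ℤ → Square} {l : List (ℤ × ℤ)}

theorem mem_timeArcs (hl : IsArcList B A M X l) (u r : ℤ) :
    (u, r) ∈ timeArcs A M T l ↔ ∃ i c : ℕ, i < T ∧ c < A ∧ u = (i * A + c : ℕ) ∧
      ((∃ q : ℕ, q < M ∧ (A ≤ q ∨ i + 1 < T) ∧ Step B (X c) (X q) ∧
          r = ((i + 1) * M + q : ℕ)) ∨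
        (0 < i ∧ r = (i * M + c : ℕ))) := by
  simp only [timeArcs, layer, List.mem_flatMap, List.mem_range, List.mem_append, List.mem_map,
    List.mem_filter, decide_eq_true_eq, Prod.mk.injEq]
  constructor
  · rintro ⟨i, hi, ⟨⟨c, q⟩, ⟨h1, h2⟩, rfl, rfl⟩ | h⟩
    · obtain ⟨c, q, hc, hq, hs, rfl, rfl⟩ := (hl _ _).1 h1
      exact ⟨i, c, hi, hc, by push_cast; ring, Or.inl ⟨q, hq, by simpa using h2, hs, by push_cast; ring⟩⟩
    · split_ifs at h with h0
      · simp only [List.mem_map, List.mem_range, Prod.mk.injEq] at h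
        obtain ⟨c, hc, rfl, rfl⟩ := h
        exact ⟨i, c, hi, hc, by push_cast; ring, Or.inr ⟨h0, by push_cast; ring⟩⟩
      · simp at h
  · rintro ⟨i, c, hi, hc, rfl, ⟨q, hq, h2, hs, rfl⟩ | ⟨h0, rfl⟩⟩
    · refine ⟨i, hi, Or.inl ⟨(c, q), ⟨(hl _ _).2 ⟨c, q, hc, hq, hs, rfl, rfl⟩, by simpa using h2⟩,
        by push_cast; ring, by push_cast; ring⟩⟩
    · refine ⟨i, hi, Or.inr ?_⟩
      rw [if_pos h0]
      exact List.mem_map.2 ⟨c, List.mem_range.2 hc, by push_cast; rfl⟩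

theorem mul_add_inj {M i j q q' : ℕ} (hq : q < M) (hq' : q' < M) (h : i * M + q = j * M + q') :
    i = j ∧ q = q' := by
  have h1 : i = j := by
    have := congrArg (· / M) h
    simpa [Nat.add_div_of_dvd_right, Nat.div_eq_of_lt hq, Nat.div_eq_of_lt hq',
      Nat.pos_of_ne_zero (by omega : M ≠ 0)] using this
  subst h1
  exact ⟨rfl, by omega⟩

theorem timeArcs_bounds (hX : IsNumbering B A M X) (hl : IsArcList B A M X l) :
    ∀ e ∈ timeArcs A M T l, 0 ≤ e.2 ∧ e.2 < ((T + 1) * M : ℕ) := by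
  rintro ⟨u, r⟩ he
  obtain ⟨i, c, hi, hc, -, h⟩ := (mem_timeArcs hl u r).1 he
  have := hX.le
  rcases h with ⟨q, hq, -, -, rfl⟩ | ⟨-, rfl⟩
  · refine ⟨by positivity, ?_⟩
    have : (i + 1) * M + q < (T + 1) * M := by nlinarith
    exact Int.ofNat_lt.2 this
  · refine ⟨by positivity, ?_⟩
    have : i * M + c < (T + 1) * M := by nlinarith
    exact Int.ofNat_lt.2 this

theorem IsNumbering.exists_num (hX : IsNumbering B A M X) {s q : Square} (h : Step B s q) :
    ∃ k : ℕ, k < M ∧ X k = q := by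
  rcases h with h | h
  · obtain ⟨c, hc, hq⟩ := (hX.mem_cells q).1 h.1
    exact ⟨c, hc.trans_le hX.le, hq⟩
  · exact hX.exit _ _ h

theorem IsNumbering.mem_cells_iff (hX : IsNumbering B A M X) {q : ℕ} (hq : q < M) :
    X q ∈ B.cells ↔ q < A := by
  constructor
  · intro h; by_contra hcon
    exact hX.notMem_cells q (by omega) hq h
  · intro h; exact (hX.mem_cells _).2 ⟨q, h, rfl⟩

/-- A vacated square is matched to the next place of its person, an empty one to its own copy. These
choices do not collide, because a square in which somebody arrives is vacated at the next time and
does not use its own copy. -/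
theorem IsScheme.exists_isMatching (hX : IsNumbering B A M X)
    (hl : IsArcList B A M X l) {D : ℕ → Finset Square} {σ : ℕ → Square → Square}
    (h : IsScheme B B.cells T D σ) : ∃ m, Auction.IsMatching (timeArcs A M T l) (T * A) m := by
  classical
  have hnum : ∀ i c, ∃ k : ℕ, X c ∈ D i → k < M ∧ X k = σ i (X c) := by
    intro i c
    by_cases hc : X c ∈ D i
    · obtain ⟨k, hk⟩ := hX.exists_num (h.step i _ hc)
      exact ⟨k, fun _ => hk⟩
    · exact ⟨0, fun h => absurd h hc⟩
  choose num hnum using hnum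
  let m' : ℕ → ℕ → ℕ := fun i c => if X c ∈ D i then (i + 1) * M + num i c else i * M + c
  let m : ℤ → ℤ := fun u => m' (u.toNat / A) (u.toNat % A)
  have hsplit : ∀ u : ℤ, 0 ≤ u → u < (T * A : ℕ) → ∃ i c : ℕ, i < T ∧ c < A ∧ u = (i * A + c : ℕ) ∧
      m u = m' i c := by
    intro u h0 h1
    have hA : 0 < A := by
      rcases Nat.eq_zero_or_pos A with h2 | h2
      · subst h2; push_cast at h1; omega
      · exact h2
    refine ⟨u.toNat / A, u.toNat % A, ?_, Nat.mod_lt _ hA, ?_, rfl⟩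
    · rw [Nat.div_lt_iff_lt_mul hA]; omega
    · have := Nat.div_add_mod' u.toNat A
      omega
  have hcell : ∀ c : ℕ, c < A → X c ∈ B.cells := fun c hc => (hX.mem_cells _).2 ⟨c, hc, rfl⟩
  refine ⟨m, fun u h0 h1 => ?_, fun u v hu0 hu1 hv0 hv1 he => ?_⟩
  · obtain ⟨i, c, hi, hc, rfl, hm⟩ := hsplit u h0 h1
    rw [mem_timeArcs hl]
    refine ⟨i, c, hi, hc, rfl, ?_⟩
    rw [hm]
    by_cases hD : X c ∈ D i
    · obtain ⟨h2, h3⟩ := hnum i c hD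
      refine Or.inl ⟨num i c, h2, ?_, by rw [h3]; exact h.step i _ hD, by simp only [m', if_pos hD]⟩
      -- A last move into a square of the polygon would put that square into `D T`.
      by_contra! hcon
      have h4 : X (num i c) ∈ D (i + 1) := by
        rw [h3]; exact h.next i _ hD (h3 ▸ hcell _ hcon.1)
      obtain rfl : i + 1 = T := by omega
      simp [h.done] at h4
    · refine Or.inr ⟨?_, by simp only [m', if_neg hD]⟩
      rcases Nat.eq_zero_or_pos i with rfl | h2
      · exact absurd (h.start ▸ hcell c hc) hD
      · exact h2
  · obtain ⟨i, c, hi, hc, rfl, hm⟩ := hsplit u hu0 hu1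
    obtain ⟨j, d, hj, hd, rfl, hm'⟩ := hsplit v hv0 hv1
    rw [hm, hm'] at he
    have he : m' i c = m' j d := by exact_mod_cast he
    have hcM := hc.trans_le hX.le
    have hdM := hd.trans_le hX.le
    -- The only mixed collision would be between an arrival and an empty square at the place of
    -- arrival.
    have clash : ∀ i c j d, c < A → d < A → X (c : ℕ) ∈ D i → X (d : ℕ) ∉ D j →
        (i + 1) * M + num i c = j * M + d → False := by
      intro i c j d hc hd h2 h3 he
      obtain ⟨h4, h5⟩ := hnum i c h2
      obtain ⟨rfl, h6⟩ := mul_add_inj h4 (hd.trans_le hX.le) he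
      rw [h6] at h5
      exact h3 (h5 ▸ h.next i _ h2 (h5 ▸ hcell d hd))
    simp only [m'] at he
    split_ifs at he with h2 h3 h3
    · obtain ⟨h4, h5⟩ := hnum i c h2
      obtain ⟨h6, h7⟩ := hnum j d h3
      obtain ⟨h8, h9⟩ := mul_add_inj h4 h6 he
      obtain rfl : i = j := by omega
      rw [h9] at h5
      have := hX.inj _ _ hcM hdM (h.inj i h2 h3 (h5.symm.trans h7))
      rw [this]
    · exact (clash i c j d hc hd h2 h3 he).elim
    · exact (clash j d i c hd hc h3 h2 he.symm).elim
    · obtain ⟨rfl, rfl⟩ := mul_add_inj hcM hdM he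
      rfl

/-- The place to which the person in the square number `c` goes at time `i`, and a negative number
if nobody is there. -/
def target (A M : ℕ) (m : ℤ → ℤ) (i : ℕ) (c : ℤ) : ℤ :=
  m (i * A + c) - (i + 1) * M

open Classical in
/-- The squares that are vacated at time `i`. -/
noncomputable def activeCells (A M T : ℕ) (X : ℤ → Square) (m : ℤ → ℤ) (i : ℕ) : Finset Square :=
  if i < T then
    ((Finset.range A).filter fun c : ℕ => 0 ≤ target A M m i c).image fun c : ℕ => X c
  else ∅

open Classical in
/-- The move that a matching prescribes. -/
noncomputable def matchMove (A M : ℕ) (X : ℤ → Square) (m : ℤ → ℤ) (i : ℕ) (s : Square) : Square :=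
  if h : ∃ c : ℕ, c < A ∧ X c = s then X (target A M m i h.choose) else s

theorem matchMove_apply (hX : IsNumbering B A M X) (m : ℤ → ℤ) (i : ℕ) {c : ℕ} (hc : c < A) :
    matchMove A M X m i (X c) = X (target A M m i c) := by
  have h : ∃ d : ℕ, d < A ∧ X d = X c := ⟨c, hc, rfl⟩
  have hle := hX.le
  rw [matchMove, dif_pos h,
    hX.inj _ _ (h.choose_spec.1.trans_le hle) (hc.trans_le hle) h.choose_spec.2]

theorem mem_activeCells {m : ℤ → ℤ} {i : ℕ} {s : Square} :
    s ∈ activeCells A M T X m i ↔ i < T ∧ ∃ c : ℕ, c < A ∧ 0 ≤ target A M m i c ∧ X c = s := by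
  rw [activeCells]
  split_ifs with h
  · simp [h, and_assoc]
  · simp [h]

/-- After the subtraction of `(i + 1) * M`, a move appears as a place number and an idle edge as `c
- M < 0`. Thus the sign of `target` tells whether the square is vacated. -/
theorem target_spec (hl : IsArcList B A M X l) {m : ℤ → ℤ}
    (hm : Auction.IsMatching (timeArcs A M T l) (T * A) m) {i c : ℕ} (hi : i < T) (hc : c < A) :
    (∃ q : ℕ, q < M ∧ (A ≤ q ∨ i + 1 < T) ∧ Step B (X c) (X q) ∧ target A M m i c = q) ∨
      (0 < i ∧ target A M m i c = c - M ∧ m (i * A + c) = (i * M + c : ℕ)) := by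
  have hlt : i * A + c < T * A := by nlinarith
  have := hm.1 (i * A + c : ℕ) (by positivity) (by exact_mod_cast hlt)
  obtain ⟨j, d, hj, hd, h1, h2⟩ := (mem_timeArcs hl _ _).1 this
  obtain ⟨rfl, rfl⟩ := mul_add_inj hc hd (by exact_mod_cast h1)
  have hcast : ((i * A + c : ℕ) : ℤ) = i * A + c := by push_cast; ring
  rw [hcast] at h2
  rcases h2 with ⟨q, hq, h3, h4, h5⟩ | ⟨h3, h5⟩
  · exact Or.inl ⟨q, hq, h3, h4, by rw [target, h5]; push_cast; ring⟩
  · exact Or.inr ⟨h3, by rw [target, h5]; push_cast; ring, h5⟩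

/-- There are no idle edges at time 0, so all squares are vacated then. A move into `q` occupies the
right vertex of `q` at time `i + 1`; the left vertex of `q` at that time, being matched as well,
cannot be idle, so `q` is vacated. In the last step there are no edges into the polygon. -/
theorem isScheme_of_isMatching (hX : IsNumbering B A M X) (hl : IsArcList B A M X l) {m : ℤ → ℤ}
    (hT : 0 < T) (hm : Auction.IsMatching (timeArcs A M T l) (T * A) m) :
    IsScheme B B.cells T (activeCells A M T X m) (matchMove A M X m) := by
  have hle := hX.le
  have hpos : ∀ {i c : ℕ}, i < T → c < A → 0 ≤ target A M m i c →
      ∃ q : ℕ, q < M ∧ (A ≤ q ∨ i + 1 < T) ∧ Step B (X c) (X q) ∧ target A M m i c = q := by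
    intro i c hi hc h0
    rcases target_spec hl hm hi hc with h | ⟨-, h, -⟩
    · exact h
    · omega
  refine ⟨?_, fun i s hs => ?_, fun i s hs => ?_, fun i s hs hc => ?_, fun i s hs s' hs' he => ?_, ?_⟩
  · ext s
    rw [mem_activeCells, hX.mem_cells]
    constructor
    · rintro ⟨-, c, hc, -, rfl⟩; exact ⟨c, hc, rfl⟩
    · rintro ⟨c, hc, rfl⟩
      refine ⟨hT, c, hc, ?_, rfl⟩
      rcases target_spec hl hm hT hc with ⟨q, -, -, -, h⟩ | ⟨h, -⟩
      · omega
      · omega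
  · obtain ⟨-, c, hc, -, rfl⟩ := mem_activeCells.1 hs
    exact (hX.mem_cells _).2 ⟨c, hc, rfl⟩
  · obtain ⟨hi, c, hc, h0, rfl⟩ := mem_activeCells.1 hs
    obtain ⟨q, hq, h1, h2, h3⟩ := hpos hi hc h0
    rwa [matchMove_apply hX m i hc, h3]
  · obtain ⟨hi, c, hcA, h0, rfl⟩ := mem_activeCells.1 hs
    obtain ⟨q, hq, h1, h2, h3⟩ := hpos hi hcA h0
    rw [matchMove_apply hX m i hcA, h3] at hc ⊢
    have hqA := (hX.mem_cells_iff hq).1 hc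
    have hi1 : i + 1 < T := by omega
    refine mem_activeCells.2 ⟨hi1, q, hqA, ?_, rfl⟩
    rcases target_spec hl hm hi1 hqA with ⟨q', -, -, -, h⟩ | ⟨-, -, h⟩
    · omega
    · exfalso
      have h4 : m (i * A + c) = ((i + 1) * M + q : ℕ) := by
        rw [target] at h3; push_cast; linarith
      have h5 : (i : ℤ) * A + c = ((i + 1 : ℕ) : ℤ) * A + q := by
        have e1 : i * A + c < T * A := by nlinarith
        have e2 : (i + 1) * A + q < T * A := by nlinarith
        exact hm.2 _ _ (by positivity) (by exact_mod_cast e1) (by positivity)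
          (by exact_mod_cast e2) (h4.trans h.symm)
      have h6 : i * A + c = (i + 1) * A + q := by exact_mod_cast h5
      have := (mul_add_inj hcA hqA h6).1
      omega
  · obtain ⟨hi, c, hc, h0, rfl⟩ := mem_activeCells.1 hs
    obtain ⟨-, d, hd, h0', rfl⟩ := mem_activeCells.1 hs'
    obtain ⟨q, hq, -, -, h3⟩ := hpos hi hc h0
    obtain ⟨q', hq', -, -, h3'⟩ := hpos hi hd h0'
    rw [matchMove_apply hX m i hc, matchMove_apply hX m i hd, h3, h3'] at he
    have hqq := hX.inj _ _ hq hq' he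
    subst hqq
    have e1 : i * A + c < T * A := by nlinarith
    have e2 : i * A + d < T * A := by nlinarith
    have := hm.2 (i * A + c) (i * A + d) (by positivity) (by exact_mod_cast e1) (by positivity)
      (by exact_mod_cast e2) (by rw [target] at h3 h3'; linarith)
    obtain rfl : c = d := by
      have : (c : ℤ) = d := by linarith
      exact_mod_cast this
    rfl
  · ext s; simp [mem_activeCells]

/-- Follow `g` as long as the number is that of a square of the polygon. -/
def jump (A : ℕ) (g : ℤ → ℤ) (x : ℤ) : ℤ :=
  if 0 ≤ x ∧ x < A then g x else x

/-- This turns the cycle condition into a test on numbers with at most `A` iterations, which a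
program can carry out. Negative numbers and numbers of exits are fixed by `jump`, so a sequence that
returns to `c < A` was never outside the polygon. -/
theorem onCycle_iff (hX : IsNumbering B A M X) (hl : IsArcList B A M X l) {m : ℤ → ℤ}
    (hT : 0 < T) (hm : Auction.IsMatching (timeArcs A M T l) (T * A) m) {i c : ℕ} (hi : i < T)
    (hc : c < A) :
    OnCycle (activeCells A M T X m i) (matchMove A M X m i) (X c) ↔
      ∃ k < A, (jump A (target A M m i))^[k + 1] c = c := by
  have hle := hX.le
  have hsch := isScheme_of_isMatching hX hl hT hm
  set f := matchMove A M X m i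
  set g := jump A (target A M m i) with hg
  have hstep : ∀ d : ℕ, d < A → X d ∈ activeCells A M T X m i →
      ∃ q : ℕ, q < M ∧ g d = q ∧ f (X d) = X q := by
    intro d hd hmem
    obtain ⟨-, d', hd', h0, he⟩ := mem_activeCells.1 hmem
    obtain rfl := hX.inj _ _ (hd'.trans_le hle) (hd.trans_le hle) he
    rcases target_spec hl hm hi hd with ⟨q, hq, -, -, h⟩ | ⟨-, h, -⟩
    · refine ⟨q, hq, ?_, ?_⟩
      · rw [hg, jump, if_pos (by omega), h]
      · show matchMove A M X m i _ = _
        rw [matchMove_apply hX m i hd, h]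
    · omega
  constructor
  · intro h
    obtain ⟨k, hk, hk0, hD, hcyc⟩ := h.exists_le_card
    have hcard : (activeCells A M T X m i).card ≤ A := by
      rw [activeCells, if_pos hi]
      exact Finset.card_image_le.trans ((Finset.card_filter_le _ _).trans (by simp))
    have key : ∀ j ≤ k, ∃ q : ℕ, q < M ∧ g^[j] c = q ∧ f^[j] (X c) = X q := by
      intro j
      induction j with
      | zero => exact fun _ => ⟨c, hc.trans_le hle, rfl, rfl⟩
      | succ j ih =>
        intro hj
        obtain ⟨q, hq, h1, h2⟩ := ih (by omega)
        have hmem := hD j (by omega)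
        rw [h2] at hmem
        have hqA : q < A := (hX.mem_cells_iff hq).1 (hsch.sub i hmem)
        obtain ⟨q', hq', h3, h4⟩ := hstep q hqA hmem
        exact ⟨q', hq', by rw [Function.iterate_succ_apply', h1, h3],
          by rw [Function.iterate_succ_apply', h2, h4]⟩
    obtain ⟨q, hq, h1, h2⟩ := key k le_rfl
    rw [hcyc] at h2
    have := hX.inj _ _ (hc.trans_le hle) hq h2
    subst this
    exact ⟨k - 1, by omega, by rw [Nat.sub_add_cancel hk0]; exact h1⟩
  · rintro ⟨k, hk, hcyc⟩
    have hin : ∀ j ≤ k + 1, 0 ≤ g^[j] c ∧ g^[j] c < A := by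
      intro j hj
      by_contra hcon
      have hstay : ∀ n, g^[n] (g^[j] c) = g^[j] c := by
        intro n
        induction n with
        | zero => rfl
        | succ n ih => rw [Function.iterate_succ_apply', ih, hg, jump, if_neg hcon]
      have := hstay (k + 1 - j)
      rw [← Function.iterate_add_apply, Nat.sub_add_cancel hj, hcyc] at this
      rw [← this] at hcon
      exact hcon ⟨by omega, by omega⟩
    have key : ∀ j ≤ k, ∃ q : ℕ, q < A ∧ g^[j] c = q ∧ X q ∈ activeCells A M T X m i := by
      intro j hj
      obtain ⟨h1, h2⟩ := hin j (by omega)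
      obtain ⟨h3, -⟩ := hin (j + 1) (by omega)
      rw [Function.iterate_succ_apply'] at h3
      obtain ⟨q, hq⟩ := Int.eq_ofNat_of_zero_le h1
      rw [hq] at h2 h3
      refine ⟨q, by omega, hq, mem_activeCells.2 ⟨hi, q, by omega, ?_, rfl⟩⟩
      rwa [hg, jump, if_pos ⟨by omega, h2⟩] at h3
    have hX' : ∀ j ≤ k + 1, f^[j] (X c) = X (g^[j] c) := by
      intro j
      induction j with
      | zero => exact fun _ => rfl
      | succ j ih =>
        intro hj
        obtain ⟨q, hq, h1, h2⟩ := key j (by omega)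
        obtain ⟨q', -, h3, h4⟩ := hstep q hq h2
        rw [Function.iterate_succ_apply', ih (by omega), h1, h4, Function.iterate_succ_apply', h1, h3]
    refine ⟨k + 1, by omega, fun j hj => ?_, by rw [hX' _ le_rfl, hcyc]⟩
    obtain ⟨q, hq, h1, h2⟩ := key j (by omega)
    rwa [hX' j (by omega), h1]

end Matching

end Evac

/-! ### The geometry of grid polygons -/

namespace Evac

theorem map_fst_ringEdges (r : List (ℤ × ℤ)) : (ringEdges r).map Prod.fst = r := by
  rw [ringEdges, List.map_fst_zip (by simp)]

theorem map_snd_ringEdges (r : List (ℤ × ℤ)) : (ringEdges r).map Prod.snd = r.rotate 1 := by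
  rw [ringEdges, List.map_snd_zip (by simp)]

theorem Building.map_fst_edges (B : Building) : B.edges.map Prod.fst = B.rings.flatten := by
  simp only [Building.edges, List.map_flatMap, map_fst_ringEdges, List.flatMap_id']

/-- On a closed curve every vertex begins one edge and ends one edge. -/
theorem sum_ringEdges {M : Type*} [AddCommMonoid M] (g : ℤ × ℤ → M) (r : List (ℤ × ℤ)) :
    ((ringEdges r).map fun e => g e.1).sum = ((ringEdges r).map fun e => g e.2).sum := by
  have h1 : ((ringEdges r).map fun e => g e.1) = r.map g := by
    conv_rhs => rw [← map_fst_ringEdges r]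
    simp
  have h2 : ((ringEdges r).map fun e => g e.2) = (r.rotate 1).map g := by
    rw [← map_snd_ringEdges r]
    simp
  rw [h1, h2]
  exact (((List.rotate_perm r 1).map g).sum_eq).symm

theorem Building.sum_edges {M : Type*} [AddCommMonoid M] (B : Building) (g : ℤ × ℤ → M) :
    (B.edges.map fun e => g e.1).sum = (B.edges.map fun e => g e.2).sum := by
  unfold Building.edges
  induction B.rings with
  | nil => rfl
  | cons r l ih => 
    simp only [List.flatMap_cons, List.map_append, List.sum_append]
    rw [ih, sum_ringEdges]

/-! ### The even-odd rule -/

namespace Building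

/-- The parity of the number of edges that a ray from the centre of `s` crosses. -/
def parity (B : Building) (s : Square) : ZMod 2 :=
  (B.edges.map fun e => if CrossesRay s e then (1 : ZMod 2) else 0).sum

theorem parity_eq_countP (B : Building) (s : Square) :
    B.parity s = (B.edges.countP fun e => decide (CrossesRay s e) : ℕ) := by
  unfold parity
  induction B.edges with
  | nil => rfl
  | cons e l ih =>
    rw [List.map_cons, List.sum_cons, ih, List.countP_cons]
    by_cases h : CrossesRay s e <;> simp [h, add_comm]

theorem odd_iff_parity (B : Building) (s : Square) :
    Odd (B.edges.countP fun e => decide (CrossesRay s e)) ↔ B.parity s = 1 := by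
  rw [parity_eq_countP, ZMod.natCast_eq_one_iff_odd]

theorem sum_parity_edges (B : Building) (g : ℤ × ℤ → ZMod 2) :
    (B.edges.map fun e => g e.1 + g e.2).sum = 0 := by
  rw [List.sum_map_add, B.sum_edges g]
  exact CharTwo.add_self_eq_zero _

/-- The vertical edge `e` separates the squares `(x - 1, y)` and `(x, y)`. -/
def CoversV (x y : ℤ) (e : (ℤ × ℤ) × (ℤ × ℤ)) : Prop :=
  e.1.1 = x ∧ e.2.1 = x ∧ min e.1.2 e.2.2 ≤ y ∧ y < max e.1.2 e.2.2

/-- The horizontal edge `e` separates the squares `(x, y - 1)` and `(x, y)`. -/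
def CoversH (x y : ℤ) (e : (ℤ × ℤ) × (ℤ × ℤ)) : Prop :=
  e.1.2 = y ∧ e.2.2 = y ∧ min e.1.1 e.2.1 ≤ x ∧ x < max e.1.1 e.2.1

instance (x y : ℤ) : DecidablePred (CoversV x y) := fun e =>
  inferInstanceAs (Decidable
    (e.1.1 = x ∧ e.2.1 = x ∧ min e.1.2 e.2.2 ≤ y ∧ y < max e.1.2 e.2.2))

instance (x y : ℤ) : DecidablePred (CoversH x y) := fun e =>
  inferInstanceAs (Decidable
    (e.1.2 = y ∧ e.2.2 = y ∧ min e.1.1 e.2.1 ≤ x ∧ x < max e.1.1 e.2.1))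

/-- The longer ray crosses what the shorter one crosses and in addition the edges between the two
squares; modulo 2 the identity holds edge by edge. -/
theorem parity_horizontal (B : Building) (x y : ℤ) :
    B.parity (x - 1, y) + B.parity (x, y) =
      (B.edges.map fun e => if CoversV x y e then (1 : ZMod 2) else 0).sum := by
  unfold parity
  rw [← List.sum_map_add]
  congr 1
  refine List.map_congr_left fun e _ => ?_
  by_cases h1 : CrossesRay (x - 1, y) e <;> by_cases h2 : CrossesRay (x, y) e <;>
    by_cases h3 : CoversV x y e <;> simp only [h1, h2, h3, if_true, if_false] <;>
    first | rfl | (exfalso; unfold CrossesRay at h1 h2; unfold CoversV at h3; omega)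

variable {B : Building}

/-- The two rays differ in the vertical edges with an end at height `y` and to the left, and these
are balanced by the horizontal edges at that height. To see this, add the number of all ends of
edges on the half-line to the left of and including `(x, y)`. It vanishes modulo 2, since each
vertex is an end of two edges, and with it the identity holds edge by edge. -/
theorem IsValid.parity_vertical (hB : B.IsValid) (x y : ℤ) :
    B.parity (x, y - 1) + B.parity (x, y) =
      (B.edges.map fun e => if CoversH x y e then (1 : ZMod 2) else 0).sum := by
  have h0 := B.sum_parity_edges fun p => if p.2 = y ∧ p.1 ≤ x then 1 else 0
  unfold parity
  rw [← List.sum_map_add]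
  refine (add_zero _).symm.trans ((congrArg _ h0.symm).trans ?_)
  rw [← List.sum_map_add]
  congr 1
  refine List.map_congr_left fun e he => ?_
  have hr := hB.rectilinear e he
  have hn : ¬ (e.1.1 = e.2.1 ∧ e.1.2 = e.2.2) := fun h => hB.nondegenerate e he (Prod.ext h.1 h.2)
  by_cases h1 : CrossesRay (x, y - 1) e <;> by_cases h2 : CrossesRay (x, y) e <;>
    by_cases h3 : CoversH x y e <;> by_cases h4 : e.1.2 = y ∧ e.1.1 ≤ x <;>
    by_cases h5 : e.2.2 = y ∧ e.2.1 ≤ x <;>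
    simp only [h1, h2, h3, h4, h5, and_self, if_true, if_false] <;>
    first
      | rfl
      | (exfalso; unfold CrossesRay at h1 h2; unfold CoversH at h3; simp only at h1 h2; omega)

/-- An edge crosses the line through the centres of row `y` exactly if one of its two ends has
height at most `y`; around closed curves these ends cancel modulo 2. -/
theorem IsValid.parity_line (hB : B.IsValid) (y : ℤ) :
    (B.edges.map fun e => if e.1.1 = e.2.1 ∧ min e.1.2 e.2.2 ≤ y ∧ y < max e.1.2 e.2.2
      then (1 : ZMod 2) else 0).sum = 0 := by
  have h2 : (1 : ZMod 2) + 1 = 0 := rfl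
  refine Eq.trans ?_ (B.sum_parity_edges fun p => if p.2 ≤ y then 1 else 0)
  congr 1
  refine List.map_congr_left fun e he => ?_
  have hr := hB.rectilinear e he
  split_ifs <;> first | omega | simp [h2] 

/-- A square of odd parity lies between two vertical edges. -/
theorem IsValid.exists_edges_of_parity (hB : B.IsValid) {s : Square} (h : B.parity s = 1) :
    ∃ e ∈ B.edges, ∃ e' ∈ B.edges, e.1.1 ≤ s.1 ∧ s.1 < e'.1.1 ∧
      min e.1.2 e.2.2 ≤ s.2 ∧ s.2 < max e.1.2 e.2.2 := by
  have h1 : ∃ e ∈ B.edges, CrossesRay s e := by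
    by_contra! hcon
    have : B.parity s = 0 := by
      refine List.sum_eq_zero fun z hz => ?_
      obtain ⟨e, he, rfl⟩ := List.mem_map.1 hz
      exact if_neg (hcon e he)
    rw [h] at this; exact one_ne_zero this
  have h2 : ∃ e' ∈ B.edges, s.1 < e'.1.1 := by
    by_contra! hcon
    have : B.parity s = 0 := by
      rw [← hB.parity_line s.2]
      unfold parity
      congr 1
      refine List.map_congr_left fun e he => ?_
      have := hcon e he
      refine if_congr ?_ rfl rfl
      unfold CrossesRay
      tauto
    rw [h] at this; exact one_ne_zero this
  obtain ⟨e, he, h3, h4, h5, h6⟩ := h1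
  obtain ⟨e', he', h7⟩ := h2
  exact ⟨e, he, e', he', h4, h7, h5, h6⟩

theorem IsValid.mem_flatten_fst {e : (ℤ × ℤ) × (ℤ × ℤ)} (he : e ∈ B.edges) :
    e.1 ∈ B.rings.flatten := by
  rw [← map_fst_edges]; exact List.mem_map_of_mem he

theorem mem_flatten_snd {e : (ℤ × ℤ) × (ℤ × ℤ)} (he : e ∈ B.edges) :
    e.2 ∈ B.rings.flatten := by
  obtain ⟨r, hr, he⟩ := List.mem_flatMap.1 he
  have : e.2 ∈ r.rotate 1 := by
    rw [← map_snd_ringEdges]; exact List.mem_map_of_mem he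
  exact List.mem_flatten.2 ⟨r, hr, List.mem_rotate.1 this⟩

theorem foldr_min_le (l : List ℤ) : ∀ x ∈ l, l.foldr min 0 ≤ x := by
  induction l with
  | nil => simp
  | cons a l ih =>
    intro x hx
    simp only [List.foldr_cons]
    rcases List.mem_cons.1 hx with rfl | hx
    · exact min_le_left _ _
    · exact (min_le_right _ _).trans (ih x hx)

theorem le_foldr_max (l : List ℤ) : ∀ x ∈ l, x ≤ l.foldr max 0 := by
  induction l with
  | nil => simp
  | cons a l ih =>
    intro x hx
    simp only [List.foldr_cons]
    rcases List.mem_cons.1 hx with rfl | hx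
    · exact le_max_left _ _
    · exact (ih x hx).trans (le_max_right _ _)

theorem bounds_of_mem_flatten {p : ℤ × ℤ} (hp : p ∈ B.rings.flatten) :
    B.lo ≤ p.1 ∧ p.1 ≤ B.hi ∧ B.lo ≤ p.2 ∧ p.2 ≤ B.hi := by
  have h1 : p.1 ∈ B.rings.flatten.flatMap fun p => [p.1, p.2] :=
    List.mem_flatMap.2 ⟨p, hp, by simp⟩
  have h2 : p.2 ∈ B.rings.flatten.flatMap fun p => [p.1, p.2] :=
    List.mem_flatMap.2 ⟨p, hp, by simp⟩
  exact ⟨foldr_min_le _ _ h1, le_foldr_max _ _ h1, foldr_min_le _ _ h2, le_foldr_max _ _ h2⟩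

/-- A square of odd parity has an edge to its left and, since the whole line is crossed an even
number of times, one to its right. So the box in the definition of `cells` excludes nothing. -/
theorem IsValid.mem_cells_iff (hB : B.IsValid) (s : Square) : s ∈ B.cells ↔ B.parity s = 1 := by
  rw [cells, Finset.mem_filter, odd_iff_parity]
  refine ⟨fun h => h.2, fun h => ⟨?_, h⟩⟩
  obtain ⟨e, he, e', he', h1, h2, h3, h4⟩ := hB.exists_edges_of_parity h
  have b1 := bounds_of_mem_flatten (IsValid.mem_flatten_fst he)
  have b2 := bounds_of_mem_flatten (mem_flatten_snd he)
  have b3 := bounds_of_mem_flatten (IsValid.mem_flatten_fst he')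
  simp only [Finset.mem_product, Finset.mem_Ico]
  omega

/-! ### Consequences of simplicity, and bounds in terms of the area -/

theorem onEdge_fst (hB : B.IsValid) {e : (ℤ × ℤ) × (ℤ × ℤ)} (he : e ∈ B.edges) : OnEdge e.1 e :=
  ⟨hB.nondegenerate e he, by omega, by omega, by omega, by omega⟩

theorem IsValid.eq_of_onEdge (hB : B.IsValid) {e e' : (ℤ × ℤ) × (ℤ × ℤ)} (he : e ∈ B.edges)
    (he' : e' ∈ B.edges) {p : ℤ × ℤ} (h : OnEdge p e) (h' : OnEdge p e') : e = e' := by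
  by_contra hne
  have : Std.Symm fun e e' : (ℤ × ℤ) × (ℤ × ℤ) => ∀ p, ¬ (OnEdge p e ∧ OnEdge p e') :=
    ⟨fun _ _ h p hp => h p ⟨hp.2, hp.1⟩⟩
  exact hB.simple.forall he he' hne p ⟨h, h'⟩

theorem IsValid.nodup_flatten (hB : B.IsValid) : B.rings.flatten.Nodup := by
  rw [← map_fst_edges, List.Nodup, List.pairwise_map]
  refine hB.simple.imp_of_mem fun {e e'} he he' h heq => h e.1 ⟨onEdge_fst hB he, ?_⟩
  rw [heq]; exact onEdge_fst hB he'

theorem IsValid.nodup_edges (hB : B.IsValid) : B.edges.Nodup := by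
  have := hB.nodup_flatten
  rw [← map_fst_edges] at this
  exact this.of_map

/-- Every edge is followed by another one on its curve, and by yet another one. -/
theorem IsValid.exists_next (hB : B.IsValid) {e : (ℤ × ℤ) × (ℤ × ℤ)} (he : e ∈ B.edges) :
    ∃ f ∈ B.edges, ∃ g ∈ B.edges, f.1 = e.2 ∧ g.1 = f.2 ∧ g.1 ≠ e.1 := by
  obtain ⟨r, hr, he⟩ := List.mem_flatMap.1 he
  have hlen := hB.four_le r hr
  have hnd : r.Nodup := (List.nodup_flatten.1 hB.nodup_flatten).1 r hr
  obtain ⟨i, hi, rfl⟩ := List.mem_iff_getElem.1 he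
  have hl : (ringEdges r).length = r.length := by simp [ringEdges]
  have hget : ∀ (j : ℕ) (hj : j < (ringEdges r).length),
      (ringEdges r)[j] = (r[j]'(by omega), r[(j + 1) % r.length]'(Nat.mod_lt _ (by omega))) := by
    intro j hj
    simp only [ringEdges, List.getElem_zip, List.getElem_rotate]
  have hj1 : (i + 1) % r.length < (ringEdges r).length := by rw [hl]; exact Nat.mod_lt _ (by omega)
  have hj2 : ((i + 1) % r.length + 1) % r.length < (ringEdges r).length := by
    rw [hl]; exact Nat.mod_lt _ (by omega)
  refine ⟨_, List.mem_flatMap.2 ⟨r, hr, List.getElem_mem hj1⟩, _,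
    List.mem_flatMap.2 ⟨r, hr, List.getElem_mem hj2⟩, ?_, ?_, ?_⟩
  · rw [hget, hget]
  · rw [hget, hget]
  · rw [hget, hget]
    intro h
    have := (hnd.getElem_inj_iff).1 h
    rw [hl] at hi
    rcases Nat.lt_or_ge (i + 1) r.length with h1 | h1
    · rw [Nat.mod_eq_of_lt h1] at this
      rcases Nat.lt_or_ge (i + 2) r.length with h2 | h2
      · rw [Nat.mod_eq_of_lt h2] at this; omega
      · rw [show i + 1 + 1 = r.length by omega, Nat.mod_self] at this; omega
    · rw [show i + 1 = r.length by omega, Nat.mod_self, Nat.mod_eq_of_lt (by omega)] at this; omega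

/-- Two edges that both contain a pair of distinct lattice points, up to their final points, are
equal. -/
theorem IsValid.eq_of_two (hB : B.IsValid) {e e' : (ℤ × ℤ) × (ℤ × ℤ)} (he : e ∈ B.edges)
    (he' : e' ∈ B.edges) {p q : ℤ × ℤ} (hpq : p ≠ q)
    (h1 : p ≠ e.2 → OnEdge p e) (h2 : q ≠ e.2 → OnEdge q e)
    (h3 : p ≠ e'.2 → OnEdge p e') (h4 : q ≠ e'.2 → OnEdge q e') : e = e' := by
  -- The case of opposite directions: `e` ends in `p` and `e'` in `q`. The edge after `e` starts in
  -- `p` and so is `e'`; the one after that starts in `q` and so is `e`. Then the curve would have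
  -- only two edges.
  have main : ∀ e ∈ B.edges, ∀ e' ∈ B.edges, ∀ p q : ℤ × ℤ, p ≠ q → (q ≠ e.2 → OnEdge q e) →
      (p ≠ e'.2 → OnEdge p e') → p = e.2 → q = e'.2 → False := by
    intro e he e' he' p q hpq h2 h3 hp hq
    obtain ⟨f, hf, g, hg, hfe, hgf, hne⟩ := hB.exists_next he
    have hpf : OnEdge p f := by rw [hp, ← hfe]; exact onEdge_fst hB hf
    obtain rfl := hB.eq_of_onEdge hf he' hpf (h3 (by rw [← hq]; exact hpq))
    have hqg : OnEdge q g := by rw [hq, ← hgf]; exact onEdge_fst hB hg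
    have := hB.eq_of_onEdge he hg (h2 (by rw [← hp]; exact hpq.symm)) hqg
    exact hne (by rw [this])
  by_cases hp : p = e.2
  · by_cases hq : q = e'.2
    · exact (main e he e' he' p q hpq h2 h3 hp hq).elim
    · exact hB.eq_of_onEdge he he' (h2 (by rw [← hp]; exact hpq.symm)) (h4 hq)
  · by_cases hp' : p = e'.2
    · by_cases hq : q = e.2
      · exact (main e' he' e he p q hpq h4 h1 hp' hq).elim
      · exact hB.eq_of_onEdge he he' (h2 hq) (h4 (by rw [← hp']; exact hpq.symm))
    · exact hB.eq_of_onEdge he he' (h1 hp) (h3 hp')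

/-- To be used for the edges that cover a given unit side: there is only one of them, so the squares
on the two sides of it have different parities. -/
theorem IsValid.sum_eq_one (hB : B.IsValid) (P : (ℤ × ℤ) × (ℤ × ℤ) → Prop) [DecidablePred P]
    (hP : ∀ e ∈ B.edges, ∀ e' ∈ B.edges, P e → P e' → e = e') {e : (ℤ × ℤ) × (ℤ × ℤ)}
    (he : e ∈ B.edges) (hPe : P e) :
    (B.edges.map fun e => if P e then (1 : ZMod 2) else 0).sum = 1 := by
  rw [← List.sum_toFinset _ hB.nodup_edges, Finset.sum_eq_single e, if_pos hPe]
  · intro e' he' hne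
    exact if_neg fun h => hne (hP _ (List.mem_toFinset.1 he') _ he h hPe)
  · intro h; exact absurd (List.mem_toFinset.2 he) h

theorem zmod_two_cases (a b : ZMod 2) (h : a + b = 1) : a = 1 ∨ b = 1 := by
  revert h; revert a b; decide

/-- Every vertex is a corner of a square of the polygon. -/
theorem IsValid.exists_cell_near (hB : B.IsValid) {v : ℤ × ℤ} (hv : v ∈ B.rings.flatten) :
    ∃ c ∈ B.cells, v.1 - 1 ≤ c.1 ∧ c.1 ≤ v.1 ∧ v.2 - 1 ≤ c.2 ∧ c.2 ≤ v.2 := by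
  rw [← map_fst_edges] at hv
  obtain ⟨e, he, rfl⟩ := List.mem_map.1 hv
  have hne : ¬ (e.1.1 = e.2.1 ∧ e.1.2 = e.2.2) := fun h => hB.nondegenerate e he (Prod.ext h.1 h.2)
  rcases hB.rectilinear e he with h | h
  -- The unit piece of `e` at its initial vertex; its direction depends on that of `e`.
  · obtain ⟨y, hy, hy1, hy2⟩ : ∃ y, CoversV e.1.1 y e ∧ e.1.2 - 1 ≤ y ∧ y ≤ e.1.2 := by
      rcases lt_or_ge e.1.2 e.2.2 with h1 | h1
      · exact ⟨e.1.2, ⟨rfl, h.symm, by omega, by omega⟩, by omega, by omega⟩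
      · exact ⟨e.1.2 - 1, ⟨rfl, h.symm, by omega, by omega⟩, by omega, by omega⟩
    have hsum := B.parity_horizontal e.1.1 y
    rw [hB.sum_eq_one (CoversV e.1.1 y) ?_ he hy] at hsum
    · rcases zmod_two_cases _ _ hsum with h2 | h2
      · exact ⟨_, (hB.mem_cells_iff _).2 h2, by simp, by simp, hy1, hy2⟩
      · exact ⟨_, (hB.mem_cells_iff _).2 h2, by simp, by simp, hy1, hy2⟩
    · intro a ha b hb hca hcb
      obtain ⟨a1, a2, a3, a4⟩ := hca
      obtain ⟨b1, b2, b3, b4⟩ := hcb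
      refine hB.eq_of_two ha hb (p := (e.1.1, y)) (q := (e.1.1, y + 1)) (by simp) ?_ ?_ ?_ ?_ <;>
      · intro h
        refine ⟨h, ?_, ?_, ?_, ?_⟩ <;> simp only <;> omega
  · obtain ⟨x, hx, hx1, hx2⟩ : ∃ x, CoversH x e.1.2 e ∧ e.1.1 - 1 ≤ x ∧ x ≤ e.1.1 := by
      rcases lt_or_ge e.1.1 e.2.1 with h1 | h1
      · exact ⟨e.1.1, ⟨rfl, h.symm, by omega, by omega⟩, by omega, by omega⟩
      · exact ⟨e.1.1 - 1, ⟨rfl, h.symm, by omega, by omega⟩, by omega, by omega⟩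
    have hsum := hB.parity_vertical x e.1.2
    rw [hB.sum_eq_one (CoversH x e.1.2) ?_ he hx] at hsum
    · rcases zmod_two_cases _ _ hsum with h2 | h2
      · exact ⟨_, (hB.mem_cells_iff _).2 h2, hx1, hx2, by simp, by simp⟩
      · exact ⟨_, (hB.mem_cells_iff _).2 h2, hx1, hx2, by simp, by simp⟩
    · intro a ha b hb hca hcb
      obtain ⟨a1, a2, a3, a4⟩ := hca
      obtain ⟨b1, b2, b3, b4⟩ := hcb
      refine hB.eq_of_two ha hb (p := (x, e.1.2)) (q := (x + 1, e.1.2)) (by simp) ?_ ?_ ?_ ?_ <;>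
      · intro h
        refine ⟨h, ?_, ?_, ?_, ?_⟩ <;> simp only <;> omega

/-- Squares of the polygon are less than its area apart. -/
theorem IsValid.abs_sub_lt (hB : B.IsValid) {c d : Square} (hc : c ∈ B.cells) (hd : d ∈ B.cells) :
    |c.1 - d.1| < B.area ∧ |c.2 - d.2| < B.area := by
  classical
  have key : ∀ (a b : (B.cells : Set Square))
      (w : (gridGraph.induce (B.cells : Set Square)).Walk a b),
      |a.1.1 - b.1.1| ≤ w.length ∧ |a.1.2 - b.1.2| ≤ w.length := by
    intro a b w
    induction w with
    | nil => simp
    | @cons u v w h p ih =>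
      have h' : |u.1.1 - v.1.1| + |u.1.2 - v.1.2| = 1 := h
      simp only [SimpleGraph.Walk.length_cons]
      push_cast
      have := abs_sub_le u.1.1 v.1.1 w.1.1
      have := abs_sub_le u.1.2 v.1.2 w.1.2
      have := abs_nonneg (u.1.1 - v.1.1)
      have := abs_nonneg (u.1.2 - v.1.2)
      constructor <;> omega
  -- A path repeats no square, so it has fewer steps than there are squares, and each step changes
  -- each coordinate by at most 1.
  obtain ⟨w, hw⟩ := (hB.connected.preconnected ⟨c, hc⟩ ⟨d, hd⟩).exists_isPath
  have h1 := hw.length_lt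
  have h2 := key _ _ w
  have h3 : Fintype.card (B.cells : Set Square) = B.area := by
    simp [Building.area]
  simp only at h2
  omega

/-- The squares with distance at most `1` in each coordinate. -/
noncomputable def around (c : ℤ × ℤ) : Finset (ℤ × ℤ) :=
  Finset.Icc (c.1 - 1) (c.1 + 1) ×ˢ Finset.Icc (c.2 - 1) (c.2 + 1)

theorem card_around (c : ℤ × ℤ) : (around c).card = 9 := by
  have : ∀ x : ℤ, x + 1 + 1 - (x - 1) = 3 := fun x => by ring
  simp [around, this]

/-- Every square of the polygon accounts for at most the nine points around it. -/
theorem length_le_of_near (l : List (ℤ × ℤ)) (hl : l.Nodup)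
    (h : ∀ v ∈ l, ∃ c ∈ B.cells, v ∈ around c) : l.length ≤ 9 * B.area := by
  classical
  rw [← List.toFinset_card_of_nodup hl, mul_comm]
  refine (Finset.card_le_card (t := B.cells.biUnion around) fun v hv => ?_).trans
    (Finset.card_biUnion_le_card_mul _ _ _ fun c _ => (card_around c).le)
  obtain ⟨c, hc, hvc⟩ := h v (List.mem_toFinset.1 hv)
  exact Finset.mem_biUnion.2 ⟨c, hc, hvc⟩

theorem IsValid.length_flatten_le (hB : B.IsValid) : B.rings.flatten.length ≤ 9 * B.area := by
  refine length_le_of_near _ hB.nodup_flatten fun v hv => ?_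
  obtain ⟨c, hc, h⟩ := hB.exists_cell_near hv
  refine ⟨c, hc, ?_⟩
  simp only [around, Finset.mem_product, Finset.mem_Icc]
  omega

theorem length_edges (B : Building) : B.edges.length = B.rings.flatten.length := by
  rw [← map_fst_edges, List.length_map]

theorem IsValid.length_exits_le (hB : B.IsValid) : B.exits.length ≤ 9 * B.area := by
  rw [← List.length_map (f := Prod.fst)]
  refine length_le_of_near _ hB.exits_nodup fun v hv => ?_
  obtain ⟨x, hx, rfl⟩ := List.mem_map.1 hv
  obtain ⟨s, hs⟩ := List.exists_mem_of_ne_nil _ (hB.entries_ne_nil x hx)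
  obtain ⟨h1, h2⟩ := hB.entries_adj x hx s hs
  refine ⟨s, h1, ?_⟩
  unfold Adj at h2
  have := abs_nonneg (s.1 - x.1.1)
  have := abs_nonneg (s.2 - x.1.2)
  have h3 := abs_le.1 (show |s.1 - x.1.1| ≤ 1 by omega)
  have h4 := abs_le.1 (show |s.2 - x.1.2| ≤ 1 by omega)
  simp only [around, Finset.mem_product, Finset.mem_Icc]
  omega

theorem IsValid.length_entries_le (hB : B.IsValid) : ∀ x ∈ B.exits, x.2.length ≤ B.area := by
  classical
  intro x hx
  rw [← List.toFinset_card_of_nodup (hB.entries_nodup x hx)]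
  exact Finset.card_le_card fun s hs => (hB.entries_adj x hx s (List.mem_toFinset.1 hs)).1

theorem length_flatMap_pair (l : List (ℤ × ℤ)) :
    (l.flatMap fun p => [p.1, p.2]).length = 2 * l.length := by
  induction l with
  | nil => rfl
  | cons a l ih => simp [List.flatMap_cons, ih]; omega

/-- A curve takes one entry for its length and two per vertex, hence at most three per vertex. The
bound makes all loops over the input polynomial in the area, regardless of the size of the
coordinates. -/
theorem IsValid.length_encode_le (hB : B.IsValid) :
    B.encode.length ≤ 2 + 27 * B.area + 9 * B.area * (3 + 2 * B.area) := by
  have h1 : ∀ l : List (List (ℤ × ℤ)), (∀ r ∈ l, 4 ≤ r.length) →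
      (l.flatMap fun r => (r.length : ℤ) :: r.flatMap fun p => [p.1, p.2]).length ≤
        3 * l.flatten.length := by
    intro l hl
    induction l with
    | nil => simp
    | cons r l ih =>
      have := ih fun r hr => hl r (List.mem_cons_of_mem _ hr)
      have := hl r List.mem_cons_self
      simp only [List.flatMap_cons, List.length_append, List.length_cons, length_flatMap_pair,
        List.flatten_cons]
      omega
  have h2 : ∀ l : List (Square × List Square), (∀ x ∈ l, x.2.length ≤ B.area) →
      (l.flatMap fun x =>
        x.1.1 :: x.1.2 :: (x.2.length : ℤ) :: x.2.flatMap fun p => [p.1, p.2]).length ≤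
        l.length * (3 + 2 * B.area) := by
    intro l hl
    induction l with
    | nil => simp
    | cons x l ih =>
      have h3 := ih fun r hr => hl r (List.mem_cons_of_mem _ hr)
      have := hl x List.mem_cons_self
      simp only [List.flatMap_cons, List.length_append, List.length_cons, length_flatMap_pair]
      rw [add_mul]
      omega
  have h3 := h1 B.rings hB.four_le
  have h4 := h2 B.exits hB.length_entries_le
  have h5 := hB.length_flatten_le
  have h6 : B.exits.length * (3 + 2 * B.area) ≤ 9 * B.area * (3 + 2 * B.area) :=
    Nat.mul_le_mul_right _ hB.length_exits_le
  simp only [encode, List.length_append, List.length_cons]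
  omega

end Building

end Evac

/-! ### The program -/

namespace ArrLang

set_option linter.unusedSectionVars false

/-! ### Evaluation rules for the array language -/

section Eval

variable {V A : Type} [DecidableEq V] [DecidableEq A] (s : Store V A)

@[simp] theorem Store.setArr_arr_of_ne {a b : A} (h : b ≠ a) (i z : ℤ) :
    (s.setArr a i z).arr b = s.arr b := by
  rw [Store.setArr_arr, if_neg h]

@[simp] theorem Ex.val_lit (z : ℤ) : (Ex.lit z : Ex V A).val s = z := rfl
@[simp] theorem Ex.val_var (x : V) : (Ex.var x : Ex V A).val s = s.var x := rfl
@[simp] theorem Ex.val_arr (a : A) (i : Ex V A) : (Ex.arr a i).val s = s.arr a (i.val s) := rfl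
@[simp] theorem Ex.val_add (a b : Ex V A) : (a + b).val s = a.val s + b.val s := rfl
@[simp] theorem Ex.val_sub (a b : Ex V A) : (a - b).val s = a.val s - b.val s := rfl
@[simp] theorem Ex.val_ofNat (n : ℕ) [n.AtLeastTwo] :
    (ofNat(n) : Ex V A).val s = (ofNat(n) : ℤ) := rfl
@[simp] theorem Ex.val_zero : (0 : Ex V A).val s = 0 := rfl
@[simp] theorem Ex.val_one : (1 : Ex V A).val s = 1 := rfl

@[simp] theorem Cmd.den_skip : (Cmd.skip : Cmd V A).den s = s := rfl
@[simp] theorem Cmd.den_set (x : V) (e : Ex V A) : (Cmd.set x e).den s = s.setVar x (e.val s) := rfl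
@[simp] theorem Cmd.den_put (a : A) (i e : Ex V A) :
    (Cmd.put a i e).den s = s.setArr a (i.val s) (e.val s) := rfl
@[simp] theorem Cmd.den_seq (c d : Cmd V A) : (Cmd.seq c d).den s = d.den (c.den s) := rfl
theorem Cmd.den_ite (e : Ex V A) (c d : Cmd V A) :
    (Cmd.ite e c d).den s = if e.val s ≠ 0 then c.den s else d.den s := rfl

@[simp] theorem Cmd.den_ite_lt (a b : Ex V A) (c d : Cmd V A) :
    (Cmd.ite (a ≺ b) c d).den s = if a.val s < b.val s then c.den s else d.den s := by
  rw [Cmd.den_ite, Ex.val]; split_ifs <;> simp_all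

@[simp] theorem Cmd.den_ite_eq (a b : Ex V A) (c d : Cmd V A) :
    (Cmd.ite (a ≐ b) c d).den s = if a.val s = b.val s then c.den s else d.den s := by
  rw [Cmd.den_ite, Ex.val]; split_ifs <;> simp_all

end Eval

/-! ### Lists as contents of arrays -/

/-- The values of `f` from `p` on are the entries of the list. -/
def HoldsAt (f : ℤ → ℤ) : ℤ → List ℤ → Prop
  | _, [] => True
  | p, a :: l => f p = a ∧ HoldsAt f (p + 1) l

theorem holdsAt_append {f : ℤ → ℤ} {p : ℤ} {l l' : List ℤ} :
    HoldsAt f p (l ++ l') ↔ HoldsAt f p l ∧ HoldsAt f (p + l.length) l' := by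
  induction l generalizing p with
  | nil => simp [HoldsAt]
  | cons a l ih =>
    simp only [List.cons_append, HoldsAt, ih, List.length_cons, and_assoc]
    push_cast
    rw [show p + 1 + (l.length : ℤ) = p + (l.length + 1) by ring]

theorem holdsAt_iff {f : ℤ → ℤ} {p : ℤ} {l : List ℤ} :
    HoldsAt f p l ↔ ∀ (k : ℕ) (h : k < l.length), f (p + k) = l[k] := by
  induction l generalizing p with
  | nil => simp [HoldsAt]
  | cons a l ih =>
    rw [HoldsAt, ih]
    constructor
    · rintro ⟨h1, h2⟩ (- | k) hk
      · simpa using h1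
      · have := h2 k (by simpa using hk)
        rw [List.getElem_cons_succ, ← this]; congr 1; push_cast; ring
    · intro h
      refine ⟨by have := h 0 (by simp); simpa using this, fun k hk => ?_⟩
      have := h (k + 1) (by simpa using hk)
      rw [List.getElem_cons_succ] at this
      rw [← this]; congr 1; push_cast; ring

theorem HoldsAt.congr {f g : ℤ → ℤ} {p : ℤ} {l : List ℤ} (h : HoldsAt f p l)
    (hfg : ∀ z, p ≤ z → z < p + l.length → g z = f z) : HoldsAt g p l := by
  rw [holdsAt_iff] at h ⊢
  intro k hk
  rw [hfg _ (by omega) (by omega), h k hk]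

/-- The list of coordinates of a list of points. -/
def coords (l : List (ℤ × ℤ)) : List ℤ :=
  l.flatMap fun p => [p.1, p.2]

@[simp] theorem coords_nil : coords [] = [] := rfl

@[simp] theorem coords_cons (p : ℤ × ℤ) (l : List (ℤ × ℤ)) :
    coords (p :: l) = p.1 :: p.2 :: coords l := rfl

@[simp] theorem coords_append (l l' : List (ℤ × ℤ)) : coords (l ++ l') = coords l ++ coords l' := by
  simp [coords]

@[simp] theorem length_coords (l : List (ℤ × ℤ)) : (coords l).length = 2 * l.length := by
  induction l with
  | nil => rfl
  | cons a l ih => rw [coords_cons, List.length_cons, List.length_cons, ih, List.length_cons]; omega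

theorem HoldsAt.coords_getElem {f : ℤ → ℤ} {p : ℤ} {l : List (ℤ × ℤ)} (h : HoldsAt f p (coords l))
    (k : ℕ) (hk : k < l.length) : f (p + 2 * k) = l[k].1 ∧ f (p + 2 * k + 1) = l[k].2 := by
  induction l generalizing p k with
  | nil => simp at hk
  | cons a l ih =>
    obtain ⟨h1, h2, h3⟩ := h
    rcases k with - | k
    · simpa using ⟨h1, h2⟩
    · have := ih h3 k (by simpa using hk)
      rw [List.getElem_cons_succ, ← this.1, ← this.2]
      push_cast
      exact ⟨congrArg f (by ring), congrArg f (by ring)⟩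

/-- The values of `f` at `0, 1, 2, …` are the entries of the list. -/
def Holds {α : Type} (f : ℤ → α) (l : List α) : Prop :=
  ∀ (k : ℕ) (h : k < l.length), f k = l[k]

theorem Holds.nil {α : Type} (f : ℤ → α) : Holds f [] := fun k h => by simp at h

theorem Holds.push {α : Type} {f g : ℤ → α} {l : List α} {x : α} (h : Holds f l)
    (hg : ∀ z, 0 ≤ z → z < l.length → g z = f z) (hx : g l.length = x) : Holds g (l ++ [x]) := by
  intro k hk
  rcases Nat.lt_or_ge k l.length with h1 | h1
  · rw [List.getElem_append_left h1, hg _ (by omega) (by omega), h k h1]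
  · obtain rfl : k = l.length := by simp at hk; omega
    simpa using hx

theorem Holds.exists_of_mem {α : Type} {f : ℤ → α} {l : List α} (h : Holds f l) {x : α}
    (hx : x ∈ l) : ∃ k : ℕ, k < l.length ∧ f k = x := by
  obtain ⟨k, hk, rfl⟩ := List.mem_iff_getElem.1 hx
  exact ⟨k, hk, h k hk⟩

end ArrLang

/-! ### Reading the input word -/

namespace Evac

namespace Solver

open ArrLang

/-- The variables of the program. -/
inductive Var where
  | len | pos | nr | ne | i | j | k | rl | q | nx | np | rad | side | x | y | par | na | nm | nb
  | flag | tt | done | uo | ro | m | nl | nrt | cap | u | br | bp | op | lp | cnt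
  deriving DecidableEq

/-- The arrays of the program. -/
inductive Arr where
  | inp | x1 | y1 | x2 | y2 | ex | ey | px | py | pu | pv | qx | qy | bc | bq | el | er | price | owner
  | mate | tgt | out
  deriving DecidableEq

open Var Arr

/-- Commands of the program. -/
abbrev C := Cmd Var Arr

/-- Stores of the program. -/
abbrev St := Store Var Arr

/-- Expressions of the program. -/
abbrev E := Ex Var Arr

/-- Array access. -/
abbrev rd (a : Arr) (e : E) : E := .arr a e

/-- Read one edge of a boundary curve. -/
def readEdge : C :=
  .ite ((j : E) + 1 ≺ rl) (q ::= pos + j + j + 2) (q ::= pos) ;;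
  .put x1 ne (rd inp (pos + j + j)) ;;
  .put y1 ne (rd inp (pos + j + j + 1)) ;;
  .put x2 ne (rd inp q) ;;
  .put y2 ne (rd inp ((q : E) + 1)) ;;
  ne ::= (ne : E) + 1

/-- Read one boundary curve. -/
def readRing : C :=
  rl ::= rd inp pos ;;
  pos ::= (pos : E) + 1 ;;
  .rep j rl len readEdge ;;
  pos ::= (pos : E) + rl + rl

/-- Read the boundary curves, and list their edges. -/
def readRings : C :=
  pos ::= 1 ;;
  nr ::= rd inp 0 ;;
  ne ::= 0 ;;
  .rep i nr len readRing

/-- Read one pair of an exit and a square from which it can be entered. -/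
def readEntry : C :=
  .put px np (rd inp (pos + j + j)) ;;
  .put py np (rd inp (pos + j + j + 1)) ;;
  .put pu np (rd ex i) ;;
  .put pv np (rd ey i) ;;
  np ::= (np : E) + 1

/-- Read one exit. -/
def readExit : C :=
  .put ex i (rd inp pos) ;;
  .put ey i (rd inp ((pos : E) + 1)) ;;
  rl ::= rd inp ((pos : E) + 2) ;;
  pos ::= (pos : E) + 3 ;;
  .rep j rl len readEntry ;;
  pos ::= (pos : E) + rl + rl

/-- Read the exits. -/
def readExits : C :=
  nx ::= rd inp pos ;;
  pos ::= (pos : E) + 1 ;;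
  np ::= 0 ;;
  .rep i nx len readExit

/-- The table of edges. -/
def edgeAt (s : St) (z : ℤ) : (ℤ × ℤ) × (ℤ × ℤ) :=
  ((s.arr x1 z, s.arr y1 z), (s.arr x2 z, s.arr y2 z))

theorem readEdge_spec (s : St) (r : List (ℤ × ℤ)) (E₀ : List ((ℤ × ℤ) × (ℤ × ℤ))) (k : ℕ)
    (hk : k < r.length) (hj : s.var j = k) (hrl : s.var rl = r.length)
    (hin : HoldsAt (s.arr inp) (s.var pos) (coords r)) (hE : Holds (edgeAt s) E₀)
    (hne : s.var ne = E₀.length) :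
    Holds (edgeAt (readEdge.den s))
        (E₀ ++ [(r[k], r[(k + 1) % r.length]'(Nat.mod_lt _ (by omega)))]) ∧
      (readEdge.den s).var ne = E₀.length + 1 := by
  have h1 := hin.coords_getElem k hk
  -- The edge leads to the following vertex, and the last edge of the curve back to the first
  -- vertex, at `pos`.
  have hq : ∃ z : ℤ, (Cmd.ite ((j : E) + 1 ≺ rl) (q ::= pos + j + j + 2) (q ::= pos) : C).den s =
      s.setVar q z ∧ s.arr inp z = (r[(k + 1) % r.length]'(Nat.mod_lt _ (by omega))).1 ∧
      s.arr inp (z + 1) = (r[(k + 1) % r.length]'(Nat.mod_lt _ (by omega))).2 := by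
    by_cases hlt : k + 1 < r.length
    · refine ⟨s.var pos + k + k + 2, ?_, ?_⟩
      · rw [Cmd.den_ite_lt, if_pos (by simp [hj, hrl]; omega)]
        simp [hj]
      · have h2 := hin.coords_getElem (k + 1) hlt
        simp only [Nat.mod_eq_of_lt hlt]
        rw [← h2.1, ← h2.2]
        push_cast
        exact ⟨congrArg _ (by ring), congrArg _ (by ring)⟩
    · refine ⟨s.var pos, ?_, ?_⟩
      · rw [Cmd.den_ite_lt, if_neg (by simp [hj, hrl]; omega)]
        simp
      · have h2 := hin.coords_getElem 0 (by omega)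
        have h3 : (k + 1) % r.length = 0 := by
          rw [show k + 1 = r.length by omega, Nat.mod_self]
        simp only [h3]
        simpa using h2
  obtain ⟨z, hz, hz1, hz2⟩ := hq
  generalize hs' : readEdge.den s = s'
  rw [readEdge, Cmd.den_seq, hz] at hs'
  simp only [Cmd.den_seq, Cmd.den_put, Cmd.den_set] at hs'
  have e1 : s.var pos + k + k = s.var pos + 2 * k := by ring
  subst hs'
  refine ⟨hE.push (fun w h0 h2 => ?_) ?_, by simp [hne]⟩
  · simp [edgeAt, hne, h2.ne]
  · simp [edgeAt, hne, hj, e1, h1, hz1, hz2]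

/-- Lists of points, each preceded by its length. -/
def encodeRings (l : List (List (ℤ × ℤ))) : List ℤ :=
  l.flatMap fun r => (r.length : ℤ) :: coords r

/-- The part of the input word that describes exits. -/
def encodeExits (l : List (Square × List Square)) : List ℤ :=
  l.flatMap fun x => x.1.1 :: x.1.2 :: (x.2.length : ℤ) :: coords x.2

theorem encode_eq (B : Building) : B.encode =
    ((B.rings.length : ℤ) :: encodeRings B.rings) ++
      ((B.exits.length : ℤ) :: encodeExits B.exits) := rfl

theorem readRing_spec (s : St) (r : List (ℤ × ℤ)) (E₀ : List ((ℤ × ℤ) × (ℤ × ℤ)))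
    (hin : HoldsAt (s.arr inp) (s.var pos) ((r.length : ℤ) :: coords r))
    (hE : Holds (edgeAt s) E₀) (hne : s.var ne = E₀.length) (hlen : (r.length : ℤ) ≤ s.var len) :
    Holds (edgeAt (readRing.den s)) (E₀ ++ ringEdges r) ∧
      (readRing.den s).var ne = (E₀ ++ ringEdges r).length ∧
      (readRing.den s).var pos = s.var pos + 1 + 2 * r.length := by
  have hl : (ringEdges r).length = r.length := by simp [ringEdges]
  rw [readRing]
  simp only [Cmd.den_seq, Cmd.den_set]
  generalize hs₁ : (s.setVar rl ((rd inp pos).val s)).setVar pos _ = s₁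
  have hfr := Cmd.den_frame (.rep j rl len readEdge) s₁
  have hin₁ : HoldsAt (s₁.arr inp) (s₁.var pos) (coords r) := by
    subst hs₁; simpa using hin.2
  have hrl : s₁.var rl = r.length := by subst hs₁; simpa using hin.1
  have hI := rep_induction (x := j) (v := rl) (cap := len) (c := readEdge) (s := s₁)
    (fun k s' => Holds (edgeAt s') (E₀ ++ (ringEdges r).take k) ∧ s'.var ne = E₀.length + k)
    r.length (by decide) hrl (by rw [hrl]; subst hs₁; simpa using hlen)
    (by subst hs₁; exact ⟨by simpa [edgeAt, Holds] using hE, by simp [hne]⟩) (by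
      rintro k hk s' ⟨h1, h2⟩ hj hf
      have hpos := hf.var pos (by decide)
      have hrl' := hf.var rl (by decide)
      have hinp := hf.arr inp (by decide)
      obtain ⟨h3, h4⟩ := readEdge_spec s' r _ k hk hj (hrl'.trans hrl)
        (by rw [hinp, hpos]; exact hin₁) h1 (by
          rw [h2, List.length_append, List.length_take, hl, min_eq_left hk.le]; push_cast; rfl)
      rw [List.take_succ_eq_append_getElem (by omega), ← List.append_assoc]
      refine ⟨?_, ?_⟩
      · have : (ringEdges r)[k]'(by omega) =
            (r[k], r[(k + 1) % r.length]'(Nat.mod_lt _ (by omega))) := by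
          simp only [ringEdges, List.getElem_zip, List.getElem_rotate]
        rw [this]; exact h3
      · simp only [Store.setVar_var]
        rw [if_neg (by decide), h4, List.length_append, List.length_take, hl, min_eq_left hk.le]
        push_cast; ring)
  rw [← hl, List.take_length] at hI
  refine ⟨hI.1, ?_, ?_⟩
  · simp [hI.2]
  · simp [hfr.var pos (by decide), hfr.var rl (by decide), hrl]
    subst hs₁; simp; ring

/-- According to the invariant, the unread rest of the word starts at `pos`, so each curve begins
where the one before ended. All counts are at most the length of the word, so `len` is a sufficient
cap. -/
theorem readRings_spec (s : St) (B : Building) (hin : HoldsAt (s.arr inp) 0 B.encode)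
    (hlen : s.var len = B.encode.length) :
    Holds (edgeAt (readRings.den s)) B.edges ∧ (readRings.den s).var ne = B.edges.length ∧
      HoldsAt (s.arr inp) ((readRings.den s).var pos)
        ((B.exits.length : ℤ) :: encodeExits B.exits) := by
  have hbound : B.rings.length ≤ B.encode.length ∧ ∀ r ∈ B.rings, r.length ≤ B.encode.length := by
    have key : ∀ l : List (List (ℤ × ℤ)), l.length ≤ (encodeRings l).length ∧
        ∀ r ∈ l, r.length ≤ (encodeRings l).length := by
      intro l
      induction l with
      | nil => simp
      | cons a l ih =>
        simp only [encodeRings, List.flatMap_cons, List.length_append, List.length_cons,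
          length_coords] at ih ⊢
        refine ⟨by omega, fun r hr => ?_⟩
        rcases List.mem_cons.1 hr with rfl | hr
        · omega
        · have := ih.2 r hr; omega
    obtain ⟨h1, h2⟩ := key B.rings
    rw [encode_eq]
    simp only [List.length_append, List.length_cons]
    exact ⟨by omega, fun r hr => by have := h2 r hr; omega⟩
  rw [encode_eq, List.cons_append] at hin
  obtain ⟨hin1, hin2⟩ := hin
  rw [readRings]
  simp only [Cmd.den_seq, Cmd.den_set]
  generalize hs₁ : ((s.setVar pos _).setVar nr _).setVar ne _ = s₁
  have hnr : s₁.var nr = B.rings.length := by subst hs₁; simpa using hin1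
  have hlen₁ : s₁.var len = B.encode.length := by subst hs₁; simpa using hlen
  have hinp₁ : s₁.arr inp = s.arr inp := by subst hs₁; simp
  have hI := rep_induction (x := i) (v := nr) (cap := len) (c := readRing) (s := s₁)
    (fun k s' => Holds (edgeAt s') ((B.rings.take k).flatMap ringEdges) ∧
      s'.var ne = ((B.rings.take k).flatMap ringEdges).length ∧
      HoldsAt (s.arr inp) (s'.var pos) (encodeRings (B.rings.drop k) ++
        ((B.exits.length : ℤ) :: encodeExits B.exits)))
    B.rings.length (by decide) hnr (by rw [hnr, hlen₁]; exact_mod_cast hbound.1)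
    (by
      subst hs₁
      refine ⟨by simpa using Holds.nil _, by simp, by simpa using hin2⟩) (by
      rintro k hk s' ⟨h1, h2, h3⟩ hi hf
      have hinp := (hf.arr inp (by decide)).trans hinp₁
      have hlen' := (hf.var len (by decide)).trans hlen₁
      rw [List.drop_eq_getElem_cons hk, encodeRings, List.flatMap_cons, List.append_assoc,
        holdsAt_append] at h3
      obtain ⟨h3, h3'⟩ := h3
      obtain ⟨h4, h5, h6⟩ := readRing_spec s' B.rings[k] _ (by rw [hinp]; exact h3) h1 h2
        (by rw [hlen']; exact_mod_cast hbound.2 _ (List.getElem_mem hk))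
      rw [List.take_succ_eq_append_getElem hk, List.flatMap_append, List.flatMap_singleton]
      refine ⟨h4, ?_, ?_⟩
      · simpa using h5
      · simp only [Store.setVar_var]
        rw [if_neg (by decide), h6]
        simp only [List.length_cons, length_coords] at h3'
        push_cast at h3'
        rw [show s'.var pos + 1 + 2 * (B.rings[k].length : ℤ) =
          s'.var pos + (2 * (B.rings[k].length : ℤ) + 1) by ring]
        exact h3')
  rw [List.take_length, List.drop_length] at hI
  exact hI

/-- The table of pairs of an exit and a square from which it can be entered. -/
def entryAt (s : St) (z : ℤ) : (ℤ × ℤ) × (ℤ × ℤ) :=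
  ((s.arr px z, s.arr py z), (s.arr pu z, s.arr pv z))

/-- The table of exits. -/
def exitAt (s : St) (z : ℤ) : ℤ × ℤ := (s.arr ex z, s.arr ey z)

/-- The pairs of an exit and a square from which it can be entered. -/
def entries (l : List (Square × List Square)) : List (Square × Square) :=
  l.flatMap fun x => x.2.map fun p => (p, x.1)

theorem mem_entries (B : Building) (c e : Square) : (c, e) ∈ entries B.exits ↔ B.CanEnter c e := by
  simp only [entries, List.mem_flatMap, List.mem_map, Prod.mk.injEq, Building.CanEnter]
  constructor
  · rintro ⟨x, hx, p, hp, rfl, rfl⟩; exact ⟨x, hx, rfl, hp⟩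
  · rintro ⟨x, hx, rfl, hp⟩; exact ⟨x, hx, c, hp, rfl, rfl⟩

theorem readExit_spec (s : St) (x : Square × List Square) (X₀ : List Square)
    (P₀ : List (Square × Square)) (hi : s.var i = X₀.length)
    (hin : HoldsAt (s.arr inp) (s.var pos)
      (x.1.1 :: x.1.2 :: (x.2.length : ℤ) :: coords x.2))
    (hX : Holds (exitAt s) X₀) (hP : Holds (entryAt s) P₀) (hnp : s.var np = P₀.length)
    (hlen : (x.2.length : ℤ) ≤ s.var len) :
    Holds (exitAt (readExit.den s)) (X₀ ++ [x.1]) ∧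
      Holds (entryAt (readExit.den s)) (P₀ ++ x.2.map fun p => (p, x.1)) ∧
      (readExit.den s).var np = (P₀ ++ x.2.map fun p => (p, x.1)).length ∧
      (readExit.den s).var pos = s.var pos + 3 + 2 * x.2.length := by
  obtain ⟨hin1, hin2, hin3, hin4⟩ := hin
  rw [readExit]
  simp only [Cmd.den_seq, Cmd.den_set, Cmd.den_put]
  generalize hs₁ : (((s.setArr ex _ _).setArr ey _ _).setVar rl _).setVar pos _ = s₁
  have hfr := Cmd.den_frame (.rep j rl len readEntry) s₁
  have hin₁ : HoldsAt (s₁.arr inp) (s₁.var pos) (coords x.2) := by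
    subst hs₁
    have : s.var pos + 1 + 1 + 1 = s.var pos + 3 := by ring
    rw [this] at hin4
    simpa using hin4
  have hrl : s₁.var rl = x.2.length := by
    subst hs₁
    have : s.var pos + 1 + 1 = s.var pos + 2 := by ring
    rw [this] at hin3
    simpa using hin3
  have hpos : s₁.var pos = s.var pos + 3 := by subst hs₁; simp
  have hi₁ : s₁.var i = X₀.length := by subst hs₁; simpa using hi
  have hX₁ : Holds (exitAt s₁) (X₀ ++ [x.1]) := by
    subst hs₁
    refine hX.push (fun w h0 h1 => ?_) ?_
    · simp [exitAt, hi, h1.ne]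
    · simp [exitAt, hi, hin1, hin2]
  have hx₁ : exitAt s₁ (s₁.var i) = x.1 := by
    have := hX₁ X₀.length (by simp)
    rw [hi₁, this]; simp
  have hI := rep_induction (x := j) (v := rl) (cap := len) (c := readEntry) (s := s₁)
    (fun k s' => Holds (entryAt s') (P₀ ++ (x.2.take k).map fun p => (p, x.1)) ∧
      s'.var np = P₀.length + k)
    x.2.length (by decide) hrl (by rw [hrl]; subst hs₁; simpa using hlen)
    (by
      subst hs₁
      refine ⟨?_, by simpa using hnp⟩
      simpa [entryAt, Holds] using hP) (by
      rintro k hk s' ⟨h1, h2⟩ hj hf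
      have hpos' := hf.var pos (by decide)
      have hi' := hf.var i (by decide)
      have hinp := hf.arr inp (by decide)
      have hex := hf.arr ex (by decide)
      have hey := hf.arr ey (by decide)
      have hc := hin₁.coords_getElem k hk
      rw [← hinp, ← hpos'] at hc
      have hx' : exitAt s' (s'.var i) = x.1 := by
        rw [← hx₁]; simp only [exitAt, hex, hey, hi']
      have e1 : s'.var pos + k + k = s'.var pos + 2 * k := by ring
      rw [List.take_succ_eq_append_getElem hk, List.map_append, ← List.append_assoc]
      have hl : (P₀ ++ (x.2.take k).map fun p => (p, x.1)).length = P₀.length + k := by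
        simp [hk.le]
      have h2' : s'.var np = (P₀ ++ (x.2.take k).map fun p => (p, x.1)).length := by
        rw [h2, hl]; push_cast; rfl
      simp only [readEntry, Cmd.den_seq, Cmd.den_set, Cmd.den_put]
      refine ⟨h1.push (fun w h0 h3 => ?_) ?_, ?_⟩
      · have hw : (w : ℤ) ≠ s'.var np := by omega
        simp [entryAt, hw]
      · rw [← hx']
        simp [entryAt, h2', hj, e1, hc, exitAt]
      · simp [h2]; ring)
  rw [List.take_length] at hI
  refine ⟨?_, hI.1, ?_, ?_⟩
  · simpa [exitAt, Holds, hfr.arr ex (by decide), hfr.arr ey (by decide)] using hX₁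
  · simp [hI.2]
  · simp [hfr.var pos (by decide), hfr.var rl (by decide), hrl, hpos]; ring

theorem readExits_spec (s : St) (B : Building)
    (hin : HoldsAt (s.arr inp) (s.var pos) ((B.exits.length : ℤ) :: encodeExits B.exits))
    (hlen : s.var len = B.encode.length) :
    Holds (exitAt (readExits.den s)) (B.exits.map Prod.fst) ∧
      (readExits.den s).var nx = B.exits.length ∧
      Holds (entryAt (readExits.den s)) (entries B.exits) ∧
      (readExits.den s).var np = (entries B.exits).length := by
  have hbound : B.exits.length ≤ B.encode.length ∧
      ∀ x ∈ B.exits, x.2.length ≤ B.encode.length := by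
    have key : ∀ l : List (Square × List Square), l.length ≤ (encodeExits l).length ∧
        ∀ x ∈ l, x.2.length ≤ (encodeExits l).length := by
      intro l
      induction l with
      | nil => simp
      | cons a l ih =>
        simp only [encodeExits, List.flatMap_cons, List.length_append, List.length_cons,
          length_coords] at ih ⊢
        refine ⟨by omega, fun r hr => ?_⟩
        rcases List.mem_cons.1 hr with rfl | hr
        · omega
        · have := ih.2 r hr; omega
    obtain ⟨h1, h2⟩ := key B.exits
    rw [encode_eq]
    simp only [List.length_append, List.length_cons]
    exact ⟨by omega, fun r hr => by have := h2 r hr; omega⟩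
  obtain ⟨hin1, hin2⟩ := hin
  rw [readExits]
  simp only [Cmd.den_seq, Cmd.den_set]
  generalize hs₁ : ((s.setVar nx _).setVar pos _).setVar np _ = s₁
  have hnx : s₁.var nx = B.exits.length := by subst hs₁; simpa using hin1
  have hlen₁ : s₁.var len = B.encode.length := by subst hs₁; simpa using hlen
  have hinp₁ : s₁.arr inp = s.arr inp := by subst hs₁; simp
  have hI := rep_induction (x := i) (v := nx) (cap := len) (c := readExit) (s := s₁)
    (fun k s' => Holds (exitAt s') ((B.exits.take k).map Prod.fst) ∧
      Holds (entryAt s') (entries (B.exits.take k)) ∧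
      s'.var np = (entries (B.exits.take k)).length ∧
      HoldsAt (s.arr inp) (s'.var pos) (encodeExits (B.exits.drop k)))
    B.exits.length (by decide) hnx (by rw [hnx, hlen₁]; exact_mod_cast hbound.1)
    (by
      subst hs₁
      refine ⟨by simpa using Holds.nil _, by simpa [entries] using Holds.nil _,
        by simp [entries], by simpa using hin2⟩) (by
      rintro k hk s' ⟨h1, h2, h3, h4⟩ hi hf
      have hinp := (hf.arr inp (by decide)).trans hinp₁
      have hlen' := (hf.var len (by decide)).trans hlen₁
      rw [List.drop_eq_getElem_cons hk, encodeExits, List.flatMap_cons, holdsAt_append] at h4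
      obtain ⟨h4, h4'⟩ := h4
      obtain ⟨h5, h6, h7, h8⟩ := readExit_spec s' B.exits[k] _ _
        (by rw [hi, List.length_map, List.length_take, min_eq_left hk.le])
        (by rw [hinp]; exact h4) h1 h2 h3
        (by rw [hlen']; exact_mod_cast hbound.2 _ (List.getElem_mem hk))
      have he : entries (B.exits.take (k + 1)) = entries (B.exits.take k) ++
          B.exits[k].2.map fun p => (p, B.exits[k].1) := by
        rw [List.take_succ_eq_append_getElem hk, entries, List.flatMap_append,
          List.flatMap_singleton]; rfl
      rw [he, List.take_succ_eq_append_getElem hk, List.map_append]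
      refine ⟨h5, h6, ?_, ?_⟩
      · simpa using h7
      · simp only [Store.setVar_var]
        rw [if_neg (by decide), h8]
        simp only [List.length_cons, length_coords] at h4'
        push_cast at h4'
        rw [show s'.var pos + 3 + 2 * (B.exits[k].2.length : ℤ) =
          s'.var pos + (2 * (B.exits[k].2.length : ℤ) + 1 + 1 + 1) by ring]
        exact h4')
  have hfr := Cmd.den_frame (.rep i nx len readExit) s₁
  rw [List.take_length] at hI
  exact ⟨hI.1, (hfr.var nx (by decide)).trans hnx, hI.2.1, hI.2.2.1⟩

end Solver

end Evac

/-! ### A box around the polygon, and the list of its squares -/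

namespace Evac

namespace Solver

open ArrLang Var Arr

/-- Increase `rad` to at least the value of an expression. -/
def grow (e : E) : C := .ite (rad ≺ e) (rad ::= e) .skip

/-- Increase `rad` to at least the distance of a vertex from the base square. -/
def growVertex : C :=
  grow (rd x1 i - rd px 0) ;; grow (rd px 0 - rd x1 i) ;;
  grow (rd y1 i - rd py 0) ;; grow (rd py 0 - rd y1 i)

/-- Find a square box around the base square that contains the polygon. -/
def radius : C :=
  rad ::= 0 ;;
  .rep i ne len growVertex ;;
  side ::= (rad : E) + rad + 1

theorem growVertex_var (s : St) : (growVertex.den s).var rad =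
    max (s.var rad) (max |s.arr x1 (s.var i) - s.arr px 0| |s.arr y1 (s.var i) - s.arr py 0|) := by
  have hg : ∀ (s : St) (e : E), (grow e).den s = s.setVar rad (max (s.var rad) (e.val s)) := by
    intro s e
    rw [grow, Cmd.den_ite_lt]
    split_ifs with h
    · rw [Cmd.den_set, max_eq_right (show s.var rad ≤ e.val s from le_of_lt h)]
    · rw [Cmd.den_skip, max_eq_left (show e.val s ≤ s.var rad from not_lt.1 h)]
      simp [Store.setVar]
  simp only [growVertex, Cmd.den_seq, hg, abs_eq_max_neg]
  simp

/-- The last claim, minimality of the radius, is what will bound the box by the area. -/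
theorem radius_spec (s : St) (Es : List ((ℤ × ℤ) × (ℤ × ℤ))) (hE : Holds (edgeAt s) Es)
    (hne : s.var ne = Es.length) (hlen : s.var ne ≤ s.var len) :
    0 ≤ (radius.den s).var rad ∧ (radius.den s).var side = 2 * (radius.den s).var rad + 1 ∧
    (∀ e ∈ Es, |e.1.1 - s.arr px 0| ≤ (radius.den s).var rad ∧
      |e.1.2 - s.arr py 0| ≤ (radius.den s).var rad) ∧
    (∀ b : ℤ, 0 ≤ b → (∀ e ∈ Es, |e.1.1 - s.arr px 0| ≤ b ∧ |e.1.2 - s.arr py 0| ≤ b) →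
      (radius.den s).var rad ≤ b) := by
  rw [radius]
  simp only [Cmd.den_seq, Cmd.den_set]
  generalize hs₁ : s.setVar rad _ = s₁
  have ha : s₁.arr = s.arr := by subst hs₁; simp
  have hI := rep_induction (x := i) (v := ne) (cap := len) (c := growVertex) (s := s₁)
    (fun k s' => 0 ≤ s'.var rad ∧ (∀ e ∈ Es.take k, |e.1.1 - s.arr px 0| ≤ s'.var rad ∧
      |e.1.2 - s.arr py 0| ≤ s'.var rad) ∧
      ∀ b : ℤ, 0 ≤ b → (∀ e ∈ Es, |e.1.1 - s.arr px 0| ≤ b ∧ |e.1.2 - s.arr py 0| ≤ b) →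
      s'.var rad ≤ b)
    Es.length (by decide) (by subst hs₁; simpa using hne) (by subst hs₁; simpa using hlen)
    (by subst hs₁; exact ⟨by simp, by simp, fun b hb _ => by simpa using hb⟩) (by
      rintro k hk s' ⟨h1, h2, h3⟩ hi hf
      have hv := growVertex_var s'
      have e1 := hE k hk
      rw [edgeAt, ← ha] at e1
      rw [hi, hf.arr x1 (by decide), hf.arr y1 (by decide), hf.arr px (by decide),
        hf.arr py (by decide)] at hv
      have e2 : s₁.arr x1 k = Es[k].1.1 := by rw [← e1]
      have e3 : s₁.arr y1 k = Es[k].1.2 := by rw [← e1]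
      rw [e2, e3, ha] at hv
      simp only [Store.setVar_var, reduceCtorEq, if_false]
      rw [hv]
      refine ⟨by omega, fun e he => ?_, fun b hb hE' => ?_⟩
      · rw [List.take_succ_eq_append_getElem hk, List.mem_append, List.mem_singleton] at he
        rcases he with he | rfl
        · have := h2 e he; omega
        · omega
      · have := h3 b hb hE'
        have := hE' _ (List.getElem_mem hk)
        omega)
  rw [List.take_length] at hI
  refine ⟨by simpa using hI.1, ?_, by simpa using hI.2.1, by simpa using hI.2.2⟩
  simp; ring

/-- Change the parity if the ray from the square `(x, y)` crosses the edge number `k`. -/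
def cross : C :=
  .ite (rd x1 k ≐ rd x2 k) (.ite (rd x1 k ≺ (x : E) + 1)
    (.ite (rd y1 k ≺ (y : E) + 1) (.ite (y ≺ rd y2 k) (par ::= (1 : E) - par) .skip)
      (.ite (rd y2 k ≺ (y : E) + 1) (par ::= (1 : E) - par) .skip)) .skip) .skip

/-- List the square `(x, y)` if it is in the polygon. -/
def pushCell : C :=
  par ::= 0 ;;
  .rep k ne len cross ;;
  .ite par (.put qx na x ;; .put qy na y ;; na ::= (na : E) + 1) .skip

/-- List the square number `j` in the row of the box if it is in the polygon. -/
def scanCell : C := y ::= rd py 0 - rad + j ;; pushCell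

/-- List the squares of the polygon in one row of the box. -/
def scanRow : C :=
  x ::= rd px 0 - rad + i ;;
  .rep j side side scanCell

/-- List the squares of the polygon. -/
def scan : C :=
  na ::= 0 ;;
  .rep i side side scanRow ;;
  nm ::= (na : E) + nx

/-- The table of places. -/
def placeAt (s : St) (z : ℤ) : ℤ × ℤ := (s.arr qx z, s.arr qy z)

/-- A weak inequality is tested as a strict one against the successor. The two inner branches treat
edges that run upwards and downwards, in place of minimum and maximum. -/
theorem cross_var (s : St) : (cross.den s).var par =
    if Building.CrossesRay (s.var x, s.var y) (edgeAt s (s.var k)) then 1 - s.var par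
    else s.var par := by
  have h : (cross.den s).var par = if s.arr x1 (s.var k) = s.arr x2 (s.var k) then
      if s.arr x1 (s.var k) < s.var x + 1 then
        if s.arr y1 (s.var k) < s.var y + 1 then
          if s.var y < s.arr y2 (s.var k) then 1 - s.var par else s.var par
        else if s.arr y2 (s.var k) < s.var y + 1 then 1 - s.var par else s.var par
      else s.var par
    else s.var par := by
    simp only [cross, Cmd.den_ite_eq, Cmd.den_ite_lt, Ex.val_arr, Ex.val_var, Ex.val_add, Ex.val_one]
    repeat' split
    all_goals simp only [*, if_true, if_false, Cmd.den_set, Cmd.den_skip, Store.setVar_var,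
      Ex.val_sub, Ex.val_one, Ex.val_var]
  rw [h]
  simp only [Building.CrossesRay, edgeAt]
  repeat' split
  all_goals first | rfl | omega

theorem parity_spec (s : St) (B : Building) (hE : Holds (edgeAt s) B.edges)
    (hne : s.var ne = B.edges.length) (hlen : s.var ne ≤ s.var len) (hpar : s.var par = 0) :
    ((Cmd.rep k ne len cross).den s).var par =
      if B.parity (s.var x, s.var y) = 1 then 1 else 0 := by
  have hI := rep_induction (x := k) (v := ne) (cap := len) (c := cross) (s := s)
    (fun n s' => s'.var par = if (((B.edges.take n).map fun e =>
      if Building.CrossesRay (s.var x, s.var y) e then (1 : ZMod 2) else 0).sum = 1) then 1 else 0)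
    B.edges.length (by decide) hne hlen (by simp [hpar]) (by
      rintro n hn s' h1 hk hf
      have e1 : edgeAt s' (s'.var k) = B.edges[n] := by
        rw [← hE n hn, hk]
        simp only [edgeAt, hf.arr x1 (by decide), hf.arr y1 (by decide), hf.arr x2 (by decide),
          hf.arr y2 (by decide)]
      have hv := cross_var s'
      rw [e1, hf.var x (by decide), hf.var y (by decide), h1] at hv
      simp only [Store.setVar_var, reduceCtorEq, if_false]
      rw [hv, List.take_succ_eq_append_getElem hn, List.map_append, List.sum_append]
      generalize (((B.edges.take n).map fun e =>
        if Building.CrossesRay (s.var x, s.var y) e then (1 : ZMod 2) else 0).sum) = z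
      simp only [List.map_cons, List.map_nil, List.sum_cons, List.sum_nil, add_zero]
      have hz : ∀ z : ZMod 2, z + 1 = 1 ↔ ¬ z = 1 := by decide
      by_cases hc : Building.CrossesRay (s.var x, s.var y) B.edges[n]
      · simp only [hc, if_true, hz]
        by_cases h : z = 1 <;> simp [h]
      · simp [hc])
  rw [List.take_length] at hI
  exact hI

theorem pushCell_spec (s : St) (B : Building) (hB : B.IsValid) (hE : Holds (edgeAt s) B.edges)
    (hne : s.var ne = B.edges.length) (hlen : s.var ne ≤ s.var len) (L : List Square)
    (hL : Holds (placeAt s) L) (hna : s.var na = L.length) :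
    Holds (placeAt (pushCell.den s))
      (if (s.var x, s.var y) ∈ B.cells then L ++ [(s.var x, s.var y)] else L) ∧
    (pushCell.den s).var na =
      (if (s.var x, s.var y) ∈ B.cells then L ++ [(s.var x, s.var y)] else L).length := by
  rw [pushCell]
  simp only [Cmd.den_seq, Cmd.den_set]
  generalize hs₁ : s.setVar par _ = s₁
  have hp := parity_spec s₁ B (by subst hs₁; exact hE) (by subst hs₁; simpa using hne)
    (by subst hs₁; simpa using hlen) (by subst hs₁; simp)
  have hf := Cmd.den_frame (.rep k ne len cross) s₁
  generalize (Cmd.rep k ne len cross).den s₁ = s₂ at hp hf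
  have hx : s₂.var x = s.var x := (hf.var x (by decide)).trans (by subst hs₁; simp)
  have hy : s₂.var y = s.var y := (hf.var y (by decide)).trans (by subst hs₁; simp)
  have hn : s₂.var na = L.length := (hf.var na (by decide)).trans (by subst hs₁; simpa using hna)
  have hqx : s₂.arr qx = s.arr qx := (hf.arr qx (by decide)).trans (by subst hs₁; simp)
  have hqy : s₂.arr qy = s.arr qy := (hf.arr qy (by decide)).trans (by subst hs₁; simp)
  rw [show s₁.var x = s.var x by subst hs₁; simp, show s₁.var y = s.var y by subst hs₁; simp] at hp
  rw [Cmd.den_ite, Ex.val_var]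
  by_cases hc : (s.var x, s.var y) ∈ B.cells
  · rw [if_pos ((hB.mem_cells_iff _).1 hc)] at hp
    rw [if_pos hc, if_pos (by simp [hp])]
    refine ⟨hL.push (fun w h0 h1 => ?_) ?_, by simp [hn]⟩
    · simp [placeAt, hn, hx, hy, h1.ne, hqx, hqy]
    · simp [placeAt, hn, hx, hy]
  · rw [if_neg fun h => hc ((hB.mem_cells_iff _).2 h)] at hp
    rw [if_neg hc, if_neg (by simp [hp])]
    refine ⟨?_, by simp [hn]⟩
    simpa [Holds, placeAt, hqx, hqy] using hL

/-- Of the polygon, exactly the squares in the set have been listed in the table of places. -/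
def Listed (B : Building) (S : Set Square) (s : St) : Prop :=
  ∃ L : List Square, Holds (placeAt s) L ∧ s.var na = L.length ∧ L.Nodup ∧
    ∀ q, q ∈ L ↔ q ∈ B.cells ∧ q ∈ S

theorem Listed.congr {B : Building} {S S' : Set Square} {s s' : St} (h : Listed B S s)
    (hS : ∀ q ∈ B.cells, q ∈ S ↔ q ∈ S') (hx : s'.arr qx = s.arr qx) (hy : s'.arr qy = s.arr qy)
    (hn : s'.var na = s.var na) : Listed B S' s' := by
  obtain ⟨L, h1, h2, h3, h4⟩ := h
  refine ⟨L, ?_, hn.trans h2, h3, fun q => ?_⟩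
  · simpa [Holds, placeAt, hx, hy] using h1
  · rw [h4, and_congr_right_iff]; exact hS q

theorem Listed.pushCell {B : Building} (hB : B.IsValid) {S : Set Square} {s : St}
    (h : Listed B S s) (hE : Holds (edgeAt s) B.edges)
    (hne : s.var ne = B.edges.length) (hlen : s.var ne ≤ s.var len)
    (hS : (s.var x, s.var y) ∉ S) : Listed B (insert (s.var x, s.var y) S) (pushCell.den s) := by
  obtain ⟨L, h1, h2, h3, h4⟩ := h
  obtain ⟨h5, h6⟩ := pushCell_spec s B hB hE hne hlen L h1 h2
  refine ⟨_, h5, h6, ?_, fun q => ?_⟩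
  · split_ifs with hc
    · rw [List.nodup_append]
      refine ⟨h3, by simp, fun a ha b hb => ?_⟩
      rw [List.mem_singleton] at hb
      rintro rfl
      exact hS (hb ▸ ((h4 a).1 ha).2)
    · exact h3
  · split_ifs with hc
    · rw [List.mem_append, List.mem_singleton, h4, Set.mem_insert_iff]
      constructor
      · rintro (h | rfl)
        · exact ⟨h.1, Or.inr h.2⟩
        · exact ⟨hc, Or.inl rfl⟩
      · rintro ⟨h, rfl | h'⟩
        · exact Or.inr rfl
        · exact Or.inl ⟨h, h'⟩
    · rw [h4, Set.mem_insert_iff, and_congr_right_iff]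
      intro hq
      constructor
      · exact Or.inr
      · rintro (rfl | h)
        · exact absurd hq hc
        · exact h

/-- What the scan of the box needs to know. -/
structure ScanContext (B : Building) (R : ℕ) (a b : ℤ) (s : St) : Prop where
  edges : Holds (edgeAt s) B.edges
  ne : s.var ne = B.edges.length
  len : s.var Var.ne ≤ s.var len
  rad : s.var rad = R
  side : s.var side = (2 * R + 1 : ℕ)
  fst : s.arr px 0 = a
  snd : s.arr py 0 = b

theorem ScanContext.congr {B : Building} {R : ℕ} {a b : ℤ} {s s' : St} (h : ScanContext B R a b s)
    (hv : ∀ v ∈ [Var.ne, Var.len, Var.rad, Var.side], s'.var v = s.var v)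
    (ha : ∀ a ∈ [x1, y1, x2, y2, px, py], s'.arr a = s.arr a) : ScanContext B R a b s' := by
  simp only [List.mem_cons, List.not_mem_nil, or_false, forall_eq_or_imp, forall_eq] at hv ha
  obtain ⟨h1, h2, h3, h4, h5, h6, h7⟩ := h
  refine ⟨?_, by simp [hv, h2], by simpa [hv] using h3, by simp [hv, h4], by simp [hv, h5],
    by simp [ha, h6], by simp [ha, h7]⟩
  simpa [Holds, edgeAt, ha] using h1

theorem ScanContext.frame {B : Building} {R : ℕ} {a b : ℤ} {c : C} {s s' : St}
    (h : ScanContext B R a b s) (hf : Frame c s s')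
    (hv : ∀ v ∈ [Var.ne, Var.len, Var.rad, Var.side], v ∉ c.vars)
    (ha : ∀ a ∈ [x1, y1, x2, y2, px, py], a ∉ c.arrs) : ScanContext B R a b s' :=
  h.congr (fun v hm => hf.var v (hv v hm)) fun a hm => hf.arr a (ha a hm)

/-- The box is scanned in lexicographic order, and the set of squares dealt with is an initial
segment. Since the polygon lies in the box, the beginning and the end of a row can be described by
half-planes. -/
theorem scanRow_spec (s : St) (B : Building) (hB : B.IsValid) (R : ℕ) (a b : ℤ)
    (hs : ScanContext B R a b s) (hbox : ∀ c ∈ B.cells, |c.1 - a| ≤ R ∧ |c.2 - b| ≤ R) (n : ℤ)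
    (hi : s.var i = n) (hL : Listed B {q | q.1 < a - R + n} s) :
    Listed B {q | q.1 < a - R + (n + 1)} (scanRow.den s) := by
  rw [scanRow]
  simp only [Cmd.den_seq, Cmd.den_set]
  generalize hs₁ : s.setVar x _ = s₁
  have hx₁ : s₁.var x = a - R + n := by
    subst hs₁; simp [hs.fst, hs.rad, hi]
  have hc₁ : ScanContext B R a b s₁ := by
    subst hs₁; exact hs.congr (by simp) (by simp)
  have hI := rep_induction (x := j) (v := side) (cap := side) (c := scanCell) (s := s₁)
    (fun k s' => Listed B {q | q.1 < a - R + n ∨ (q.1 = a - R + n ∧ q.2 < b - R + k)} s')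
    (2 * R + 1) (by decide) hc₁.side le_rfl
    (by
      subst hs₁
      refine hL.congr (fun q hq => ?_) (by simp) (by simp) (by simp)
      simp only [Set.mem_ofPred_eq]
      have h1 := hbox q hq
      rw [abs_le, abs_le] at h1
      push_cast
      omega) (by
      intro k hk s₂ hL₂ hj hf
      have hc₂ := hc₁.frame hf (by decide) (by decide)
      rw [scanCell]
      simp only [Cmd.den_seq, Cmd.den_set]
      generalize hs₃ : s₂.setVar y _ = s₃
      have hc₃ : ScanContext B R a b s₃ := by
        subst hs₃; exact hc₂.congr (by simp) (by simp)
      have hx₃ : s₃.var x = a - R + n := by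
        subst hs₃; simp [hf.var x (by decide), hx₁]
      have hy₃ : s₃.var y = b - R + k := by
        subst hs₃; simp [hc₂.snd, hc₂.rad, hj]
      have hL₃ : Listed B {q | q.1 < a - R + n ∨ (q.1 = a - R + n ∧ q.2 < b - R + k)} s₃ := by
        subst hs₃
        exact hL₂.congr (fun _ _ => Iff.rfl) (by simp) (by simp) (by simp)
      have hP := hL₃.pushCell hB hc₃.edges hc₃.ne hc₃.len (by rw [hx₃, hy₃]; simp)
      refine hP.congr (fun q _ => ?_) (by simp) (by simp) (by simp)
      rw [hx₃, hy₃]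
      simp only [Set.mem_insert_iff, Set.mem_ofPred_eq, Prod.ext_iff]
      push_cast
      omega)
  refine hI.congr (fun q hq => ?_) rfl rfl rfl
  have h1 := hbox q hq
  rw [abs_le, abs_le] at h1
  simp only [Set.mem_ofPred_eq]
  push_cast
  omega

theorem scan_spec (s : St) (B : Building) (hB : B.IsValid) (R : ℕ) (a b : ℤ)
    (hs : ScanContext B R a b s) (hbox : ∀ c ∈ B.cells, |c.1 - a| ≤ R ∧ |c.2 - b| ≤ R) :
    Listed B Set.univ (scan.den s) ∧ (scan.den s).var nm = (scan.den s).var na + s.var nx := by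
  rw [scan]
  simp only [Cmd.den_seq, Cmd.den_set]
  generalize hs₁ : s.setVar na _ = s₁
  have hc₁ : ScanContext B R a b s₁ := by
    subst hs₁; exact hs.congr (by simp) (by simp)
  have hI := rep_induction (x := i) (v := side) (cap := side) (c := scanRow) (s := s₁)
    (fun n s' => Listed B {q | q.1 < a - R + n} s') (2 * R + 1) (by decide) hc₁.side le_rfl
    (by
      subst hs₁
      refine ⟨[], Holds.nil _, by simp, by simp, fun q => ?_⟩
      simp only [List.not_mem_nil, false_iff, not_and, Set.mem_ofPred_eq]
      intro hq h
      have h1 := hbox q hq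
      rw [abs_le] at h1
      push_cast at h
      omega) (by
      intro n hn s₂ hL₂ hi hf
      exact (scanRow_spec s₂ B hB R a b (hc₁.frame hf (by decide) (by decide)) hbox n hi hL₂).congr
        (fun q _ => by push_cast; rfl) (by simp) (by simp) (by simp))
  have hf := Cmd.den_frame (.rep i side side scanRow) s₁
  refine ⟨hI.congr (fun q hq => ?_) (by simp) (by simp) (by simp), ?_⟩
  · have h1 := hbox q hq
    rw [abs_le, abs_le] at h1
    simp only [Set.mem_ofPred_eq, Set.mem_univ, iff_true]
    push_cast
    omega
  · simp [hf.var nx (by decide)]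
    subst hs₁; simp

end Solver

end Evac

/-! ### The numbering of places, and the list of possible moves -/

namespace Evac

namespace Solver

open ArrLang Var Arr

/-- List the exits as places. -/
def addExits : C :=
  .rep i nx len (.put qx ((na : E) + i) (rd ex i) ;; .put qy ((na : E) + i) (rd ey i))

theorem addExits_spec (s : St) (L X : List Square) (hL : Holds (placeAt s) L)
    (hna : s.var na = L.length) (hX : Holds (exitAt s) X) (hnx : s.var nx = X.length)
    (hlen : s.var nx ≤ s.var len) : Holds (placeAt (addExits.den s)) (L ++ X) := by
  have hI := rep_induction (x := i) (v := nx) (cap := len) (c :=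
      (.put qx ((na : E) + i) (rd ex i) ;; .put qy ((na : E) + i) (rd ey i))) (s := s)
    (fun n s' => Holds (placeAt s') (L ++ X.take n)) X.length (by decide) hnx hlen
    (by simpa [Holds, placeAt] using hL) (by
      intro n hn s' h1 hi hf
      have e1 : s'.var na = L.length := (hf.var na (by decide)).trans hna
      have e2 : (L ++ X.take n).length = L.length + n := by simp [hn.le]
      have e3 := hX n hn
      simp only [Cmd.den_seq, Cmd.den_put]
      rw [List.take_succ_eq_append_getElem hn, ← List.append_assoc]
      refine h1.push (fun w h0 h2 => ?_) ?_
      · have : (w : ℤ) ≠ L.length + n := by omega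
        simp [placeAt, e1, hi, this]
      · rw [e2, ← e3]
        simp [placeAt, e1, hi, exitAt, hf.arr ex (by decide), hf.arr ey (by decide)])
  rw [List.take_length] at hI
  exact hI

/-- Squares are listed before exits, so a comparison with the number of squares tells the two apart.
-/
theorem isNumbering_of_holds {B : Building} (hB : B.IsValid) {f : ℤ → ℤ × ℤ} {L : List Square}
    (hf : Holds f (L ++ B.exits.map Prod.fst)) (hL : L.Nodup) (hmem : ∀ q, q ∈ L ↔ q ∈ B.cells) :
    IsNumbering B L.length (L.length + B.exits.length) f := by
  have hlen : (L ++ B.exits.map Prod.fst).length = L.length + B.exits.length := by simp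
  have hout : ∀ e ∈ B.exits.map Prod.fst, e ∉ B.cells := by
    intro e he
    obtain ⟨x, hx, rfl⟩ := List.mem_map.1 he
    exact hB.exits_outside x hx
  have hnd : (L ++ B.exits.map Prod.fst).Nodup := by
    rw [List.nodup_append]
    refine ⟨hL, hB.exits_nodup, fun a ha b hb => ?_⟩
    rintro rfl
    exact hout a hb ((hmem a).1 ha)
  have hget : ∀ c (hc : c < L.length), f c = L[c] := by
    intro c hc
    rw [hf c (by rw [hlen]; omega), List.getElem_append_left hc]
  refine ⟨by omega, fun s => ?_, fun a b ha hb he => ?_, fun q h1 h2 => ?_, fun s e h => ?_⟩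
  · rw [← hmem]
    constructor
    · intro h
      obtain ⟨c, hc, rfl⟩ := List.mem_iff_getElem.1 h
      exact ⟨c, hc, hget c hc⟩
    · rintro ⟨c, hc, rfl⟩
      rw [hget c hc]; exact List.getElem_mem hc
  · rw [hf a (by omega), hf b (by omega)] at he
    exact (hnd.getElem_inj_iff).1 he
  · rw [hf q (by omega), List.getElem_append_right h1]
    exact hout _ (List.getElem_mem _)
  · obtain ⟨x, hx, rfl, -⟩ := h
    obtain ⟨k, hk, h⟩ := hf.exists_of_mem
      (List.mem_append_right L (List.mem_map_of_mem (f := Prod.fst) hx))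
    exact ⟨k, by omega, h⟩

/-- Set `flag` if the places number `i` and `j` are equal or neighbours. -/
def nearTest : C :=
  x ::= rd qx i - rd qx j ;;
  y ::= rd qy i - rd qy j ;;
  .ite ((x : E) + y ≺ 2) (.ite (0 - 2 ≺ (x : E) + y) (.ite ((x : E) - y ≺ 2)
    (.ite (0 - 2 ≺ (x : E) - y) (flag ::= 1) .skip) .skip) .skip) .skip

/-- Set `flag` if the pair number `k` consists of the places number `i` and `j`. -/
def entryTest : C :=
  .ite (rd px k ≐ rd qx i) (.ite (rd py k ≐ rd qy i) (.ite (rd pu k ≐ rd qx j)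
    (.ite (rd pv k ≐ rd qy j) (flag ::= 1) .skip) .skip) .skip) .skip

/-- List the pair of the places number `i` and `j` if one can go from the one to the other. -/
def pushArc : C :=
  flag ::= 0 ;;
  .ite (j ≺ na) nearTest .skip ;;
  .rep k np len entryTest ;;
  .ite flag (.put bc nb i ;; .put bq nb j ;; nb ::= (nb : E) + 1) .skip

/-- List all such pairs. -/
def listArcs : C :=
  nb ::= 0 ;;
  .rep i na nm (.rep j nm nm pushArc)

/-- The table of pairs of places. -/
def arcAt (s : St) (z : ℤ) : ℤ × ℤ := (s.arr bc z, s.arr bq z)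

/-- For integers, `|x| + |y| ≤ 1` means that `x + y` and `x - y` both lie strictly between `-2` and
`2`. -/
theorem nearTest_var (s : St) : (nearTest.den s).var flag =
    if placeAt s (s.var i) = placeAt s (s.var j) ∨ Adj (placeAt s (s.var i)) (placeAt s (s.var j))
      then 1 else s.var flag := by
  rw [nearTest]
  simp only [Cmd.den_seq, Cmd.den_set]
  generalize hs₁ : (s.setVar x _).setVar y _ = s₁
  have hx : s₁.var x = s.arr qx (s.var i) - s.arr qx (s.var j) := by subst hs₁; simp
  have hy : s₁.var y = s.arr qy (s.var i) - s.arr qy (s.var j) := by subst hs₁; simp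
  have hfl : s₁.var flag = s.var flag := by subst hs₁; simp
  simp only [Adj, placeAt, Prod.mk.injEq]
  rw [← hx, ← hy, abs_eq_max_neg, abs_eq_max_neg]
  have hx' : s.arr qx (s.var i) = s.arr qx (s.var j) ↔ s₁.var x = 0 := by omega
  have hy' : s.arr qy (s.var i) = s.arr qy (s.var j) ↔ s₁.var y = 0 := by omega
  iterate 4 (all_goals try (rw [Cmd.den_ite_lt]; split))
  all_goals simp only [Ex.val_var, Ex.val_add, Ex.val_ofNat, Ex.val_sub, Ex.val_zero, Cmd.den_set,
    Cmd.den_skip] at *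
  · rw [if_pos (by omega)]; simp
  all_goals rw [if_neg (by omega)]; exact hfl

theorem entryTest_var (s : St) : (entryTest.den s).var flag =
    if entryAt s (s.var k) = (placeAt s (s.var i), placeAt s (s.var j)) then 1
      else s.var flag := by
  simp only [entryTest, entryAt, placeAt, Prod.mk.injEq]
  iterate 4 (all_goals try (rw [Cmd.den_ite_eq]; split))
  all_goals simp only [Ex.val_var, Ex.val_arr, Cmd.den_set, Cmd.den_skip] at *
  · rw [if_pos (by tauto)]; simp
  all_goals rw [if_neg (by tauto)]

theorem entries_spec (s : St) (P : List (Square × Square)) (hP : Holds (entryAt s) P)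
    (hnp : s.var np = P.length) (hlen : s.var np ≤ s.var len) :
    ((Cmd.rep k np len entryTest).den s).var flag =
      if (placeAt s (s.var i), placeAt s (s.var j)) ∈ P then 1 else s.var flag := by
  have hI := rep_induction (x := k) (v := np) (cap := len) (c := entryTest) (s := s)
    (fun n s' => s'.var flag =
      if (placeAt s (s.var i), placeAt s (s.var j)) ∈ P.take n then 1 else s.var flag)
    P.length (by decide) hnp hlen (by simp) (by
      intro n hn s' h1 hk hf
      have e1 : entryAt s' (s'.var k) = P[n] := by
        rw [← hP n hn, hk]
        simp only [entryAt, hf.arr px (by decide), hf.arr py (by decide), hf.arr pu (by decide),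
          hf.arr pv (by decide)]
      have e2 : ∀ z, placeAt s' z = placeAt s z := by
        intro z
        simp only [placeAt, hf.arr qx (by decide), hf.arr qy (by decide)]
      have hv := entryTest_var s'
      rw [e1, e2, e2, hf.var i (by decide), hf.var j (by decide), h1] at hv
      simp only [Store.setVar_var, reduceCtorEq, if_false]
      rw [hv, List.take_succ_eq_append_getElem hn]
      simp only [List.mem_append, List.mem_singleton, eq_comm (a := P[n])]
      by_cases h2 : (placeAt s (s.var i), placeAt s (s.var j)) = P[n] <;> simp [h2])
  rw [List.take_length] at hI
  exact hI

/-- What the listing of arcs needs to know. -/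
structure ArcContext (B : Building) (A M : ℕ) (X : ℤ → Square) (s : St) : Prop where
  place : placeAt s = X
  entries : Holds (entryAt s) (entries B.exits)
  np : s.var np = (Solver.entries B.exits).length
  len : s.var Var.np ≤ s.var len
  na : s.var na = A
  nm : s.var nm = M

theorem ArcContext.congr {B : Building} {A M : ℕ} {X : ℤ → Square} {s s' : St}
    (h : ArcContext B A M X s)
    (hv : ∀ v ∈ [Var.np, Var.len, Var.na, Var.nm], s'.var v = s.var v)
    (ha : ∀ a ∈ [qx, qy, px, py, pu, pv], s'.arr a = s.arr a) : ArcContext B A M X s' := by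
  simp only [List.mem_cons, List.not_mem_nil, or_false, forall_eq_or_imp, forall_eq] at hv ha
  obtain ⟨h1, h2, h3, h4, h5, h6⟩ := h
  refine ⟨?_, ?_, by simp [hv, h3], by simpa [hv] using h4, by simp [hv, h5], by simp [hv, h6]⟩
  · rw [← h1]; funext z; simp [placeAt, ha]
  · simpa [Holds, entryAt, ha] using h2

theorem ArcContext.frame {B : Building} {A M : ℕ} {X : ℤ → Square} {c : C} {s s' : St}
    (h : ArcContext B A M X s) (hf : Frame c s s')
    (hv : ∀ v ∈ [Var.np, Var.len, Var.na, Var.nm], v ∉ c.vars)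
    (ha : ∀ a ∈ [qx, qy, px, py, pu, pv], a ∉ c.arrs) : ArcContext B A M X s' :=
  h.congr (fun v hm => hf.var v (hv v hm)) fun a hm => hf.arr a (ha a hm)

-- The two ways of making a step are tested separately: closeness counts only if the target is a
-- square of the polygon, and an exit is reached only through a listed pair.
open Classical in
theorem pushArc_spec (s : St) (B : Building) (A M : ℕ) (X : ℤ → Square)
    (hX : IsNumbering B A M X) (hs : ArcContext B A M X s) (c q : ℕ) (hq : q < M)
    (hi : s.var i = c) (hj : s.var j = q) (l : List (ℤ × ℤ)) (hl : Holds (arcAt s) l)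
    (hnb : s.var nb = l.length) :
    Holds (arcAt (pushArc.den s)) (if Step B (X c) (X q) then l ++ [((c : ℤ), (q : ℤ))] else l) ∧
    (pushArc.den s).var nb =
      (if Step B (X c) (X q) then l ++ [((c : ℤ), (q : ℤ))] else l).length := by
  rw [pushArc]
  simp only [Cmd.den_seq, Cmd.den_set]
  generalize hs₁ : s.setVar flag _ = s₁
  have hc₁ : ArcContext B A M X s₁ := by subst hs₁; exact hs.congr (by simp) (by simp)
  have hf₁ := Cmd.den_frame (.ite (j ≺ na) nearTest .skip) s₁
  have hfl : ((Cmd.ite (j ≺ na) nearTest .skip : C).den s₁).var flag =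
      if X q ∈ B.cells ∧ (X c = X q ∨ Adj (X c) (X q)) then 1 else 0 := by
    have h1 : s₁.var j = q := by subst hs₁; simpa using hj
    have h2 : s₁.var i = c := by subst hs₁; simpa using hi
    have h3 : s₁.var flag = 0 := by subst hs₁; simp
    rw [Cmd.den_ite_lt, Ex.val_var, Ex.val_var, h1, hc₁.na]
    have h4 := hX.mem_cells_iff hq
    by_cases h : q < A
    · rw [if_pos (by exact_mod_cast h), nearTest_var, hc₁.place, h1, h2, h3]
      simp [h4, h]
    · rw [if_neg (by exact_mod_cast h), Cmd.den_skip, h3]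
      simp [h4, h]
  generalize (Cmd.ite (j ≺ na) nearTest .skip : C).den s₁ = s₂ at hf₁ hfl
  have hc₂ := hc₁.frame hf₁ (by decide) (by decide)
  have hf₂ := Cmd.den_frame (.rep k np len entryTest) s₂
  have hi₂ : s₂.var i = c := (hf₁.var i (by decide)).trans (by subst hs₁; simpa using hi)
  have hj₂ : s₂.var j = q := (hf₁.var j (by decide)).trans (by subst hs₁; simpa using hj)
  have hfl₃ := entries_spec s₂ _ hc₂.entries hc₂.np hc₂.len
  generalize (Cmd.rep k np len entryTest).den s₂ = s₃ at hf₂ hfl₃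
  rw [hc₂.place, hi₂, hj₂, hfl] at hfl₃
  simp only [mem_entries] at hfl₃
  have hi₃ : s₃.var i = c := (hf₂.var i (by decide)).trans hi₂
  have hj₃ : s₃.var j = q := (hf₂.var j (by decide)).trans hj₂
  have hn₃ : s₃.var nb = l.length := by
    rw [hf₂.var nb (by decide), hf₁.var nb (by decide)]; subst hs₁; simpa using hnb
  have hbc : s₃.arr bc = s.arr bc := by
    rw [hf₂.arr bc (by decide), hf₁.arr bc (by decide)]; subst hs₁; simp
  have hbq : s₃.arr bq = s.arr bq := by
    rw [hf₂.arr bq (by decide), hf₁.arr bq (by decide)]; subst hs₁; simp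
  rw [Cmd.den_ite, Ex.val_var]
  by_cases hst : Step B (X c) (X q)
  · have h1 : s₃.var flag ≠ 0 := by
      rw [hfl₃]
      rcases hst with h | h
      · simp [h]
      · simp [h]
    rw [if_pos h1, if_pos hst]
    refine ⟨hl.push (fun w h0 h1 => ?_) ?_, by simp [hn₃]⟩
    · simp [arcAt, hn₃, h1.ne, hbc, hbq]
    · simp [arcAt, hn₃, hi₃, hj₃]
  · rw [Step, not_or] at hst
    have h1 : s₃.var flag = 0 := by
      rw [hfl₃, if_neg hst.2, if_neg hst.1]
    rw [if_neg (by simp [h1]), if_neg (by rw [Step, not_or]; exact hst)]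
    refine ⟨?_, by simp [hn₃]⟩
    simpa [Holds, arcAt, hbc, hbq] using hl

/-- Exactly the arcs for pairs of numbers from the set have been listed. -/
def ArcsListed (B : Building) (X : ℤ → Square) (S : Set (ℕ × ℕ)) (s : St) : Prop :=
  ∃ l : List (ℤ × ℤ), Holds (arcAt s) l ∧ s.var nb = l.length ∧ l.Nodup ∧
    ∀ u r, (u, r) ∈ l ↔ ∃ c q : ℕ, (c, q) ∈ S ∧ Step B (X c) (X q) ∧ u = c ∧ r = q

theorem ArcsListed.congr {B : Building} {X : ℤ → Square} {S S' : Set (ℕ × ℕ)} {s s' : St}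
    (h : ArcsListed B X S s) (hS : ∀ p, p ∈ S ↔ p ∈ S') (hx : s'.arr bc = s.arr bc)
    (hy : s'.arr bq = s.arr bq) (hn : s'.var nb = s.var nb) : ArcsListed B X S' s' := by
  obtain ⟨l, h1, h2, h3, h4⟩ := h
  obtain rfl : S = S' := Set.ext hS
  refine ⟨l, ?_, hn.trans h2, h3, h4⟩
  simpa [Holds, arcAt, hx, hy] using h1

open Classical in
theorem ArcsListed.pushArc {B : Building} {A M : ℕ} {X : ℤ → Square} {S : Set (ℕ × ℕ)} {s : St}
    (h : ArcsListed B X S s) (hX : IsNumbering B A M X) (hs : ArcContext B A M X s) (c q : ℕ)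
    (hq : q < M) (hi : s.var i = c) (hj : s.var j = q) (hS : (c, q) ∉ S) :
    ArcsListed B X (insert (c, q) S) (pushArc.den s) := by
  obtain ⟨l, h1, h2, h3, h4⟩ := h
  obtain ⟨h5, h6⟩ := pushArc_spec s B A M X hX hs c q hq hi hj l h1 h2
  refine ⟨_, h5, h6, ?_, fun u r => ?_⟩
  · split_ifs with hc
    · rw [List.nodup_append]
      refine ⟨h3, by simp, fun a ha b hb => ?_⟩
      rw [List.mem_singleton] at hb
      subst hb
      rintro rfl
      obtain ⟨c', q', h7, -, h8, h9⟩ := (h4 _ _).1 ha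
      rw [Nat.cast_inj] at h8 h9
      rw [h8, h9] at hS
      exact hS h7
    · exact h3
  · have : (u, r) ∈ (if Step B (X c) (X q) then l ++ [((c : ℤ), (q : ℤ))] else l) ↔
        (u, r) ∈ l ∨ (Step B (X c) (X q) ∧ u = c ∧ r = q) := by
      split_ifs with hc <;> simp [hc]
    rw [this, h4]
    constructor
    · rintro (⟨c', q', h7, h8⟩ | ⟨h7, h8⟩)
      · exact ⟨c', q', Or.inr h7, h8⟩
      · exact ⟨c, q, Or.inl rfl, h7, h8⟩
    · rintro ⟨c', q', h7 | h7, h8⟩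
      · rw [Prod.mk.injEq] at h7
        obtain ⟨rfl, rfl⟩ := h7
        exact Or.inr h8
      · exact Or.inl ⟨c', q', h7, h8⟩

/-- The bound on the number of arcs comes from their distinctness; it is needed because this number
caps the loops that build the bipartite graph. -/
theorem listArcs_spec (s : St) (B : Building) (A M : ℕ) (X : ℤ → Square)
    (hX : IsNumbering B A M X) (hs : ArcContext B A M X s) :
    ∃ l : List (ℤ × ℤ), Holds (arcAt (listArcs.den s)) l ∧ (listArcs.den s).var nb = l.length ∧
      l.length ≤ A * M ∧ IsArcList B A M X l := by
  rw [listArcs]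
  simp only [Cmd.den_seq, Cmd.den_set]
  generalize hs₁ : s.setVar nb _ = s₁
  have hc₁ : ArcContext B A M X s₁ := by subst hs₁; exact hs.congr (by simp) (by simp)
  have hI := rep_induction (x := i) (v := na) (cap := nm) (c := .rep j nm nm pushArc) (s := s₁)
    (fun n s' => ArcsListed B X {p | p.1 < n ∧ p.2 < M} s') A (by decide) hc₁.na
    (by rw [hc₁.na, hc₁.nm]; exact_mod_cast hX.le)
    (by
      subst hs₁
      exact ⟨[], Holds.nil _, by simp, by simp, by simp⟩) (by
      intro n hn s₂ hL₂ hi hf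
      have hc₂ := hc₁.frame hf (by decide) (by decide)
      have hJ := rep_induction (x := j) (v := nm) (cap := nm) (c := Solver.pushArc) (s := s₂)
        (fun k s' => ArcsListed B X {p | p.2 < M ∧ (p.1 < n ∨ (p.1 = n ∧ p.2 < k))} s') M (by decide)
        hc₂.nm le_rfl
        (hL₂.congr (fun p => by simp only [Set.mem_ofPred_eq]; omega)
          (by simp) (by simp) (by simp)) (by
          intro k hk s₃ hL₃ hj hf₃
          have hc₃ := hc₂.frame hf₃ (by decide) (by decide)
          refine (hL₃.pushArc hX hc₃ n k hk ((hf₃.var i (by decide)).trans hi) hj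
            (by simp)).congr (fun p => ?_) (by simp) (by simp) (by simp)
          simp only [Set.mem_insert_iff, Set.mem_ofPred_eq, Prod.ext_iff]
          omega)
      refine hJ.congr (fun p => ?_) (by simp) (by simp) (by simp)
      simp only [Set.mem_ofPred_eq]
      omega)
  obtain ⟨l, h1, h2, h3, h4⟩ := hI
  have hl : IsArcList B A M X l := by
    intro u r
    rw [h4]
    simp only [Set.mem_ofPred_eq, and_assoc]
  refine ⟨l, h1, h2, ?_, hl⟩
  classical
  rw [← List.toFinset_card_of_nodup h3]
  have : l.toFinset ⊆ (Finset.range A ×ˢ Finset.range M).image fun p => ((p.1 : ℤ), (p.2 : ℤ)) := by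
    rintro ⟨u, r⟩ hur
    obtain ⟨c, q, hc, hq, -, rfl, rfl⟩ := (hl u r).1 (List.mem_toFinset.1 hur)
    exact Finset.mem_image.2 ⟨(c, q), by simp [hc, hq], rfl⟩
  refine (Finset.card_le_card this).trans (Finset.card_image_le.trans ?_)
  simp

end Solver

end Evac

namespace Evac

namespace Solver

open ArrLang Var Arr

/-! #### The bipartite graph -/

/-- Append an edge to the list of edges. -/
def pushEdge (a b : E) : C := .put el m a ;; .put er m b ;; m ::= (m : E) + 1

/-- List the edge for the arc number `j` in layer `i`. -/
def buildArc : C :=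
  .ite (rd bq j ≺ na)
    (.ite ((i : E) + 1 ≺ tt) (pushEdge ((uo : E) + rd bc j) ((ro : E) + nm + rd bq j)) .skip)
    (pushEdge ((uo : E) + rd bc j) ((ro : E) + nm + rd bq j))

/-- List the edges of layer `i`. -/
def buildLayer : C :=
  .rep j nb nb buildArc ;;
  .ite (0 ≺ i) (.rep j na na (pushEdge ((uo : E) + j) ((ro : E) + j))) .skip ;;
  uo ::= (uo : E) + na ;;
  ro ::= (ro : E) + nm

/-- List the edges of the bipartite graph. -/
def build : C :=
  m ::= 0 ;;
  uo ::= 0 ;;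
  ro ::= 0 ;;
  .rep i tt tt buildLayer ;;
  nl ::= uo ;;
  nrt ::= (ro : E) + nm ;;
  cap ::= (nl : E) + nrt + 1

/-- The table of edges of the bipartite graph. -/
def pairAt (s : St) (z : ℤ) : ℤ × ℤ := (s.arr el z, s.arr er z)

theorem pushEdge_spec (s : St) (a b : E) (L : List (ℤ × ℤ)) (hL : Holds (pairAt s) L)
    (hm : s.var m = L.length) (hb : b.val (s.setArr el (s.var m) (a.val s)) = b.val s) :
    Holds (pairAt ((pushEdge a b).den s)) (L ++ [(a.val s, b.val s)]) ∧
      ((pushEdge a b).den s).var m = (L ++ [(a.val s, b.val s)]).length := by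
  simp only [pushEdge, Cmd.den_seq, Cmd.den_put, Cmd.den_set, Ex.val_var]
  rw [hb]
  refine ⟨hL.push (fun w h0 h1 => ?_) ?_, by simp [hm]⟩
  · simp [pairAt, hm, h1.ne]
  · simp [pairAt, hm]

/-- What the listing of edges needs to know. -/
structure BuildContext (A M T : ℕ) (l : List (ℤ × ℤ)) (s : St) : Prop where
  arcs : Holds (arcAt s) l
  nb : s.var nb = l.length
  na : s.var na = A
  nm : s.var nm = M
  tt : s.var tt = T

theorem BuildContext.congr {A M T : ℕ} {l : List (ℤ × ℤ)} {s s' : St} (h : BuildContext A M T l s)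
    (hv : ∀ v ∈ [Var.nb, Var.na, Var.nm, Var.tt], s'.var v = s.var v)
    (ha : ∀ a ∈ [bc, bq], s'.arr a = s.arr a) : BuildContext A M T l s' := by
  simp only [List.mem_cons, List.not_mem_nil, or_false, forall_eq_or_imp, forall_eq] at hv ha
  obtain ⟨h1, h2, h3, h4, h5⟩ := h
  refine ⟨?_, by simp [hv, h2], by simp [hv, h3], by simp [hv, h4], by simp [hv, h5]⟩
  simpa [Holds, arcAt, ha] using h1

theorem BuildContext.frame {A M T : ℕ} {l : List (ℤ × ℤ)} {c : C} {s s' : St}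
    (h : BuildContext A M T l s) (hf : Frame c s s')
    (hv : ∀ v ∈ [Var.nb, Var.na, Var.nm, Var.tt], v ∉ c.vars)
    (ha : ∀ a ∈ [bc, bq], a ∉ c.arrs) : BuildContext A M T l s' :=
  h.congr (fun v hm => hf.var v (hv v hm)) fun a hm => hf.arr a (ha a hm)

/-- Exactly the given edges have been listed. -/
def EdgesListed (L : List (ℤ × ℤ)) (s : St) : Prop :=
  Holds (pairAt s) L ∧ s.var m = L.length

theorem EdgesListed.congr {L : List (ℤ × ℤ)} {s s' : St} (h : EdgesListed L s)
    (hx : s'.arr el = s.arr el) (hy : s'.arr er = s.arr er) (hm : s'.var m = s.var m) :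
    EdgesListed L s' := by
  refine ⟨?_, hm.trans h.2⟩
  simpa [Holds, pairAt, hx, hy] using h.1

theorem buildArc_spec {A M T : ℕ} {l : List (ℤ × ℤ)} {s : St} (hs : BuildContext A M T l s)
    (n k : ℕ) (hk : k < l.length) (hi : s.var i = n) (hj : s.var j = k)
    (huo : s.var uo = n * A) (hro : s.var ro = n * M) {L : List (ℤ × ℤ)} (hL : EdgesListed L s) :
    EdgesListed (L ++ ([l[k]].filter fun b => (A : ℤ) ≤ b.2 ∨ n + 1 < T).map
      fun b => ((n * A + b.1 : ℤ), ((n + 1) * M + b.2 : ℤ))) (buildArc.den s) := by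
  have harc := hs.arcs k hk
  have h1 : s.arr bc k = l[k].1 := by rw [← harc]; rfl
  have h2 : s.arr bq k = l[k].2 := by rw [← harc]; rfl
  have hp := pushEdge_spec s ((uo : E) + rd bc j) ((ro : E) + nm + rd bq j) L hL.1 hL.2 (by simp)
  simp only [Ex.val_add, Ex.val_var, Ex.val_arr, hj, h1, h2, huo, hro, hs.nm] at hp
  rw [show (n : ℤ) * M + M + l[k].2 = (n + 1) * M + l[k].2 by ring] at hp
  rw [buildArc, Cmd.den_ite_lt]
  split
  · rename_i h3
    simp only [Ex.val_arr, Ex.val_var, hj, h2, hs.na] at h3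
    rw [Cmd.den_ite_lt]
    split
    · rename_i h4
      simp only [Ex.val_add, Ex.val_var, Ex.val_one, hi, hs.tt] at h4
      rw [List.filter_cons_of_pos (by simpa using by omega), List.filter_nil, List.map_singleton]
      exact hp
    · rename_i h4
      simp only [Ex.val_add, Ex.val_var, Ex.val_one, hi, hs.tt] at h4
      rw [List.filter_cons_of_neg (by simpa using by omega), List.filter_nil, List.map_nil,
        List.append_nil]
      exact hL
  · rename_i h3
    simp only [Ex.val_arr, Ex.val_var, hj, h2, hs.na] at h3
    rw [List.filter_cons_of_pos (by simpa using by omega), List.filter_nil, List.map_singleton]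
    exact hp

/-- In the absence of multiplication, `uo` and `ro` carry the products `n * A` and `n * M` from
layer to layer by addition. -/
theorem buildLayer_spec {A M T : ℕ} {l : List (ℤ × ℤ)} {s : St} (hs : BuildContext A M T l s)
    (n : ℕ) (hi : s.var i = n) (huo : s.var uo = n * A) (hro : s.var ro = n * M)
    {L : List (ℤ × ℤ)} (hL : EdgesListed L s) :
    EdgesListed (L ++ layer A M T l n) (buildLayer.den s) ∧
      (buildLayer.den s).var uo = (n + 1) * A ∧ (buildLayer.den s).var ro = (n + 1) * M := by
  rw [buildLayer]
  simp only [Cmd.den_seq]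
  have hI := rep_induction (x := j) (v := nb) (cap := nb) (c := buildArc) (s := s)
    (fun k s' => EdgesListed (L ++ ((l.take k).filter fun b => (A : ℤ) ≤ b.2 ∨ n + 1 < T).map
      fun b => ((n * A + b.1 : ℤ), ((n + 1) * M + b.2 : ℤ))) s') l.length (by decide) hs.nb le_rfl
    (by
      simp only [List.take_zero, List.filter_nil, List.map_nil, List.append_nil]
      exact hL.congr (by simp) (by simp) (by simp)) (by
      intro k hk s' h1 hj hf
      rw [List.take_succ_eq_append_getElem hk, List.filter_append, List.map_append,
        ← List.append_assoc]
      exact (buildArc_spec (hs.frame hf (by decide) (by decide)) n k hk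
        ((hf.var i (by decide)).trans hi) hj ((hf.var uo (by decide)).trans huo)
        ((hf.var ro (by decide)).trans hro) h1).congr (by simp) (by simp) (by simp))
  rw [List.take_length] at hI
  have hf := Cmd.den_frame (.rep j nb nb buildArc) s
  generalize (Cmd.rep j nb nb buildArc).den s = s₁ at hI hf
  have hs₁ := hs.frame hf (by decide) (by decide)
  have hi₁ := (hf.var i (by decide)).trans hi
  have huo₁ := (hf.var uo (by decide)).trans huo
  have hro₁ := (hf.var ro (by decide)).trans hro
  have hf₂ := Cmd.den_frame
    (.ite (0 ≺ i) (.rep j na na (pushEdge ((uo : E) + j) ((ro : E) + j))) .skip) s₁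
  have hJ : EdgesListed (L ++ layer A M T l n) ((Cmd.ite (0 ≺ i)
      (.rep j na na (pushEdge ((uo : E) + j) ((ro : E) + j))) .skip : C).den s₁) := by
    rw [layer, ← List.append_assoc, Cmd.den_ite_lt, Ex.val_zero, Ex.val_var, hi₁]
    rcases Nat.eq_zero_or_pos n with h0 | h0
    · rw [if_neg (by omega), if_neg (by omega), List.append_nil]
      exact hI
    · rw [if_pos h0, if_pos (by omega)]
      have hJ := rep_induction (x := j) (v := na) (cap := na)
        (c := pushEdge ((uo : E) + j) ((ro : E) + j)) (s := s₁)
        (fun k s' => EdgesListed (L ++ (l.filter fun b => (A : ℤ) ≤ b.2 ∨ n + 1 < T).map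
            (fun b => ((n * A + b.1 : ℤ), ((n + 1) * M + b.2 : ℤ))) ++
          (List.range k).map fun c : ℕ => ((n * A + c : ℤ), (n * M + c : ℤ))) s') A (by decide)
        hs₁.na le_rfl
        (by
          simp only [List.range_zero, List.map_nil, List.append_nil]
          exact hI.congr (by simp) (by simp) (by simp)) (by
          intro k hk s' h1 hj hf'
          rw [List.range_succ, List.map_append, ← List.append_assoc, List.map_singleton]
          have h2 := pushEdge_spec s' ((uo : E) + j) ((ro : E) + j) _ h1.1 h1.2 (by simp)
          simp only [Ex.val_add, Ex.val_var, hj, (hf'.var uo (by decide)).trans huo₁,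
            (hf'.var ro (by decide)).trans hro₁] at h2
          exact EdgesListed.congr h2 (by simp) (by simp) (by simp))
      exact hJ
  generalize (Cmd.ite (0 ≺ i) (.rep j na na (pushEdge ((uo : E) + j) ((ro : E) + j))) .skip
    : C).den s₁ = s₂ at hJ hf₂
  refine ⟨hJ.congr (by simp) (by simp) (by simp), ?_, ?_⟩
  · simp [hf₂.var uo (by decide), hf₂.var na (by decide), huo₁, hs₁.na]; ring
  · simp [hf₂.var ro (by decide), hf₂.var nm (by decide), hro₁, hs₁.nm]; ring

theorem build_spec {A M T : ℕ} {l : List (ℤ × ℤ)} {s : St} (hs : BuildContext A M T l s) :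
    EdgesListed (timeArcs A M T l) (build.den s) ∧ (build.den s).var nl = (T * A : ℕ) ∧
      (build.den s).var nrt = ((T + 1) * M : ℕ) ∧
      (build.den s).var cap = (T * A + (T + 1) * M + 1 : ℕ) := by
  rw [build]
  simp only [Cmd.den_seq, Cmd.den_set]
  generalize hs₁ : ((s.setVar m _).setVar uo _).setVar ro _ = s₁
  have hc : BuildContext A M T l s₁ := by subst hs₁; exact hs.congr (by simp) (by simp)
  have hI := rep_induction (x := i) (v := tt) (cap := tt) (c := buildLayer) (s := s₁)
    (fun k s' => EdgesListed ((List.range k).flatMap (layer A M T l)) s' ∧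
      s'.var uo = k * A ∧ s'.var ro = k * M) T (by decide) hc.tt le_rfl
    (by
      subst hs₁
      exact ⟨⟨by simpa using Holds.nil _, by simp⟩, by simp, by simp⟩) (by
      rintro k hk s' ⟨h1, h2, h3⟩ hi hf
      obtain ⟨h4, h5, h6⟩ := buildLayer_spec (hc.frame hf (by decide) (by decide)) k hi h2 h3 h1
      rw [List.range_succ, List.flatMap_append, List.flatMap_singleton]
      refine ⟨h4.congr (by simp) (by simp) (by simp), ?_, ?_⟩
      · simp [h5]
      · simp [h6])
  have hf := Cmd.den_frame (.rep i tt tt buildLayer) s₁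
  have hnm := (hc.frame hf (by decide) (by decide)).nm
  obtain ⟨h1, h2, h3⟩ := hI
  refine ⟨h1.congr (by simp) (by simp) (by simp), ?_, ?_, ?_⟩
  · simp [h2]
  · simp [h3, hnm]; ring
  · simp [h2, h3, hnm]; ring

/-! #### The auction -/

/-- Select the left vertex number `k` if it is unmatched. -/
def findFree : C := .ite (rd mate k ≐ 0 - 1) (u ::= k) .skip

/-- Select the edge number `k` if it is a cheaper one at the selected left vertex. -/
def cheaper : C :=
  .ite (rd el k ≐ u) (.ite (rd price (rd er k) ≺ bp)
    (bp ::= rd price (rd er k) ;; br ::= rd er k) .skip) .skip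

/-- The selected left vertex bids for the selected right vertex. -/
def bid : C :=
  .ite (0 - 1 ≺ rd owner br) (.put mate (rd owner br) (0 - 1)) .skip ;;
  .put owner br u ;;
  .put mate u br ;;
  .put price br ((bp : E) + 1)

/-- One round of the auction. -/
def round : C :=
  u ::= 0 - 1 ;;
  .rep k nl nl findFree ;;
  br ::= 0 - 1 ;;
  bp ::= nl ;;
  .rep k m m cheaper ;;
  .ite (0 - 1 ≺ br) bid .skip

/-- The auction. -/
def auction : C :=
  .rep i nl nl (.put mate i (0 - 1)) ;;
  .rep i nrt nrt (.put price i 0 ;; .put owner i (0 - 1)) ;;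
  .rep i cap cap (.rep j cap cap round) ;;
  done ::= 1 ;;
  .rep i nl nl (.ite (rd mate i ≐ 0 - 1) (done ::= 0) .skip)

/-- What the auction needs to know. -/
structure AuctionContext (Es : List (ℤ × ℤ)) (nL nR : ℕ) (s : St) : Prop where
  edges : EdgesListed Es s
  nl : s.var nl = nL
  nrt : s.var nrt = nR

theorem AuctionContext.congr {Es : List (ℤ × ℤ)} {nL nR : ℕ} {s s' : St}
    (h : AuctionContext Es nL nR s)
    (hv : ∀ v ∈ [Var.m, Var.nl, Var.nrt], s'.var v = s.var v)
    (ha : ∀ a ∈ [el, er], s'.arr a = s.arr a) : AuctionContext Es nL nR s' := by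
  simp only [List.mem_cons, List.not_mem_nil, or_false, forall_eq_or_imp, forall_eq] at hv ha
  obtain ⟨h1, h2, h3⟩ := h
  exact ⟨h1.congr ha.1 ha.2 hv.1, by simp [hv, h2], by simp [hv, h3]⟩

theorem AuctionContext.frame {Es : List (ℤ × ℤ)} {nL nR : ℕ} {c : C} {s s' : St}
    (h : AuctionContext Es nL nR s) (hf : Frame c s s')
    (hv : ∀ v ∈ [Var.m, Var.nl, Var.nrt], v ∉ c.vars)
    (ha : ∀ a ∈ [el, er], a ∉ c.arrs) : AuctionContext Es nL nR s' :=
  h.congr (fun v hm => hf.var v (hv v hm)) fun a hm => hf.arr a (ha a hm)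

theorem findFree_spec {nL : ℕ} {s : St} (hnl : s.var nl = nL) (hu : s.var u = -1) :
    (((Cmd.rep k nl nl findFree).den s).var u = -1 ∧ ∀ v : ℕ, v < nL → s.arr mate v ≠ -1) ∨
    ∃ v : ℕ, v < nL ∧ ((Cmd.rep k nl nl findFree).den s).var u = v ∧ s.arr mate v = -1 := by
  refine rep_induction (x := k) (v := nl) (cap := nl) (c := findFree) (s := s)
    (fun n s' => (s'.var u = -1 ∧ ∀ v : ℕ, v < n → s.arr mate v ≠ -1) ∨
      ∃ v : ℕ, v < nL ∧ s'.var u = v ∧ s.arr mate v = -1) nL (by decide) hnl le_rfl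
    (Or.inl ⟨by simpa using hu, by simp⟩) ?_
  intro n hn s' h1 hk hf
  rw [findFree, Cmd.den_ite_eq]
  have hm := hf.arr mate (by decide)
  split
  · rename_i h2
    simp [hk, hm] at h2
    exact Or.inr ⟨n, hn, by simp [hk], h2⟩
  · rename_i h2
    simp [hk, hm] at h2
    rcases h1 with ⟨h1, h3⟩ | h1
    · refine Or.inl ⟨by simpa using h1, fun v hv => ?_⟩
      rcases Nat.lt_succ_iff_lt_or_eq.1 hv with h | rfl
      · exact h3 v h
      · exact h2
    · exact Or.inr (by simpa using h1)

/-- The best price starts at `nL`, so vertices of price `nL` are never selected. If `br` keeps the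
value `-1`, the left vertex is priced out. -/
theorem cheaper_spec {Es : List (ℤ × ℤ)} {nL nR : ℕ} {s : St} (hs : AuctionContext Es nL nR s)
    (hbr : s.var br = -1) (hbp : s.var bp = nL) (hE : ∀ e ∈ Es, 0 ≤ e.2 ∧ e.2 < nR) :
    (((Cmd.rep k m m cheaper).den s).var br = -1 ∧
      ∀ r, (s.var u, r) ∈ Es → (nL : ℤ) ≤ s.arr price r) ∨
    ∃ r, 0 ≤ r ∧ ((Cmd.rep k m m cheaper).den s).var br = r ∧
      ((Cmd.rep k m m cheaper).den s).var bp = s.arr price r ∧ (s.var u, r) ∈ Es ∧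
      s.arr price r < nL ∧ ∀ r', (s.var u, r') ∈ Es → s.arr price r ≤ s.arr price r' := by
  have hI := rep_induction (x := k) (v := m) (cap := m) (c := cheaper) (s := s)
    (fun n s' => (s'.var br = -1 ∧ s'.var bp = nL ∧
      ∀ r, (s.var u, r) ∈ Es.take n → (nL : ℤ) ≤ s.arr price r) ∨
    ∃ r, s'.var br = r ∧ s'.var bp = s.arr price r ∧ (s.var u, r) ∈ Es ∧
      s.arr price r < nL ∧ ∀ r', (s.var u, r') ∈ Es.take n → s.arr price r ≤ s.arr price r')
    Es.length (by decide) hs.edges.2 le_rfl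
    (Or.inl ⟨by simpa using hbr, by simpa using hbp, by simp⟩) (by
      intro n hn s' h1 hk hf
      have hp := hf.arr price (by decide)
      have hel := hf.arr el (by decide)
      have her := hf.arr er (by decide)
      have hu := hf.var u (by decide)
      have he := hs.edges.1 n hn
      have he1 : s.arr el n = Es[n].1 := by rw [← he]; rfl
      have he2 : s.arr er n = Es[n].2 := by rw [← he]; rfl
      have hmem : ∀ r, (s.var u, r) ∈ Es.take (n + 1) →
          (s.var u, r) ∈ Es.take n ∨ (s.var u, r) = Es[n] := by
        intro r hr
        rwa [List.take_succ_eq_append_getElem hn, List.mem_append, List.mem_singleton] at hr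
      rw [cheaper, Cmd.den_ite_eq]
      split
      · rename_i h2
        simp only [Ex.val_arr, Ex.val_var, hk, hel, he1, hu] at h2
        have hEn : (s.var u, Es[n].2) = Es[n] := by rw [← h2]
        have hEn' : (s.var u, Es[n].2) ∈ Es := by rw [hEn]; exact List.getElem_mem hn
        rw [Cmd.den_ite_lt]
        split
        · rename_i h3
          simp only [Ex.val_arr, Ex.val_var, hk, her, he2, hp] at h3
          refine Or.inr ⟨Es[n].2, by simp [hk, her, he2], by simp [hk, her, he2, hp], hEn', ?_, ?_⟩
          · rcases h1 with ⟨-, h4, -⟩ | ⟨r, -, h4, -, h5, -⟩ <;> omega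
          · intro r' hr'
            rcases hmem r' hr' with h5 | h5
            · rcases h1 with ⟨-, h4, h6⟩ | ⟨r, -, h4, -, -, h6⟩ <;> have := h6 r' h5 <;> omega
            · rw [← h5]
        · rename_i h3
          simp only [Ex.val_arr, Ex.val_var, hk, her, he2, hp] at h3
          rcases h1 with ⟨h4, h5, h6⟩ | ⟨r, h4, h5, h6, h7, h8⟩
          · refine Or.inl ⟨by simpa using h4, by simpa using h5, fun r' hr' => ?_⟩
            rcases hmem r' hr' with h9 | h9
            · exact h6 r' h9
            · rw [← h9] at h3; simp only at h3; omega
          · refine Or.inr ⟨r, by simpa using h4, by simpa using h5, h6, h7, fun r' hr' => ?_⟩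
            rcases hmem r' hr' with h9 | h9
            · exact h8 r' h9
            · rw [← h9] at h3; simp only at h3; omega
      · rename_i h2
        simp only [Ex.val_arr, Ex.val_var, hk, hel, he1, hu] at h2
        have hmem' : ∀ r, (s.var u, r) ∈ Es.take (n + 1) → (s.var u, r) ∈ Es.take n := by
          intro r hr
          rcases hmem r hr with h | h
          · exact h
          · exact absurd (by rw [← h]) h2
        rcases h1 with ⟨h4, h5, h6⟩ | ⟨r, h4, h5, h6, h7, h8⟩
        · exact Or.inl ⟨by simpa using h4, by simpa using h5, fun r' hr' => h6 r' (hmem' r' hr')⟩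
        · exact Or.inr ⟨r, by simpa using h4, by simpa using h5, h6, h7,
            fun r' hr' => h8 r' (hmem' r' hr')⟩)
  rw [List.take_length] at hI
  rcases hI with ⟨h1, -, h2⟩ | ⟨r, h1, h2, h3, h4⟩
  · exact Or.inl ⟨h1, h2⟩
  · exact Or.inr ⟨r, (hE _ h3).1, h1, h2, h3, h4⟩

/-- The invariant of the auction after `n` rounds. -/
def Progress (Es : List (ℤ × ℤ)) (nL nR : ℕ) (n : ℕ) (s : St) : Prop :=
  Auction.Inv Es nL nR (s.arr price) (s.arr owner) (s.arr mate) ∧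
    ((n : ℤ) ≤ ∑ r ∈ Finset.Ico (0 : ℤ) nR, s.arr price r ∨
      (∀ v : ℕ, v < nL → s.arr mate v ≠ -1) ∨ ¬ ∃ f, Auction.IsMatching Es nL f)

theorem Progress.congr {Es : List (ℤ × ℤ)} {nL nR n n' : ℕ} {s s' : St}
    (h : Progress Es nL nR n s) (hn : n' = n) (hp : s'.arr price = s.arr price)
    (ho : s'.arr owner = s.arr owner) (hm : s'.arr mate = s.arr mate) :
    Progress Es nL nR n' s' := by
  rw [Progress, hp, ho, hm, hn]; exact h

theorem bid_arr (s : St) :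
    (bid.den s).arr price = Function.update (s.arr price) (s.var br) (s.var bp + 1) ∧
    (bid.den s).arr owner = Function.update (s.arr owner) (s.var br) (s.var u) ∧
    (bid.den s).arr mate = Auction.bidMate (s.arr owner) (s.arr mate) (s.var u) (s.var br) := by
  simp only [bid, Cmd.den_seq, Auction.bidMate]
  rw [Cmd.den_ite_lt]
  split <;> rename_i h <;> simp at h
  · rw [if_pos (by omega)]
    simp [Store.setArr_arr]
  · rw [if_neg (by omega)]
    simp [Store.setArr_arr]

/-- There are only two reasons for a round without a bid, and neither goes away: either all left
vertices are matched, or one is priced out and no matching exists. Otherwise the total price goes up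
by one. -/
theorem round_spec {Es : List (ℤ × ℤ)} {nL nR n : ℕ} {s : St} (hs : AuctionContext Es nL nR s)
    (hE : ∀ e ∈ Es, 0 ≤ e.2 ∧ e.2 < nR) (hE0 : ∀ e ∈ Es, 0 ≤ e.1) (h : Progress Es nL nR n s) :
    Progress Es nL nR (n + 1) (round.den s) := by
  rw [round]
  simp only [Cmd.den_seq, Cmd.den_set]
  generalize hs₁ : s.setVar u _ = s₁
  have hc₁ : AuctionContext Es nL nR s₁ := by subst hs₁; exact hs.congr (by simp) (by simp)
  have h₁ : Progress Es nL nR n s₁ := by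
    subst hs₁; exact h.congr rfl (by simp) (by simp) (by simp)
  have hfree := findFree_spec hc₁.nl (by subst hs₁; simp)
  have hf₁ := Cmd.den_frame (.rep k nl nl findFree) s₁
  generalize (Cmd.rep k nl nl findFree).den s₁ = s₂ at hfree hf₁
  have hc₂ := hc₁.frame hf₁ (by decide) (by decide)
  rw [← hf₁.arr mate (by decide)] at hfree
  have h₂ : Progress Es nL nR n s₂ :=
    h₁.congr rfl (hf₁.arr _ (by decide)) (hf₁.arr _ (by decide)) (hf₁.arr _ (by decide))
  generalize hs₃ : (s₂.setVar br _).setVar bp _ = s₃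
  have hc₃ : AuctionContext Es nL nR s₃ := by subst hs₃; exact hc₂.congr (by simp) (by simp)
  have hcheap := cheaper_spec hc₃ (by subst hs₃; simp) (by subst hs₃; simp [hc₂.nl]) hE
  have hf₃ := Cmd.den_frame (.rep k m m cheaper) s₃
  generalize (Cmd.rep k m m cheaper).den s₃ = s₄ at hcheap hf₃
  have hu₃ : s₃.var u = s₂.var u := by subst hs₃; simp
  have hp₃ : s₃.arr price = s₂.arr price := by subst hs₃; simp
  have hu₄ : s₄.var u = s₂.var u := (hf₃.var u (by decide)).trans hu₃
  have hp₄ : s₄.arr price = s₂.arr price := (hf₃.arr price (by decide)).trans hp₃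
  have ho₄ : s₄.arr owner = s₂.arr owner := by
    rw [hf₃.arr owner (by decide)]; subst hs₃; simp
  have hm₄ : s₄.arr mate = s₂.arr mate := by
    rw [hf₃.arr mate (by decide)]; subst hs₃; simp
  rw [hu₃, hp₃] at hcheap
  rw [Cmd.den_ite_lt]
  rcases hfree with ⟨hfree, hall⟩ | ⟨v, hv, huv, hmv⟩
  -- Without a free vertex `u` is `-1`, which is not the left end of any edge, so nothing is
  -- selected.
  · have hbr : s₄.var br = -1 := by
      rcases hcheap with ⟨h3, -⟩ | ⟨r, -, -, -, h3, -⟩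
      · exact h3
      · have := hE0 _ h3
        simp only at this
        omega
    rw [if_neg (by simp [hbr]), Cmd.den_skip]
    exact Progress.congr (n := n + 1) (s := s₂) ⟨h₂.1, Or.inr (Or.inl hall)⟩ rfl hp₄ ho₄ hm₄
  · rw [huv] at hcheap
    rcases hcheap with ⟨hbr, hno⟩ | ⟨r, hr0, hbr, hbp, hr, hlt, hmin⟩
    · rw [if_neg (by simp [hbr]), Cmd.den_skip]
      refine Progress.congr (n := n + 1) (s := s₂) ⟨h₂.1, Or.inr (Or.inr ?_)⟩ rfl hp₄ ho₄ hm₄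
      rintro ⟨f, hf⟩
      exact h₂.1.not_isMatching hE (by omega) (by omega) hmv hno f hf
    · rw [if_pos (by simp [hbr]; omega)]
      obtain ⟨h3, h4, h5⟩ := bid_arr s₄
      rw [hbr, hbp, hp₄] at h3
      rw [hbr, ho₄, hu₄, huv] at h4
      rw [hbr, ho₄, hm₄, hu₄, huv] at h5
      rw [Progress, h3, h4, h5]
      refine ⟨h₂.1.bid hE (by omega) (by omega) hmv hr hlt hmin, ?_⟩
      rw [Auction.sum_price_bid hr0 (hE _ hr).2]
      rcases h₂.2 with h6 | h6 | h6
      · left; push_cast; omega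
      · exact absurd hmv (h6 v hv)
      · exact Or.inr (Or.inr h6)

/-- Two nested loops of `nL + nR + 1` rounds each make more rounds than the total price can grow,
without computing a product. So one of the two final states of `Progress` has been reached. -/
theorem auction_spec {Es : List (ℤ × ℤ)} {nL nR : ℕ} {s : St} (hs : AuctionContext Es nL nR s)
    (hcap : s.var cap = (nL + nR + 1 : ℕ))
    (hE : ∀ e ∈ Es, 0 ≤ e.2 ∧ e.2 < nR) (hE0 : ∀ e ∈ Es, 0 ≤ e.1) :
    ((auction.den s).var done = 1 ∧ Auction.IsMatching Es nL ((auction.den s).arr mate)) ∨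
    ((auction.den s).var done = 0 ∧ ¬ ∃ f, Auction.IsMatching Es nL f) := by
  rw [auction]
  simp only [Cmd.den_seq, Cmd.den_set]
  have hI₁ := rep_induction (x := i) (v := nl) (cap := nl) (c := .put mate i (0 - 1)) (s := s)
    (fun n s' => ∀ v : ℕ, v < n → s'.arr mate v = -1) nL (by decide) hs.nl le_rfl (by simp) (by
      intro n hn s' h1 hi hf v hv
      simp only [Cmd.den_put, Store.setVar_arr, Store.setArr_arr_apply, Ex.val_var, hi]
      split_ifs with h
      · simp
      · exact h1 v (by simp at h; omega))
  have hf₁ := Cmd.den_frame (.rep i nl nl (.put mate i (0 - 1))) s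
  generalize (Cmd.rep i nl nl (.put mate i (0 - 1))).den s = s₁ at hI₁ hf₁
  have hs₁ := hs.frame hf₁ (by decide) (by decide)
  have hI₂ := rep_induction (x := i) (v := nrt) (cap := nrt)
    (c := .put price i 0 ;; .put owner i (0 - 1)) (s := s₁)
    (fun n s' => ∀ v : ℕ, v < n → s'.arr price v = 0 ∧ s'.arr owner v = -1) nR (by decide) hs₁.nrt
    le_rfl (by simp) (by
      intro n hn s' h1 hi hf v hv
      simp only [Cmd.den_seq, Cmd.den_put, Store.setVar_arr, Store.setArr_var,
        Store.setArr_arr_apply, Ex.val_var, hi]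
      by_cases h : v = n
      · subst h; simp
      · simpa [h] using h1 v (by omega))
  have hf₂ := Cmd.den_frame (.rep i nrt nrt (.put price i 0 ;; .put owner i (0 - 1))) s₁
  generalize (Cmd.rep i nrt nrt (.put price i 0 ;; .put owner i (0 - 1))).den s₁ = s₂ at hI₂ hf₂
  have hs₂ := hs₁.frame hf₂ (by decide) (by decide)
  rw [← hf₂.arr mate (by decide)] at hI₁
  have hinit : Progress Es nL nR 0 s₂ := by
    have hm : ∀ v : ℤ, 0 ≤ v → v < nL → s₂.arr mate v = -1 := fun v h0 h1 => by
      have := hI₁ v.toNat (by omega); rwa [Int.toNat_of_nonneg h0] at this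
    have hr : ∀ v : ℤ, 0 ≤ v → v < nR → s₂.arr price v = 0 ∧ s₂.arr owner v = -1 :=
      fun v h0 h1 => by
        have := hI₂ v.toNat (by omega); rwa [Int.toNat_of_nonneg h0] at this
    refine ⟨⟨fun v h0 h1 h2 => absurd (hm v h0 h1) h2, fun r h0 h1 h2 => absurd (hr r h0 h1).2 h2,
      fun r h0 h1 => (hr r h0 h1).1.ge, fun r h0 h1 _ => (hr r h0 h1).1, fun r h0 h1 => ?_,
      fun v h0 h1 h2 => absurd (hm v h0 h1) h2⟩, Or.inl ?_⟩
    · rw [(hr r h0 h1).1]; omega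
    · refine Finset.sum_nonneg fun r h => ?_
      rw [Finset.mem_Ico] at h
      exact (hr r h.1 h.2).1.ge
  have hcap₂ : s₂.var cap = (nL + nR + 1 : ℕ) := by
    rw [hf₂.var cap (by decide), hf₁.var cap (by decide), hcap]
  have hI₃ := rep_induction (x := i) (v := cap) (cap := cap) (c := .rep j cap cap round) (s := s₂)
    (fun n s' => Progress Es nL nR (n * (nL + nR + 1)) s') (nL + nR + 1) (by decide) hcap₂ le_rfl
    (hinit.congr (by simp) (by simp) (by simp) (by simp)) (by
      intro n hn s₃ h1 hi hf
      have hs₃ := hs₂.frame hf (by decide) (by decide)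
      have hJ := rep_induction (x := j) (v := cap) (cap := cap) (c := round) (s := s₃)
        (fun n' s' => Progress Es nL nR (n * (nL + nR + 1) + n') s') (nL + nR + 1) (by decide)
        ((hf.var cap (by decide)).trans hcap₂) le_rfl
        (h1.congr (by simp) (by simp) (by simp) (by simp)) (by
          intro n' hn' s₄ h2 hj hf'
          exact (round_spec (hs₃.frame hf' (by decide) (by decide)) hE hE0 h2).congr
            (by ring) (by simp) (by simp) (by simp))
      exact hJ.congr (by ring) (by simp) (by simp) (by simp))
  have hf₃ := Cmd.den_frame (.rep i cap cap (.rep j cap cap round)) s₂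
  generalize (Cmd.rep i cap cap (.rep j cap cap round)).den s₂ = s₃ at hI₃ hf₃
  have hs₃ := hs₂.frame hf₃ (by decide) (by decide)
  generalize hs₄ : s₃.setVar done _ = s₄
  have hm₄ : s₄.arr mate = s₃.arr mate := by subst hs₄; simp
  have hI₅ := rep_induction (x := i) (v := nl) (cap := nl)
    (c := .ite (rd mate i ≐ 0 - 1) (done ::= 0) .skip) (s := s₄)
    (fun n s' => (s'.var done = 1 ∧ ∀ v : ℕ, v < n → s₃.arr mate v ≠ -1) ∨
      (s'.var done = 0 ∧ ∃ v : ℕ, v < nL ∧ s₃.arr mate v = -1)) nL (by decide)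
    (by subst hs₄; simpa using hs₃.nl) le_rfl (Or.inl ⟨by subst hs₄; simp, by simp⟩) (by
      intro n hn s' h1 hi hf
      have hm := (hf.arr mate (by decide)).trans hm₄
      rw [Cmd.den_ite_eq]
      split <;> rename_i h2 <;> simp [hi, hm] at h2
      · exact Or.inr ⟨by simp, n, hn, h2⟩
      · rcases h1 with ⟨h1, h3⟩ | h1
        · refine Or.inl ⟨by simpa using h1, fun v hv => ?_⟩
          rcases Nat.lt_succ_iff_lt_or_eq.1 hv with h | rfl
          · exact h3 v h
          · exact h2
        · exact Or.inr (by simpa using h1))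
  have hf₅ := Cmd.den_frame (.rep i nl nl (.ite (rd mate i ≐ 0 - 1) (done ::= 0) .skip)) s₄
  generalize (Cmd.rep i nl nl (.ite (rd mate i ≐ 0 - 1) (done ::= 0) .skip)).den s₄ = s₅
    at hI₅ hf₅
  rw [hf₅.arr mate (by decide), hm₄]
  obtain ⟨hInv, hprog⟩ := hI₃
  rcases hI₅ with ⟨h1, h2⟩ | ⟨h1, v, hv, h2⟩
  · refine Or.inl ⟨h1, hInv.isMatching fun w h3 h4 => ?_⟩
    have := h2 w.toNat (by omega)
    rwa [Int.toNat_of_nonneg h3] at this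
  · refine Or.inr ⟨h1, ?_⟩
    rcases hprog with h3 | h3 | h3
    · exfalso
      have h4 := h3.trans hInv.sum_price_le
      push_cast at h4
      nlinarith
    · exact absurd h2 (h3 v hv)
    · exact h3

end Solver

end Evac

namespace Evac

namespace Solver

open ArrLang Var Arr

/-! #### Removal of cycles -/

/-- Follow the matching for one step, and set `flag` if this leads back to the square number `j`. -/
def follow : C :=
  .ite (x ≺ na) (.ite (0 - 1 ≺ x) (x ::= rd mate ((uo : E) + x) - ro) .skip) .skip ;;
  .ite (x ≐ j) (flag ::= 1) .skip

/-- Find the move from the square number `j` at time `i`. -/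
def findMove : C :=
  x ::= j ;;
  flag ::= 0 ;;
  .rep k na na follow ;;
  .ite flag (.put tgt ((uo : E) + j) j)
    (.put tgt ((uo : E) + j) (rd mate ((uo : E) + j) - ro))

/-- Find all moves at time `i`. -/
def findLayer : C :=
  .rep j na na findMove ;;
  uo ::= (uo : E) + na ;;
  ro ::= (ro : E) + nm

/-- Find all moves. -/
def findMoves : C :=
  uo ::= 0 ;;
  ro ::= nm ;;
  .rep i tt tt findLayer

open Classical in
/-- The move that a matching prescribes after the removal of cycles. -/
noncomputable def newTarget (A M : ℕ) (m : ℤ → ℤ) (i c : ℕ) : ℤ :=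
  if ∃ k < A, (jump A (target A M m i))^[k + 1] c = c then c else target A M m i c

/-- What the search for moves needs to know. -/
structure MoveContext (A M T : ℕ) (f : ℤ → ℤ) (s : St) : Prop where
  mate : s.arr mate = f
  na : s.var na = A
  nm : s.var nm = M
  tt : s.var tt = T

theorem MoveContext.congr {A M T : ℕ} {f : ℤ → ℤ} {s s' : St} (h : MoveContext A M T f s)
    (hv : ∀ v ∈ [Var.na, Var.nm, Var.tt], s'.var v = s.var v)
    (ha : s'.arr Arr.mate = s.arr Arr.mate) : MoveContext A M T f s' := by
  simp only [List.mem_cons, List.not_mem_nil, or_false, forall_eq_or_imp, forall_eq] at hv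
  exact ⟨ha.trans h.mate, hv.1.trans h.na, hv.2.1.trans h.nm, hv.2.2.trans h.tt⟩

theorem MoveContext.frame {A M T : ℕ} {f : ℤ → ℤ} {c : C} {s s' : St}
    (h : MoveContext A M T f s) (hf : Frame c s s')
    (hv : ∀ v ∈ [Var.na, Var.nm, Var.tt], v ∉ c.vars) (ha : Arr.mate ∉ c.arrs) :
    MoveContext A M T f s' :=
  h.congr (fun v hm => hf.var v (hv v hm)) (hf.arr _ ha)

theorem follow_var {A M T : ℕ} {f : ℤ → ℤ} {s : St} (hs : MoveContext A M T f s) (n : ℕ)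
    (huo : s.var uo = n * A) (hro : s.var ro = (n + 1) * M) :
    (follow.den s).var x = jump A (target A M f n) (s.var x) ∧
    (follow.den s).var flag =
      if jump A (target A M f n) (s.var x) = s.var j then 1 else s.var flag := by
  rw [follow, Cmd.den_seq]
  have h1 : ((Cmd.ite (x ≺ na) (.ite (0 - 1 ≺ x) (x ::= rd mate ((uo : E) + x) - ro) .skip) .skip
      : C).den s).var x = jump A (target A M f n) (s.var x) := by
    rw [Cmd.den_ite_lt, jump]
    split <;> rename_i h <;> simp only [Ex.val_var, hs.na] at h
    · rw [Cmd.den_ite_lt]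
      split <;> rename_i h2 <;>
        simp only [Ex.val_var, Ex.val_sub, Ex.val_zero, Ex.val_one] at h2
      · rw [if_pos (by omega)]
        simp [hs.mate, huo, hro, target]
      · rw [if_neg (by omega), Cmd.den_skip]
    · rw [if_neg (by omega), Cmd.den_skip]
  have hf := Cmd.den_frame
    (Cmd.ite (x ≺ na) (.ite (0 - 1 ≺ x) (x ::= rd mate ((uo : E) + x) - ro) .skip) .skip : C) s
  generalize (Cmd.ite (x ≺ na) (.ite (0 - 1 ≺ x) (x ::= rd mate ((uo : E) + x) - ro) .skip) .skip
      : C).den s = s₁ at h1 hf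
  have hj := hf.var j (by decide)
  have hfl := hf.var flag (by decide)
  rw [Cmd.den_ite_eq]
  split <;> rename_i h <;> simp only [Ex.val_var, h1, hj] at h
  · rw [if_pos h]; simp [h1]
  · rw [if_neg h]; simp [h1, hfl]

-- The loop makes all `A` iterations and only records whether some iterate came back to `j`; by
-- `onCycle_iff` this is the right test, whatever the length of the cycle.
open Classical in
theorem findMove_spec {A M T : ℕ} {f : ℤ → ℤ} {s : St} (hs : MoveContext A M T f s) (n c : ℕ)
    (huo : s.var uo = n * A) (hro : s.var ro = (n + 1) * M) (hj : s.var j = c) :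
    (findMove.den s).arr tgt =
      Function.update (s.arr tgt) (n * A + c) (newTarget A M f n c) := by
  rw [findMove]
  simp only [Cmd.den_seq, Cmd.den_set]
  generalize hs₁ : (s.setVar x _).setVar flag _ = s₁
  have hc₁ : MoveContext A M T f s₁ := by subst hs₁; exact hs.congr (by simp) (by simp)
  have hj₁ : s₁.var j = c := by subst hs₁; simpa using hj
  have huo₁ : s₁.var uo = n * A := by subst hs₁; simpa using huo
  have hro₁ : s₁.var ro = (n + 1) * M := by subst hs₁; simpa using hro
  have hI := rep_induction (x := k) (v := na) (cap := na) (c := follow) (s := s₁)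
    (fun n' s' => s'.var x = (jump A (target A M f n))^[n'] c ∧ s'.var flag =
      if ∃ k < n', (jump A (target A M f n))^[k + 1] c = c then 1 else 0) A (by decide) hc₁.na le_rfl
    (by subst hs₁; simp [hj]) (by
      rintro n' hn s' ⟨h1, h2⟩ hk hf
      obtain ⟨h3, h4⟩ := follow_var (hc₁.frame hf (by decide) (by decide)) n
        ((hf.var uo (by decide)).trans huo₁) ((hf.var ro (by decide)).trans hro₁)
      rw [h1, ← Function.iterate_succ_apply' (jump A (target A M f n))] at h3
      rw [h1, ← Function.iterate_succ_apply' (jump A (target A M f n)),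
        (hf.var j (by decide)).trans hj₁, h2] at h4
      refine ⟨by simpa using h3, ?_⟩
      simp only [Store.setVar_var, reduceCtorEq, if_false, h4]
      by_cases h5 : (jump A (target A M f n))^[n' + 1] (c : ℤ) = c
      · rw [if_pos h5, if_pos ⟨n', by omega, h5⟩]
      · rw [if_neg h5]
        refine if_congr ⟨?_, ?_⟩ rfl rfl
        · rintro ⟨k, hk, h6⟩; exact ⟨k, by omega, h6⟩
        · rintro ⟨k, hk, h6⟩
          refine ⟨k, ?_, h6⟩
          rcases Nat.lt_succ_iff_lt_or_eq.1 hk with h | rfl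
          · exact h
          · exact absurd h6 h5)
  have hf := Cmd.den_frame (.rep k na na follow) s₁
  generalize (Cmd.rep k na na follow).den s₁ = s₂ at hI hf
  have hj₂ := (hf.var j (by decide)).trans hj₁
  have huo₂ := (hf.var uo (by decide)).trans huo₁
  have hro₂ := (hf.var ro (by decide)).trans hro₁
  have hm₂ := (hc₁.frame hf (by decide) (by decide)).mate
  have ht₂ : s₂.arr tgt = s.arr tgt := by
    rw [hf.arr tgt (by decide)]; subst hs₁; simp
  rw [Cmd.den_ite, Ex.val_var, hI.2, newTarget]
  by_cases h : ∃ k < A, (jump A (target A M f n))^[k + 1] (c : ℤ) = c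
  · simp only [if_pos h]
    rw [if_pos one_ne_zero]
    simp [Store.setArr_arr, hj₂, huo₂, ht₂]
  · simp only [if_neg h]
    rw [if_neg (by simp)]
    simp [Store.setArr_arr, hj₂, huo₂, hro₂, ht₂, hm₂, target]

/-- Moves at time `i` lead to right vertices numbered from `(i + 1) * M` on, so `ro` is one layer
ahead and starts at `nm` rather than at 0. -/
theorem findMoves_spec {A M T : ℕ} {f : ℤ → ℤ} {s : St} (hs : MoveContext A M T f s) :
    ∀ i c : ℕ, i < T → c < A → (findMoves.den s).arr tgt (i * A + c) = newTarget A M f i c := by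
  rw [findMoves]
  simp only [Cmd.den_seq, Cmd.den_set]
  generalize hs₁ : (s.setVar uo _).setVar ro _ = s₁
  have hc₁ : MoveContext A M T f s₁ := by subst hs₁; exact hs.congr (by simp) (by simp)
  have hI := rep_induction (x := i) (v := tt) (cap := tt) (c := findLayer) (s := s₁)
    (fun n s' => s'.var uo = n * A ∧ s'.var ro = (n + 1) * M ∧
      ∀ i c : ℕ, i < n → c < A → s'.arr tgt (i * A + c) = newTarget A M f i c) T (by decide)
    hc₁.tt le_rfl (by subst hs₁; simp [hs.nm]) (by
      rintro n hn s' ⟨h1, h2, h3⟩ hi hf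
      have hc := hc₁.frame hf (by decide) (by decide)
      rw [findLayer]
      simp only [Cmd.den_seq, Cmd.den_set]
      have hJ := rep_induction (x := j) (v := na) (cap := na) (c := findMove) (s := s')
        (fun k s' => ∀ i c : ℕ, c < A → (i < n ∨ i = n ∧ c < k) →
          s'.arr tgt (i * A + c) = newTarget A M f i c) A (by decide) hc.na le_rfl
        (by
          intro i c hcA h
          simpa using h3 i c (by omega) hcA) (by
          intro k hk s₃ h4 hj hf₃ i c hcA h
          have h5 := findMove_spec (hc.frame hf₃ (by decide) (by decide)) n k
            ((hf₃.var uo (by decide)).trans h1) ((hf₃.var ro (by decide)).trans h2) hj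
          rw [Store.setVar_arr, h5, Function.update_apply]
          split_ifs with h6
          · obtain ⟨rfl, rfl⟩ := mul_add_inj hcA hk (by exact_mod_cast h6)
            rfl
          · refine h4 i c hcA ?_
            rcases h with h | ⟨rfl, h⟩
            · exact Or.inl h
            · refine Or.inr ⟨rfl, ?_⟩
              rcases Nat.lt_succ_iff_lt_or_eq.1 h with h | rfl
              · exact h
              · exact absurd rfl h6)
      have hf₄ := Cmd.den_frame (.rep j na na findMove) s'
      have hc₄ := hc.frame hf₄ (by decide) (by decide)
      refine ⟨?_, ?_, fun i c h4 h5 => ?_⟩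
      · simp [hf₄.var uo (by decide), h1, hc₄.na]; ring
      · simp [hf₄.var ro (by decide), h2, hc₄.nm]; ring
      · simpa using hJ i c h5 (by omega))
  exact hI.2.2

/-- This connects the table of the program with the scheme `uncycle`, whose correctness has been
shown above. Entries for squares that nobody vacates play no role. -/
theorem newTarget_spec {B : Building} {A M T : ℕ} {X : ℤ → Square} {l : List (ℤ × ℤ)}
    (hX : IsNumbering B A M X) (hl : IsArcList B A M X l) {m : ℤ → ℤ} (hT : 0 < T)
    (hm : Auction.IsMatching (timeArcs A M T l) (T * A) m) {i c : ℕ} (hi : i < T) (hc : c < A)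
    (hD : X c ∈ activeCells A M T X m i) :
    ∃ q : ℕ, q < M ∧ newTarget A M m i c = q ∧
      X q = uncycle (activeCells A M T X m) (matchMove A M X m) i (X c) := by
  rw [newTarget, uncycle]
  have hcyc := onCycle_iff hX hl hT hm hi hc
  by_cases h : ∃ k < A, (jump A (target A M m i))^[k + 1] (c : ℤ) = c
  · rw [if_pos h, if_pos (hcyc.2 h)]
    exact ⟨c, hc.trans_le hX.le, rfl, rfl⟩
  · rw [if_neg h, if_neg fun h' => h (hcyc.1 h'), matchMove_apply hX m i hc]
    obtain ⟨-, d, hd, h0, he⟩ := mem_activeCells.1 hD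
    obtain rfl := hX.inj _ _ (hd.trans_le hX.le) (hc.trans_le hX.le) he
    rcases target_spec hl hm hi hd with ⟨q, hq, -, -, h3⟩ | ⟨-, h3, -⟩
    · exact ⟨q, hq, h3, by rw [h3]⟩
    · have := hX.le
      omega

/-! #### Output -/

/-- Write the next place of a route, if the route has not yet reached an exit. -/
def writePlace : C :=
  .ite (x ≺ na)
    (x ::= rd tgt ((uo : E) + x) ;;
    .put out op (rd qx x) ;;
    .put out ((op : E) + 1) (rd qy x) ;;
    op ::= (op : E) + 2 ;;
    cnt ::= (cnt : E) + 1) .skip ;;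
  uo ::= (uo : E) + na

/-- Write the route that starts in the square number `j`. -/
def writeRoute : C :=
  lp ::= op ;;
  .put out ((op : E) + 1) (rd qx j) ;;
  .put out ((op : E) + 2) (rd qy j) ;;
  op ::= (op : E) + 3 ;;
  cnt ::= 1 ;;
  x ::= j ;;
  uo ::= 0 ;;
  .rep i tt tt writePlace ;;
  .put out lp cnt

/-- Write all routes. -/
def writeRoutes : C :=
  .put out 0 na ;;
  op ::= 1 ;;
  .rep j na na writeRoute

/-- What the output of routes needs to know. -/
structure RouteContext (A M T : ℕ) (X : ℤ → Square) (D : ℕ → Finset Square)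
    (σ : ℕ → Square → Square) (s : St) : Prop where
  place : placeAt s = X
  na : s.var na = A
  tt : s.var tt = T
  tgt : ∀ i c : ℕ, i < T → c < A → X c ∈ D i →
    ∃ q : ℕ, q < M ∧ s.arr tgt (i * A + c) = q ∧ X q = σ i (X c)

section Write

variable {B : Building} {A M T : ℕ} {X : ℤ → Square} {D : ℕ → Finset Square}
  {σ : ℕ → Square → Square} {s s' : St}

theorem RouteContext.congr (h : RouteContext A M T X D σ s)
    (hv : ∀ v ∈ [Var.na, Var.tt], s'.var v = s.var v)
    (ha : ∀ a ∈ [qx, qy, Arr.tgt], s'.arr a = s.arr a) : RouteContext A M T X D σ s' := by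
  simp only [List.mem_cons, List.not_mem_nil, or_false, forall_eq_or_imp, forall_eq] at hv ha
  refine ⟨?_, hv.1.trans h.na, hv.2.trans h.tt, by rw [ha.2.2]; exact h.tgt⟩
  rw [← h.place]; funext z; simp [placeAt, ha]

theorem RouteContext.frame {c : C} (h : RouteContext A M T X D σ s) (hf : Frame c s s')
    (hv : ∀ v ∈ [Var.na, Var.tt], v ∉ c.vars)
    (ha : ∀ a ∈ [qx, qy, Arr.tgt], a ∉ c.arrs) : RouteContext A M T X D σ s' :=
  h.congr (fun v hm => hf.var v (hv v hm)) fun a hm => hf.arr a (ha a hm)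

/-- The first `n + 1` places of the route from `c` have been written at address `p + 1`, after a given
word and one free cell. -/
def Written (σ : ℕ → Square → Square) (W : List ℤ) (c : Square) (n : ℕ) (s : St) : Prop :=
  HoldsAt (s.arr out) 0 W ∧
    HoldsAt (s.arr out) (W.length + 1) (coords ((List.range (n + 1)).map (traj σ c))) ∧
    s.var op = W.length + 1 + 2 * (n + 1) ∧ s.var cnt = n + 1

theorem Written.congr {W : List ℤ} {c : Square} {n : ℕ} (h : Written σ W c n s)
    (ho : s'.arr out = s.arr out) (hop : s'.var op = s.var op) (hcnt : s'.var cnt = s.var cnt) :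
    Written σ W c n s' := by
  rw [Written, ho, hop, hcnt]; exact h

/-- Once an exit has been reached, `x` is at least `A` and nothing more is written. So every route
can be given the same `T` rounds; hence the minimum with the exit time. -/
theorem writePlace_spec (hX : IsNumbering B A M X) (h : IsScheme B B.cells T D σ)
    (hs : RouteContext A M T X D σ s) (W : List ℤ) {c : Square} (hc : c ∈ B.cells) (n : ℕ)
    (hn : n < T) (huo : s.var uo = n * A)
    (hx : ∃ q : ℕ, q < M ∧ s.var x = q ∧ X q = traj σ c (min n (exitTime B σ c)))
    (hw : Written σ W c (min n (exitTime B σ c)) s) :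
    (writePlace.den s).var uo = (n + 1) * A ∧
    (∃ q : ℕ, q < M ∧ (writePlace.den s).var x = q ∧
      X q = traj σ c (min (n + 1) (exitTime B σ c))) ∧
    Written σ W c (min (n + 1) (exitTime B σ c)) (writePlace.den s) := by
  obtain ⟨q, hq, hxq, hXq⟩ := hx
  rw [writePlace]
  simp only [Cmd.den_seq, Cmd.den_set]
  rw [Cmd.den_ite_lt]
  by_cases hlt : n < exitTime B σ c
  · rw [min_eq_left hlt.le] at hXq hw
    rw [min_eq_left (Nat.succ_le_of_lt hlt)]
    have hD := h.traj_mem_of_lt hc hlt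
    have hqA : q < A := by
      rw [← hX.mem_cells_iff hq, hXq]; exact h.sub _ hD
    rw [← hXq] at hD
    obtain ⟨r, hr, hr1, hr2⟩ := hs.tgt n q hn hqA hD
    have hr3 : X r = traj σ c (n + 1) := by rw [hr2, hXq]; rfl
    have hpl := congrFun hs.place r
    rw [hr3] at hpl
    have hpx : s.arr qx r = (traj σ c (n + 1)).1 := by rw [← hpl]; rfl
    have hpy : s.arr qy r = (traj σ c (n + 1)).2 := by rw [← hpl]; rfl
    obtain ⟨h1, h2, h3, h4⟩ := hw
    rw [if_pos (by simp [hxq, hs.na]; exact hqA)]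
    refine ⟨by simp [huo, hs.na]; ring, ⟨r, hr, by simp [huo, hxq, hr1], hr3⟩, ?_⟩
    refine ⟨h1.congr fun z h5 h6 => ?_, ?_, by simp [h3]; ring, by simp [h4]⟩
    · have e1 : z ≠ s.var op := by omega
      have e2 : z ≠ s.var op + 1 := by omega
      simp [e1, e2]
    · rw [List.range_succ, List.map_append, coords_append, holdsAt_append]
      have hlen : ((coords ((List.range (n + 1)).map (traj σ c))).length : ℤ) = 2 * (n + 1) := by
        rw [length_coords]; simp
      refine ⟨h2.congr fun z h5 h6 => ?_, ?_⟩
      · have e1 : z ≠ s.var op := by omega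
        have e2 : z ≠ s.var op + 1 := by omega
        simp [e1, e2]
      · rw [hlen, ← h3]
        simp [HoldsAt, huo, hxq, hr1, hpx, hpy]
  · rw [min_eq_right (not_lt.1 hlt)] at hXq hw
    rw [min_eq_right (by omega)]
    have hqA : ¬ q < A := by
      rw [← hX.mem_cells_iff hq, hXq]; exact h.traj_exitTime hc
    rw [if_neg (by simp [hxq, hs.na]; omega), Cmd.den_skip]
    exact ⟨by simp [huo, hs.na]; ring, ⟨q, hq, by simp [hxq], hXq⟩,
      hw.congr (by simp) (by simp) (by simp)⟩

/-- The length of a route precedes it in the output but is known only after it has been followed.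
Its cell, at `lp`, is therefore left free and filled at the end. -/
theorem writeRoute_spec (hX : IsNumbering B A M X) (h : IsScheme B B.cells T D σ)
    (hs : RouteContext A M T X D σ s) (W : List ℤ) (n : ℕ) (hn : n < A) (hj : s.var j = n)
    (hop : s.var op = W.length) (hW : HoldsAt (s.arr out) 0 W) :
    HoldsAt ((writeRoute.den s).arr out) 0
        (W ++ ((route B σ (X n)).length : ℤ) :: coords (route B σ (X n))) ∧
      (writeRoute.den s).var op =
        (W ++ ((route B σ (X n)).length : ℤ) :: coords (route B σ (X n))).length := by
  have hc : X n ∈ B.cells := (hX.mem_cells _).2 ⟨n, hn, rfl⟩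
  rw [writeRoute]
  simp only [Cmd.den_seq, Cmd.den_set, Cmd.den_put]
  generalize hs₁ : ((((Store.setVar _ op _).setVar cnt _).setVar x _).setVar uo _) = s₁
  have hc₁ : RouteContext A M T X D σ s₁ := by subst hs₁; exact hs.congr (by simp) (by simp)
  have hlp : s₁.var lp = W.length := by subst hs₁; simpa using hop
  have hpl := congrFun hs.place n
  have hpx : s.arr qx n = (X n).1 := by rw [← hpl]; rfl
  have hpy : s.arr qy n = (X n).2 := by rw [← hpl]; rfl
  have hI := rep_induction (x := i) (v := tt) (cap := tt) (c := writePlace) (s := s₁)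
    (fun k s' => s'.var uo = k * A ∧ (∃ q : ℕ, q < M ∧ s'.var x = q ∧
      X q = traj σ (X n) (min k (exitTime B σ (X n)))) ∧
      Written σ W (X n) (min k (exitTime B σ (X n))) s') T (by decide) hc₁.tt le_rfl
    (by
      subst hs₁
      refine ⟨by simp, ⟨n, hn.trans_le hX.le, by simp [hj], by simp [traj]⟩, ?_⟩
      rw [Nat.zero_min]
      refine ⟨hW.congr fun z h1 h2 => ?_, ?_, by simp [hop]; ring, by simp⟩
      · have e1 : z ≠ s.var op + 1 := by omega
        have e2 : z ≠ s.var op + 2 := by omega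
        simp [e1, e2]
      · have e1 : (W.length : ℤ) + 1 + 1 = W.length + 2 := by ring
        simp [HoldsAt, traj, hop, hj, hpx, hpy, e1]) (by
      rintro k hk s' ⟨h1, h2, h3⟩ hi hf
      obtain ⟨h4, h5, h6⟩ := writePlace_spec hX h (hc₁.frame hf (by decide) (by decide)) W hc k hk
        h1 h2 h3
      exact ⟨by simpa using h4, by simpa using h5, h6.congr (by simp) (by simp) (by simp)⟩)
  have hf := Cmd.den_frame (.rep i tt tt writePlace) s₁
  generalize (Cmd.rep i tt tt writePlace).den s₁ = s₂ at hI hf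
  rw [min_eq_right (h.exitTime_le hc)] at hI
  obtain ⟨-, -, h1, h2, h3, h4⟩ := hI
  have hlp₂ := (hf.var lp (by decide)).trans hlp
  have hlen : ((route B σ (X n)).length : ℤ) = exitTime B σ (X n) + 1 := by simp [route]
  rw [holdsAt_append, zero_add]
  refine ⟨⟨h1.congr fun z h5 h6 => ?_, ?_, h2.congr fun z h5 h6 => ?_⟩, ?_⟩
  · have e1 : z ≠ W.length := by omega
    simp [hlp₂, e1]
  · simp [hlp₂, h4, hlen]
  · have e1 : z ≠ W.length := by omega
    simp [hlp₂, e1]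
  · simp only [Store.setArr_var, h3, List.length_append, List.length_cons, length_coords]
    push_cast
    rw [hlen]
    ring

theorem writeRoutes_spec (hX : IsNumbering B A M X) (h : IsScheme B B.cells T D σ)
    (hs : RouteContext A M T X D σ s) :
    HoldsAt ((writeRoutes.den s).arr out) 0
        (encodeRoutes ((List.range A).map fun c : ℕ => route B σ (X c))) ∧
      (writeRoutes.den s).var op =
        (encodeRoutes ((List.range A).map fun c : ℕ => route B σ (X c))).length := by
  have hpre : ∀ n, (A : ℤ) :: encodeRings ((List.range (n + 1)).map fun c : ℕ => route B σ (X c)) =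
      (A : ℤ) :: encodeRings ((List.range n).map fun c : ℕ => route B σ (X c)) ++
        ((route B σ (X n)).length : ℤ) :: coords (route B σ (X n)) := by
    intro n
    rw [List.range_succ, List.map_append, encodeRings, List.flatMap_append]
    simp [encodeRings]
  have henc : encodeRoutes ((List.range A).map fun c : ℕ => route B σ (X c)) =
      (A : ℤ) :: encodeRings ((List.range A).map fun c : ℕ => route B σ (X c)) := by
    rw [encodeRoutes, List.length_map, List.length_range]; rfl
  rw [henc, writeRoutes]
  simp only [Cmd.den_seq, Cmd.den_set, Cmd.den_put]
  generalize hs₁ : (Store.setArr s out _ _).setVar op _ = s₁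
  have hc₁ : RouteContext A M T X D σ s₁ := by subst hs₁; exact hs.congr (by simp) (by simp)
  refine rep_induction (x := j) (v := na) (cap := na) (c := writeRoute) (s := s₁)
    (fun k s' => HoldsAt (s'.arr out) 0
        ((A : ℤ) :: encodeRings ((List.range k).map fun c : ℕ => route B σ (X c))) ∧
      s'.var op =
        ((A : ℤ) :: encodeRings ((List.range k).map fun c : ℕ => route B σ (X c))).length)
    A (by decide) hc₁.na le_rfl
    (by subst hs₁; simp [HoldsAt, encodeRings, hs.na]) ?_
  rintro k hk s' ⟨h1, h2⟩ hj hf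
  obtain ⟨h3, h4⟩ := writeRoute_spec hX h (hc₁.frame hf (by decide) (by decide)) _ k hk hj h2 h1
  rw [hpre]
  exact ⟨by simpa using h3, by simpa using h4⟩

end Write

end Solver

end Evac

namespace Evac

namespace Solver

open ArrLang Var Arr

/-! #### The phases of the program -/

/-- Read the input, and find a box that contains the polygon. -/
def readInput : C := readRings ;; readExits ;; radius

/-- Complete the tables of places and arcs. -/
def prepare : C := addExits ;; listArcs ;; tt ::= 0 ;; done ::= 0

/-- Allow one more time step. -/
def nextTime : C := tt ::= (tt : E) + 1

/-- Write the output. -/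
def writeOutput : C := findMoves ;; writeRoutes

theorem length_encodeRings (l : List (List (ℤ × ℤ))) :
    (encodeRings l).length = l.length + 2 * l.flatten.length := by
  induction l with
  | nil => rfl
  | cons a l ih =>
    rw [encodeRings, List.flatMap_cons, List.length_append, ← encodeRings, ih]
    simp; ring

theorem length_encodeExits (l : List (Square × List Square)) :
    (encodeExits l).length = 3 * l.length + 2 * (entries l).length := by
  induction l with
  | nil => rfl
  | cons a l ih =>
    rw [encodeExits, List.flatMap_cons, List.length_append, ← encodeExits, ih]
    simp [entries]; ring

theorem length_encode (B : Building) : B.encode.length = 2 + B.rings.length +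
    2 * B.edges.length + 3 * B.exits.length + 2 * (entries B.exits).length := by
  rw [encode_eq, List.length_append, List.length_cons, List.length_cons, length_encodeRings,
    length_encodeExits, Building.length_edges]
  ring

theorem readInput_spec (s : St) (B : Building) (hB : B.IsValid)
    (hin : HoldsAt (s.arr inp) 0 B.encode) (hlen : s.var len = B.encode.length) :
    ∃ (R : ℕ) (a b : ℤ), ScanContext B R a b (readInput.den s) ∧ R ≤ B.area ∧
      (∀ c ∈ B.cells, |c.1 - a| ≤ R ∧ |c.2 - b| ≤ R) ∧
      Holds (exitAt (readInput.den s)) (B.exits.map Prod.fst) ∧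
      (readInput.den s).var nx = B.exits.length ∧
      Holds (entryAt (readInput.den s)) (entries B.exits) ∧
      (readInput.den s).var np = (entries B.exits).length ∧
      (readInput.den s).var len = B.encode.length := by
  rw [readInput]
  simp only [Cmd.den_seq]
  obtain ⟨h1, h2, h3⟩ := readRings_spec s B hin hlen
  have hf := readRings.den_frame s
  generalize readRings.den s = s₁ at h1 h2 h3 hf
  rw [← hf.arr inp (by decide)] at h3
  have hlen₁ := (hf.var len (by decide)).trans hlen
  obtain ⟨h4, h5, h6, h7⟩ := readExits_spec s₁ B h3 hlen₁
  have hf₂ := readExits.den_frame s₁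
  generalize readExits.den s₁ = s₂ at h4 h5 h6 h7 hf₂
  have hlen₂ := (hf₂.var len (by decide)).trans hlen₁
  have hE₂ : Holds (edgeAt s₂) B.edges := by
    simpa [Holds, edgeAt, hf₂.arr x1 (by decide), hf₂.arr y1 (by decide), hf₂.arr x2 (by decide),
      hf₂.arr y2 (by decide)] using h1
  have hne₂ := (hf₂.var ne (by decide)).trans h2
  have hle : s₂.var ne ≤ s₂.var len := by
    rw [hne₂, hlen₂, length_encode]; omega
  obtain ⟨r1, r2, r3, r4⟩ := radius_spec s₂ _ hE₂ hne₂ hle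
  have hf₃ := radius.den_frame s₂
  generalize radius.den s₂ = s₃ at r1 r2 r3 r4 hf₃
  obtain ⟨R, hR⟩ := Int.eq_ofNat_of_zero_le r1
  rw [hR] at r2 r3 r4
  -- The box is centred at the first listed entry square, which belongs to the polygon.
  have hbase : (s₂.arr px 0, s₂.arr py 0) ∈ B.cells := by
    obtain ⟨x, hx⟩ := List.exists_mem_of_ne_nil _ hB.exits_ne_nil
    obtain ⟨p, hp⟩ := List.exists_mem_of_ne_nil _ (hB.entries_ne_nil x hx)
    have hmem : (p, x.1) ∈ entries B.exits := (mem_entries B p x.1).2 ⟨x, hx, rfl, hp⟩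
    have h0 := h6 0 (List.length_pos_of_mem hmem)
    have h8 : (entryAt s₂ (0 : ℕ)) ∈ entries B.exits := by rw [h0]; exact List.getElem_mem _
    exact hB.entry_mem ((mem_entries B _ _).1 h8)
  -- A square of the polygon lies in a row spanned by an edge `e` to its left, and some edge `e'`
  -- starts to its right. Both ends of `e` are vertices within the radius, the second one as the
  -- starting point of `e''`.
  have hbox : ∀ c ∈ B.cells, |c.1 - s₂.arr px 0| ≤ R ∧ |c.2 - s₂.arr py 0| ≤ R := by
    intro c hc
    obtain ⟨e, he, e', he', g1, g2, g3, g4⟩ :=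
      Building.IsValid.exists_edges_of_parity hB ((hB.mem_cells_iff c).1 hc)
    obtain ⟨e'', he'', g5⟩ : ∃ e'' ∈ B.edges, e''.1 = e.2 := by
      have := Building.mem_flatten_snd he
      rw [← Building.map_fst_edges] at this
      exact List.mem_map.1 this
    have q1 := r3 e he
    have q2 := r3 e' he'
    have q3 := r3 e'' he''
    rw [g5] at q3
    simp only [abs_le] at q1 q2 q3 ⊢
    omega
  -- Every vertex is a corner of a square of the polygon, and such a square is less than the area
  -- away from the base square.
  have hRA : (R : ℤ) ≤ B.area := by
    refine r4 _ (by omega) fun e he => ?_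
    obtain ⟨c, hc, g1, g2, g3, g4⟩ := hB.exists_cell_near (Building.IsValid.mem_flatten_fst he)
    have := hB.abs_sub_lt hc hbase
    simp only [abs_lt, abs_le] at this ⊢
    omega
  have ha : ∀ a, s₃.arr a = s₂.arr a := fun a => hf₃.arr a (by simp [Cmd.arrs, radius, growVertex, grow])
  have hlen₃ := (hf₃.var len (by decide)).trans hlen₂
  have hne₃ := (hf₃.var ne (by decide)).trans hne₂
  refine ⟨R, s₂.arr px 0, s₂.arr py 0, ⟨?_, hne₃, ?_, hR, by rw [r2]; push_cast; ring, by rw [ha],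
    by rw [ha]⟩, by exact_mod_cast hRA, hbox, ?_, (hf₃.var nx (by decide)).trans h5, ?_,
    (hf₃.var np (by decide)).trans h7, hlen₃⟩
  · simpa [Holds, edgeAt, ha] using hE₂
  · rw [hne₃, hlen₃, ← hne₂, ← hlen₂]; exact hle
  · simpa [Holds, exitAt, ha] using h4
  · simpa [Holds, entryAt, ha] using h6

/-- Besides the tables, this provides bounds for the variables that cap the loops. The phases are
compiled one by one, because a cap has to be constant within a compiled command and those of a later
phase are computed by the earlier ones. -/
theorem prepare_spec (s : St) (B : Building) (hB : B.IsValid)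
    (hin : HoldsAt (s.arr inp) 0 B.encode) (hlen : s.var len = B.encode.length) :
    (readInput.den s).var side ≤ 2 * B.area + 1 ∧
    (readInput.den s).var len = B.encode.length ∧
    (scan.den (readInput.den s)).var len = B.encode.length ∧
    ∃ (M : ℕ) (X : ℤ → Square) (l : List (ℤ × ℤ)), IsNumbering B B.area M X ∧
      IsArcList B B.area M X l ∧ M ≤ 10 * B.area ∧ l.length ≤ B.area * M ∧
      (scan.den (readInput.den s)).var nm = M ∧
      BuildContext B.area M 0 l (prepare.den (scan.den (readInput.den s))) ∧
      placeAt (prepare.den (scan.den (readInput.den s))) = X ∧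
      (prepare.den (scan.den (readInput.den s))).var done = 0 := by
  obtain ⟨R, a, b, h1, h2, h3, h4, h5, h6, h7, h8⟩ := readInput_spec s B hB hin hlen
  generalize readInput.den s = s₁ at h1 h4 h5 h6 h7 h8
  obtain ⟨⟨L, g1, g2, g3, g4⟩, g5⟩ := scan_spec s₁ B hB R a b h1 h3
  have hf := scan.den_frame s₁
  generalize scan.den s₁ = s₂ at g1 g2 g5 hf
  simp only [Set.mem_univ, and_true] at g4
  have hlen₂ := (hf.var len (by decide)).trans h8
  have hA : L.length = B.area := by
    classical
    rw [Building.area, ← List.toFinset_card_of_nodup g3]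
    congr 1
    ext q; rw [List.mem_toFinset, g4]
  have hnx₂ := (hf.var nx (by decide)).trans h5
  have hX₂ : Holds (exitAt s₂) (B.exits.map Prod.fst) := by
    simpa [Holds, exitAt, hf.arr ex (by decide), hf.arr ey (by decide)] using h4
  have hP₂ : Holds (entryAt s₂) (entries B.exits) := by
    simpa [Holds, entryAt, hf.arr px (by decide), hf.arr py (by decide), hf.arr pu (by decide),
      hf.arr pv (by decide)] using h6
  have hp := addExits_spec s₂ L (B.exits.map Prod.fst) g1 g2 hX₂ (by simpa using hnx₂)
    (by rw [hnx₂, hlen₂, length_encode]; omega)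
  have hf₃ := addExits.den_frame s₂
  refine ⟨by rw [h1.side]; push_cast; omega, h8, hlen₂, ?_⟩
  rw [prepare]
  simp only [Cmd.den_seq, Cmd.den_set]
  generalize addExits.den s₂ = s₃ at hp hf₃
  have hnum := isNumbering_of_holds hB hp g3 g4
  rw [hA] at hnum
  have hM : (s₂.var nm : ℤ) = (B.area + B.exits.length : ℕ) := by
    rw [g5, g2, h5, hA]; push_cast; rfl
  have hctx : ArcContext B B.area (B.area + B.exits.length) (placeAt s₃) s₃ := by
    refine ⟨rfl, ?_, ?_, ?_, ?_, ?_⟩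
    · simpa [Holds, entryAt, hf₃.arr px (by decide), hf₃.arr py (by decide),
        hf₃.arr pu (by decide), hf₃.arr pv (by decide)] using hP₂
    · rw [hf₃.var np (by decide), hf.var np (by decide), h7]
    · rw [hf₃.var np (by decide), hf.var np (by decide), h7, hf₃.var len (by decide), hlen₂,
        length_encode]
      omega
    · rw [hf₃.var na (by decide), g2, hA]
    · rw [hf₃.var nm (by decide), hM]
  obtain ⟨l, k1, k2, k3, k4⟩ := listArcs_spec s₃ B _ _ _ hnum hctx
  have hf₄ := listArcs.den_frame s₃
  have hctx₄ := hctx.frame hf₄ (by decide) (by decide)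
  generalize listArcs.den s₃ = s₄ at k1 k2 hf₄ hctx₄
  have := hB.length_exits_le
  refine ⟨B.area + B.exits.length, placeAt s₃, l, hnum, k4, by omega, k3, hM,
    ⟨by simpa [Holds, arcAt] using k1, by simpa using k2, by simpa using hctx₄.na,
      by simpa using hctx₄.nm, by simp⟩, ?_, by simp⟩
  rw [← hctx₄.place]
  funext z
  simp [placeAt]

theorem length_timeArcs_le (A M T : ℕ) (l : List (ℤ × ℤ)) :
    (timeArcs A M T l).length ≤ T * (l.length + A) := by
  have h : ∀ i, (layer A M T l i).length ≤ l.length + A := by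
    intro i
    rw [layer, List.length_append, List.length_map]
    refine add_le_add (List.length_filter_le _ _) ?_
    split_ifs <;> simp
  rw [timeArcs, List.length_flatMap]
  refine (List.sum_le_card_nsmul _ (l.length + A) ?_).trans (by simp)
  intro n hn
  obtain ⟨i, -, rfl⟩ := List.mem_map.1 hn
  exact h i

theorem nextTime_spec {A M t : ℕ} {l : List (ℤ × ℤ)} {s : St} (hs : BuildContext A M t l s) :
    BuildContext A M (t + 1) l (nextTime.den s) :=
  ⟨by simpa [nextTime, Holds, arcAt] using hs.arcs, by simpa [nextTime] using hs.nb,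
    by simpa [nextTime] using hs.na, by simpa [nextTime] using hs.nm, by simp [nextTime, hs.tt]⟩

theorem step_spec {B : Building} {A M t : ℕ} {X : ℤ → Square} {l : List (ℤ × ℤ)} {s : St}
    (hX : IsNumbering B A M X) (hl : IsArcList B A M X l) (hs : BuildContext A M t l s) :
    (build.den (nextTime.den s)).var m ≤ ((t + 1) * (l.length + A) : ℕ) ∧
    (build.den (nextTime.den s)).var nl = ((t + 1) * A : ℕ) ∧
    (build.den (nextTime.den s)).var nrt = ((t + 2) * M : ℕ) ∧
    (build.den (nextTime.den s)).var cap = ((t + 1) * A + (t + 2) * M + 1 : ℕ) ∧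
    BuildContext A M (t + 1) l (auction.den (build.den (nextTime.den s))) ∧
    placeAt (auction.den (build.den (nextTime.den s))) = placeAt s ∧
    (((auction.den (build.den (nextTime.den s))).var done = 1 ∧
      Auction.IsMatching (timeArcs A M (t + 1) l) ((t + 1) * A)
        ((auction.den (build.den (nextTime.den s))).arr mate)) ∨
    ((auction.den (build.den (nextTime.den s))).var done = 0 ∧
      ¬ ∃ f, Auction.IsMatching (timeArcs A M (t + 1) l) ((t + 1) * A) f)) := by
  have h1 := nextTime_spec hs
  have hf₁ := nextTime.den_frame s
  generalize nextTime.den s = s₁ at h1 hf₁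
  obtain ⟨h2, h3, h4, h5⟩ := build_spec h1
  have hf₂ := build.den_frame s₁
  generalize build.den s₁ = s₂ at h2 h3 h4 h5 hf₂
  have hE := timeArcs_bounds (T := t + 1) hX hl
  have hE0 : ∀ e ∈ timeArcs A M (t + 1) l, 0 ≤ e.1 := by
    rintro ⟨u, r⟩ he
    obtain ⟨i, c, -, -, rfl, -⟩ := (mem_timeArcs hl u r).1 he
    positivity
  have h6 := auction_spec ⟨h2, h3, h4⟩ (by rw [h5]) hE hE0
  have hf₃ := auction.den_frame s₂
  refine ⟨?_, h3, h4, h5, (h1.frame hf₂ (by decide) (by decide)).frame hf₃ (by decide) (by decide),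
    ?_, h6⟩
  · rw [h2.2]; exact_mod_cast length_timeArcs_le _ _ _ _
  · funext z
    simp only [placeAt, hf₃.arr qx (by decide), hf₃.arr qy (by decide), hf₂.arr qx (by decide),
      hf₂.arr qy (by decide), hf₁.arr qx (by decide), hf₁.arr qy (by decide)]

theorem length_encodeRoutes_le (R : List (List Square)) (T : ℕ) (h : ∀ r ∈ R, r.length ≤ T + 1) :
    (encodeRoutes R).length ≤ 1 + R.length * (2 * T + 3) := by
  have : (encodeRoutes R).length = 1 + (encodeRings R).length := by
    rw [encodeRoutes, List.length_cons, add_comm]; rfl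
  rw [this, length_encodeRings, List.length_flatten]
  have h2 := List.sum_le_card_nsmul (R.map List.length) (T + 1) fun n hn => by
    obtain ⟨r, hr, rfl⟩ := List.mem_map.1 hn
    exact h r hr
  rw [List.length_map, smul_eq_mul] at h2
  nlinarith

theorem writeOutput_spec {B : Building} (hB : B.IsValid) {A M T : ℕ} {X : ℤ → Square}
    {l : List (ℤ × ℤ)} {s : St} (hX : IsNumbering B A M X) (hl : IsArcList B A M X l)
    (hs : BuildContext A M T l s) (hp : placeAt s = X) (hT : 0 < T)
    (hm : Auction.IsMatching (timeArcs A M T l) (T * A) (s.arr mate)) :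
    ∃ R, IsEvacuation B T R ∧ R.length = A ∧
      HoldsAt ((writeOutput.den s).arr out) 0 (encodeRoutes R) ∧
      (writeOutput.den s).var op = (encodeRoutes R).length := by
  have hsch := (isScheme_of_isMatching hX hl hT hm).uncycle
  have h1 := findMoves_spec (f := s.arr mate) ⟨rfl, hs.na, hs.nm, hs.tt⟩
  have hf := findMoves.den_frame s
  rw [writeOutput, Cmd.den_seq]
  generalize findMoves.den s = s₁ at h1 hf
  have hctx : RouteContext A M T X (activeCells A M T X (s.arr mate))
      (uncycle (activeCells A M T X (s.arr mate)) (matchMove A M X (s.arr mate))) s₁ := by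
    refine ⟨?_, (hf.var na (by decide)).trans hs.na, (hf.var tt (by decide)).trans hs.tt,
      fun i c hi hc hD => ?_⟩
    · rw [← hp]; funext z
      simp only [placeAt, hf.arr qx (by decide), hf.arr qy (by decide)]
    · rw [h1 i c hi hc]
      exact newTarget_spec hX hl hT hm hi hc hD
  obtain ⟨h2, h3⟩ := writeRoutes_spec hX hsch hctx
  refine ⟨_, ?_, by simp, h2, h3⟩
  have h4 := hsch.isEvacuation hB isAcyclicScheme_uncycle ((List.range A).map fun c : ℕ => X c)
    (List.nodup_range.map_on fun a ha b hb he => hX.inj a b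
      ((List.mem_range.1 ha).trans_le hX.le) ((List.mem_range.1 hb).trans_le hX.le) he)
    (fun c => by rw [hX.mem_cells]; simp)
  rwa [List.map_map] at h4

end Solver

end Evac

namespace Evac

namespace Solver

open ArrLang Var Arr RAM

/-! ### The machine program -/

/-- The register of a variable. -/
def reg (v : Var) : ℕ := v.ctorIdx + 2

/-- The offset of an array. -/
def offset (a : Arr) : ℤ := a.ctorIdx

theorem reg_injective : Function.Injective reg := fun a b h => by
  have h1 : a.ctorIdx = b.ctorIdx := by simpa [reg] using h
  rw [← Var.ofNat_ctorIdx a, h1, Var.ofNat_ctorIdx]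

theorem offset_injective : Function.Injective offset := fun a b h => by
  have h1 : a.ctorIdx = b.ctorIdx := by simpa [offset] using h
  rw [← Arr.ofNat_ctorIdx a, h1, Arr.ofNat_ctorIdx]

theorem offset_nonneg (a : Arr) : 0 ≤ offset a := Int.natCast_nonneg _

theorem offset_lt (a : Arr) : offset a < 32 := by cases a <;> decide

/-- The machine program of a command. -/
def compile (c : C) : Prog := c.compile reg offset

/-- The machine state represents the store. -/
abbrev Represents (s : St) (σ : State) : Prop := Sim reg offset s σ

theorem exec_compile {l : List Var} (c : C) (hc : c.wf l) :
    ∃ K d : ℕ, ∀ (N : ℕ) (s : St) (σ : State), (∀ v ∈ l, s.var v ≤ N) → Represents s σ →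
      ∃ n σ', Exec (compile c) σ n σ' ∧ Represents (c.den s) σ' ∧ n ≤ K * (N + 1) ^ d :=
  c.exec_compile reg_injective offset_injective offset_nonneg offset_lt hc

/-- One step of spreading the input. -/
def spreadStep : Prog :=
  .seq (.assign 1 (.sub (.reg 1) (.lit 1)))
    (.store (.add (mul32 (.reg 1)) (.lit (offset inp))) (.mem (.reg 1)))

/-- Move the input word into the array `inp`. -/
def spread : Prog :=
  .seq (.assign 1 (.reg 0)) (.seq (.loop (.lt (.lit 0) (.reg 1)) spreadStep)
    (.assign (reg len) (.reg 0)))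

/-- The entries are moved from the last to the first. The cell written for entry `k` has an address
of at least `k`, so the entries not yet moved stay intact. -/
theorem exec_spread_loop (w : ℕ → ℤ) (k : ℕ) (σ : State) (h1 : σ.reg 1 = k)
    (hw : ∀ j < k, σ.mem j = w j) :
    ∃ n σ', Exec (.loop (.lt (.lit 0) (.reg 1)) spreadStep) σ n σ' ∧ n ≤ 100 * (k + 1) ∧
      σ'.reg 0 = σ.reg 0 ∧ (∀ j < k, σ'.mem (32 * j + offset inp) = w j) ∧
      ∀ j, k ≤ j → σ'.mem (32 * j + offset inp) = σ.mem (32 * j + offset inp) := by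
  induction k generalizing σ with
  | zero =>
    refine ⟨_, σ, .loopFalse (by simp [Expr.eval, h1]), ?_, rfl, by simp, fun _ _ => rfl⟩
    simp [Expr.cost]
  | succ k ih =>
    have e1 := Exec.assign 1 (.sub (.reg 1) (.lit 1)) σ
    have hr : (Expr.sub (.reg 1) (.lit 1)).eval σ = k := by simp [Expr.eval, h1]
    rw [hr] at e1
    have e2 := Exec.store (.add (mul32 (.reg 1)) (.lit (offset inp))) (.mem (.reg 1)) (σ.setReg 1 k)
    have ha : (Expr.add (mul32 (.reg 1)) (.lit (offset inp))).eval (σ.setReg 1 k) =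
        32 * k + offset inp := by
      simp [Expr.eval, mul32_eval, State.setReg]
    have hv : (Expr.mem (.reg 1)).eval (σ.setReg 1 k) = w k := by
      simp [Expr.eval, State.setReg, hw k (Nat.lt_succ_self k)]
    rw [ha, hv] at e2
    have ho := offset_nonneg inp
    obtain ⟨n, σ', h2, h3, h4, h5, h6⟩ := ih ((σ.setReg 1 k).setMem (32 * k + offset inp) (w k))
      (by simp [State.setReg, State.setMem]) (fun j hj => by
        have : (j : ℤ) ≠ 32 * k + offset inp := by omega
        simp [State.setReg, State.setMem, this, hw j (by omega)])
    refine ⟨_, σ', .loopTrue (by simp [Expr.eval, h1]) (.seq e1 e2) h2, ?_, ?_,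
      fun j hj => ?_, fun j hj => ?_⟩
    · simp [Expr.cost, mul32]; omega
    · simp [h4, State.setReg, State.setMem]
    · rcases Nat.lt_succ_iff_lt_or_eq.1 hj with h | rfl
      · exact h5 j h
      · rw [h6 _ le_rfl]; simp [State.setMem]
    · have : (32 * j + offset inp : ℤ) ≠ 32 * k + offset inp := by omega
      rw [h6 j (by omega)]
      simp [State.setMem, State.setReg, this]

/-- The store is read off the machine state as it is. Other arrays may contain remnants of the input
word; nothing is assumed about them. -/
theorem exec_spread (w : List ℤ) : ∃ n s σ, Exec spread (inputState w) n σ ∧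
    n ≤ 200 * (w.length + 1) ∧ Represents s σ ∧ HoldsAt (s.arr inp) 0 w ∧
      s.var len = w.length := by
  obtain ⟨n, σ, h1, h2, h3, h4, -⟩ := exec_spread_loop (fun j => w.getD j 0) w.length
    ((inputState w).setReg 1 w.length) (by simp [State.setReg])
    (fun j _ => by simp [State.setReg, inputState])
  have h0 : σ.reg 0 = w.length := by rw [h3]; simp [State.setReg, inputState]
  have e1 := Exec.assign 1 (.reg 0) (inputState w)
  have e2 := Exec.assign (reg len) (.reg 0) σ
  rw [show (Expr.reg 0).eval (inputState w) = w.length by simp [Expr.eval, inputState]] at e1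
  rw [show (Expr.reg 0).eval σ = w.length by simp [Expr.eval, h0]] at e2
  refine ⟨_, ⟨fun v => (σ.setReg (reg len) w.length).reg (reg v),
    fun a i => σ.mem (32 * i + offset a)⟩, _, .seq e1 (.seq h1 e2), ?_, ⟨fun _ => rfl, fun _ _ => rfl⟩,
    ?_, ?_⟩
  · simp [Expr.cost]; omega
  · rw [holdsAt_iff]
    intro k hk
    simp only [zero_add]
    rw [h4 k hk, List.getD_eq_getElem _ _ hk]
  · simp [State.setReg]

/-- One step of collecting the output. -/
def collectStep : Prog :=
  .seq (.store (.reg 1) (.mem (.add (mul32 (.reg 1)) (.lit (offset out)))))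
    (.assign 1 (.add (.reg 1) (.lit 1)))

/-- Make the array `out` the output word. -/
def collect : Prog :=
  .seq (.assign 1 (.lit 0)) (.seq (.loop (.lt (.reg 1) (.reg (reg op))) collectStep)
    (.assign 0 (.reg (reg op))))

/-- Here the entries are moved from the first to the last: the address `32 * j + offset out` of an
entry still to be read is larger than that of the cell `i` being written. -/
theorem exec_collect_loop (w : ℕ → ℤ) (N k i : ℕ) (hi : i + k = N) (σ : State) (h1 : σ.reg 1 = i)
    (hop : σ.reg (reg op) = N) (hw : ∀ j, i ≤ j → j < N → σ.mem (32 * j + offset out) = w j)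
    (hd : ∀ j < i, σ.mem j = w j) :
    ∃ n σ', Exec (.loop (.lt (.reg 1) (.reg (reg op))) collectStep) σ n σ' ∧
      n ≤ 100 * (k + 1) ∧ σ'.reg (reg op) = N ∧ ∀ j < N, σ'.mem j = w j := by
  induction k generalizing σ i with
  | zero =>
    refine ⟨_, σ, .loopFalse (by simp [Expr.eval, h1, hop]; omega), ?_, hop, fun j hj => hd j (by omega)⟩
    simp [Expr.cost]
  | succ k ih =>
    have ho : 0 < offset out := by decide
    have e1 := Exec.store (.reg 1) (.mem (.add (mul32 (.reg 1)) (.lit (offset out)))) σ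
    have hr : (Expr.mem (.add (mul32 (.reg 1)) (.lit (offset out)))).eval σ = w i := by
      simp only [Expr.eval, mul32_eval, h1]
      exact hw i le_rfl (by omega)
    rw [hr, show (Expr.reg 1).eval σ = i from h1] at e1
    have e2 := Exec.assign 1 (.add (.reg 1) (.lit 1)) (σ.setMem i (w i))
    rw [show (Expr.add (.reg 1) (.lit 1)).eval (σ.setMem i (w i)) = (i + 1 : ℕ) by
      simp [Expr.eval, State.setMem, h1]] at e2
    have hne : reg op ≠ 1 := by decide
    obtain ⟨n, σ', h2, h3, h4, h5⟩ := ih (i + 1) (by omega)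
      ((σ.setMem i (w i)).setReg 1 (i + 1 : ℕ)) (by simp [State.setReg])
      (by simp [State.setReg, State.setMem, hne, hop]) (fun j hj hjN => by
        have : (32 * j + offset out : ℤ) ≠ i := by omega
        simp only [State.setReg, State.setMem, Function.update_of_ne this]
        exact hw j (by omega) hjN) (fun j hj => by
        simp only [State.setReg, State.setMem, Function.update_apply, Nat.cast_inj]
        split_ifs with h
        · rw [h]
        · exact hd j (by omega))
    refine ⟨_, σ', .loopTrue (by simp [Expr.eval, h1, hop]; omega) (.seq e1 e2) h2, ?_, h4, h5⟩
    simp [Expr.cost, mul32]; omega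

/-- The indices, which `outputWord` treats as a list of integers, become natural numbers again. -/
theorem outputWord_eq (σ : State) :
    outputWord σ = (List.range (σ.reg 0).toNat).map fun i : ℕ => σ.mem i := by
  simp [outputWord, List.bind_eq_flatMap, List.map_flatMap]
  exact List.map_eq_flatMap.symm

theorem exec_collect {s : St} {σ : State} (hs : Represents s σ) (w : List ℤ)
    (hw : HoldsAt (s.arr out) 0 w) (hop : s.var op = w.length) :
    ∃ n σ', Exec collect σ n σ' ∧ n ≤ 200 * (w.length + 1) ∧ outputWord σ' = w := by
  have hne : reg op ≠ 1 := by decide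
  rw [holdsAt_iff] at hw
  obtain ⟨n, σ', h1, h2, h3, h4⟩ := exec_collect_loop (fun j => w.getD j 0) w.length w.length 0
    (by simp) (σ.setReg 1 0) (by simp [State.setReg])
    (by simp [State.setReg, hne, hs.var, hop]) (fun j _ hj => by
      have := hw j hj
      rw [zero_add, ← hs.arr] at this
      simp only [State.setReg]
      rw [this, List.getD_eq_getElem _ _ hj]) (by simp)
  have e1 := Exec.assign 1 (.lit 0) σ
  have e2 := Exec.assign 0 (.reg (reg op)) σ'
  rw [show (Expr.reg (reg op)).eval σ' = w.length from h3] at e2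
  refine ⟨_, _, .seq e1 (.seq h1 e2), ?_, ?_⟩
  · simp [Expr.cost]; omega
  · rw [outputWord_eq]
    refine List.ext_getElem (by simp [State.setReg]) fun j hj hj' => ?_
    simp only [List.getElem_map, List.getElem_range, State.setReg]
    rw [h4 j hj', List.getD_eq_getElem _ _ hj']

/-- The search for the least time. -/
def search : Prog :=
  .loop (.eq (.reg (reg done)) (.lit 0))
    (.seq (compile nextTime) (.seq (compile build) (compile auction)))

/-- The whole program. -/
def program : Prog :=
  .seq spread (.seq (compile readInput) (.seq (compile scan) (.seq (compile prepare)
    (.seq search (.seq (compile writeOutput) collect)))))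

/-- This loop has no cap known in advance; `k` counts the rounds left after the present one until
the least feasible time. All caps grow with the time, so a number `N` that suffices for `T` suffices
for every round. The final test costs 4. -/
theorem exec_search : ∃ K d : ℕ, ∀ (N : ℕ) (B : Building) (A M T : ℕ) (X : ℤ → Square)
    (l : List (ℤ × ℤ)), IsNumbering B A M X → IsArcList B A M X l →
    (∃ f, Auction.IsMatching (timeArcs A M T l) (T * A) f) →
    (∀ t, 0 < t → t < T → ¬ ∃ f, Auction.IsMatching (timeArcs A M t l) (t * A) f) →
    T * (l.length + A) ≤ N → T * A + (T + 1) * M + 1 ≤ N → l.length ≤ N → T ≤ N → A ≤ N →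
    ∀ (k t : ℕ) (s : St) (σ : State), t + k + 1 = T → BuildContext A M t l s → placeAt s = X →
      s.var done = 0 → Represents s σ →
      ∃ n s' σ', Exec search σ n σ' ∧ Represents s' σ' ∧ n ≤ (k + 1) * (K * (N + 1) ^ d) + 4 ∧
        BuildContext A M T l s' ∧ placeAt s' = X ∧
        Auction.IsMatching (timeArcs A M T l) (T * A) (s'.arr mate) := by
  obtain ⟨K₁, d₁, H₁⟩ := exec_compile (l := []) nextTime (by decide)
  obtain ⟨K₂, d₂, H₂⟩ := exec_compile (l := [tt, nb, na]) build (by decide)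
  obtain ⟨K₃, d₃, H₃⟩ := exec_compile (l := [cap, m, nl, nrt]) auction (by decide)
  refine ⟨4 + K₁ + K₂ + K₃, d₁ + d₂ + d₃, ?_⟩
  intro N B A M T X l hX hl hT hmin hN₁ hN₂ hN₃ hN₄ hN₅ k
  have hbody : ∀ n₁ n₂ n₃ : ℕ, n₁ ≤ K₁ * (N + 1) ^ d₁ → n₂ ≤ K₂ * (N + 1) ^ d₂ →
      n₃ ≤ K₃ * (N + 1) ^ d₃ →
      4 + n₁ + n₂ + n₃ ≤ (4 + K₁ + K₂ + K₃) * (N + 1) ^ (d₁ + d₂ + d₃) := by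
    intro n₁ n₂ n₃ h₁ h₂ h₃
    have p : ∀ d, d ≤ d₁ + d₂ + d₃ → (N + 1) ^ d ≤ (N + 1) ^ (d₁ + d₂ + d₃) := fun d hd =>
      Nat.pow_le_pow_right (by omega) hd
    have q₀ := p 0 (by omega)
    have q₁ := Nat.mul_le_mul_left K₁ (p d₁ (by omega))
    have q₂ := Nat.mul_le_mul_left K₂ (p d₂ (by omega))
    have q₃ := Nat.mul_le_mul_left K₃ (p d₃ (by omega))
    rw [pow_zero] at q₀
    rw [add_mul, add_mul, add_mul]
    omega
  have hstep : ∀ (t : ℕ) (s : St) (σ : State), t + 1 ≤ T → BuildContext A M t l s →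
      placeAt s = X → s.var done = 0 → Represents s σ →
      ∃ n s' σ', (∀ n' σ'', Exec search σ' n' σ'' → Exec search σ (n + n') σ'') ∧
        Represents s' σ' ∧ n ≤ (4 + K₁ + K₂ + K₃) * (N + 1) ^ (d₁ + d₂ + d₃) ∧
        BuildContext A M (t + 1) l s' ∧ placeAt s' = X ∧
        ((s'.var done = 1 ∧
          Auction.IsMatching (timeArcs A M (t + 1) l) ((t + 1) * A) (s'.arr mate)) ∨
        (s'.var done = 0 ∧ ¬ ∃ f, Auction.IsMatching (timeArcs A M (t + 1) l) ((t + 1) * A) f)) := by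
    intro t s σ ht hs hp hd hσ
    obtain ⟨g1, g2, g3, g4, g5, g6, g7⟩ := step_spec hX hl hs
    have hs₁ := nextTime_spec hs
    have b1 : (t + 1) * (l.length + A) ≤ T * (l.length + A) := Nat.mul_le_mul_right _ ht
    have b2 : (t + 1) * A ≤ T * A := Nat.mul_le_mul_right _ ht
    have b3 : (t + 2) * M ≤ (T + 1) * M := Nat.mul_le_mul_right _ (by omega)
    obtain ⟨n₁, σ₁, e1, r1, c1⟩ := H₁ N s σ (by simp) hσ
    obtain ⟨n₂, σ₂, e2, r2, c2⟩ := H₂ N _ σ₁ (by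
      simp only [List.mem_cons, List.not_mem_nil, or_false, forall_eq_or_imp, forall_eq]
      rw [hs₁.tt, hs₁.nb, hs₁.na]
      omega) r1
    obtain ⟨n₃, σ₃, e3, r3, c3⟩ := H₃ N _ σ₂ (by
      simp only [List.mem_cons, List.not_mem_nil, or_false, forall_eq_or_imp, forall_eq]
      rw [g2, g3, g4]
      omega) r2
    refine ⟨4 + n₁ + n₂ + n₃, _, σ₃, fun n' σ'' he => ?_, r3, hbody _ _ _ c1 c2 c3, g5, g6.trans hp,
      g7⟩
    have := Exec.loopTrue (e := .eq (.reg (reg done)) (.lit 0))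
      (by simp [Expr.eval, hσ.var, hd]) (.seq e1 (.seq e2 e3)) he
    have hcost : (Expr.eq (.reg (reg done)) (.lit 0)).cost + 1 + (n₁ + (n₂ + n₃)) + n' =
        4 + n₁ + n₂ + n₃ + n' := by simp [Expr.cost]; ring
    rwa [hcost] at this
  induction k with
  | zero =>
    intro t s σ ht hs hp hd hσ
    obtain ⟨n, s', σ', h1, h2, h3, h4, h5, h6⟩ := hstep t s σ (by omega) hs hp hd hσ
    obtain rfl : t + 1 = T := by omega
    rcases h6 with ⟨h6, h7⟩ | ⟨-, h7⟩
    · refine ⟨_, s', σ', h1 _ _ (.loopFalse (by simp [Expr.eval, h2.var, h6])), h2, ?_, h4, h5, h7⟩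
      simp only [Expr.cost]
      omega
    · exact absurd hT h7
  | succ k ih =>
    intro t s σ ht hs hp hd hσ
    obtain ⟨n, s', σ', h1, h2, h3, h4, h5, h6⟩ := hstep t s σ (by omega) hs hp hd hσ
    rcases h6 with ⟨-, h7⟩ | ⟨h6, -⟩
    · exact absurd ⟨_, h7⟩ (hmin (t + 1) (by omega) (by omega))
    · obtain ⟨n', s'', σ'', g1, g2, g3, g4⟩ := ih (t + 1) s' σ' (by omega) h4 h5 h6 h2
      refine ⟨_, s'', σ'', h1 _ _ g1, g2, ?_, g4⟩
      rw [add_mul (k + 1)]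
      omega

/-- An evacuation gives a matching for its own time, so the least time with a matching is a lower
bound. The time 0 has to be excluded separately: it has no left vertices, and they are trivially
matched, while the polygon is not empty. -/
theorem exists_least_time {B : Building} (hB : B.IsValid) {A M : ℕ} {X : ℤ → Square}
    {l : List (ℤ × ℤ)} (hX : IsNumbering B A M X) (hl : IsArcList B A M X l) :
    ∃ T, 0 < T ∧ (∃ f, Auction.IsMatching (timeArcs A M T l) (T * A) f) ∧
      (∀ t, 0 < t → t < T → ¬ ∃ f, Auction.IsMatching (timeArcs A M t l) (t * A) f) ∧
      ∀ T' R, IsEvacuation B T' R → T ≤ T' := by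
  classical
  have hpos : ∀ {T D σ}, IsScheme B B.cells T D σ → 0 < T := by
    intro T D σ h
    rcases Nat.eq_zero_or_pos T with rfl | h0
    · have := h.done
      rw [h.start] at this
      exact absurd this hB.cells_nonempty.ne_empty
    · exact h0
  have hex : ∃ T, 0 < T ∧ ∃ f, Auction.IsMatching (timeArcs A M T l) (T * A) f := by
    obtain ⟨T, D, σ, h⟩ := Evac.exists_isScheme hB
    exact ⟨T, hpos h, h.exists_isMatching hX hl⟩
  refine ⟨Nat.find hex, (Nat.find_spec hex).1, (Nat.find_spec hex).2,
    fun t h0 ht h => Nat.find_min hex ht ⟨h0, h⟩, fun T' R h => ?_⟩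
  obtain ⟨D, σ, h, -⟩ := h.exists_isScheme hB
  exact Nat.find_min' hex ⟨hpos h, h.exists_isMatching hX hl⟩

theorem exec_program : ∃ p : Polynomial ℕ, ∀ B : Building, B.IsValid →
    ∃ (T : ℕ) (R : List (List Square)) (n : ℕ), IsOptimalEvacuation B T R ∧
      Computes program B.encode n (encodeRoutes R) ∧ n ≤ p.eval (B.area + T) := by
  obtain ⟨K₁, d₁, H₁⟩ := exec_compile (l := [len]) readInput (by decide)
  obtain ⟨K₂, d₂, H₂⟩ := exec_compile (l := [side, len]) scan (by decide)
  obtain ⟨K₃, d₃, H₃⟩ := exec_compile (l := [nm, len]) prepare (by decide)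
  obtain ⟨K₄, d₄, H₄⟩ := exec_search
  obtain ⟨K₅, d₅, H₅⟩ := exec_compile (l := [tt, na, nm]) writeOutput (by decide)
  -- With `S` the sum of area and time there are at most `10 * S` places and `10 * S ^ 2` arcs,
  -- hence cubically many edges in the bipartite graph. This dominates all caps and the lengths of
  -- input and output; the summand `400 * (P + 1)` below pays for moving both words.
  let P : Polynomial ℕ := 100 * (Polynomial.X + 1) ^ 3
  refine ⟨400 * (P + 1) + Polynomial.C K₁ * (P + 1) ^ d₁ + Polynomial.C K₂ * (P + 1) ^ d₂ +
    Polynomial.C K₃ * (P + 1) ^ d₃ + (P * (Polynomial.C K₄ * (P + 1) ^ d₄) + 4) +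
    Polynomial.C K₅ * (P + 1) ^ d₅, fun B hB => ?_⟩
  obtain ⟨n₀, s₀, σ₀, e0, c0, r0, hin, hlen⟩ := exec_spread B.encode
  obtain ⟨g1, g2, g3, M, X, l, hX, hl, g4, g5, g6, g7, g8, g9⟩ := prepare_spec s₀ B hB hin hlen
  obtain ⟨T, hT, hmat, hmin, hopt⟩ := exists_least_time hB hX hl
  set S := B.area + T with hS
  have hN : P.eval S = 100 * (S + 1) ^ 3 := by simp [P]
  have hb := hB.length_encode_le
  have ha : B.area ≤ S := by omega
  have hTS : T ≤ S := by omega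
  generalize hNdef : P.eval S = N at hN
  have hcube : 100 * (S + 1) ^ 3 = 100 * (S * S * S) + 300 * (S * S) + 300 * S + 100 := by ring
  have hM : M ≤ 10 * S := by omega
  have haa := Nat.mul_le_mul ha ha
  have hTa := Nat.mul_le_mul hTS ha
  have hTM := Nat.mul_le_mul hTS hM
  have haM := Nat.mul_le_mul ha hM
  have hll : l.length ≤ 10 * (S * S) := by
    rw [Nat.mul_left_comm] at haM
    omega
  have hTl := Nat.mul_le_mul hTS hll
  rw [Nat.mul_left_comm, ← Nat.mul_assoc S S S] at hTl
  rw [Nat.mul_left_comm] at hTM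
  have q1 : B.encode.length ≤ N := by
    have : 9 * B.area * (3 + 2 * B.area) = 27 * B.area + 18 * (B.area * B.area) := by ring
    omega
  have q2 : 10 * B.area ≤ N := by omega
  have q3 : T * (l.length + B.area) ≤ N := by
    rw [mul_add]
    omega
  have q4 : T * B.area + (T + 1) * M + 1 ≤ N := by
    rw [add_mul]
    omega
  have q5 : l.length ≤ N := by omega
  have q6 : 1 + B.area * (2 * T + 3) ≤ N := by
    have : B.area * (2 * T + 3) = 2 * (T * B.area) + 3 * B.area := by ring
    omega
  have q7 : S ≤ N := by omega
  obtain ⟨n₁, σ₁, e1, r1, c1⟩ := H₁ N s₀ σ₀ (by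
    simp only [List.mem_cons, List.not_mem_nil, or_false, forall_eq]
    omega) r0
  obtain ⟨n₂, σ₂, e2, r2, c2⟩ := H₂ N _ σ₁ (by
    simp only [List.mem_cons, List.not_mem_nil, or_false, forall_eq_or_imp, forall_eq]
    omega) r1
  obtain ⟨n₃, σ₃, e3, r3, c3⟩ := H₃ N _ σ₂ (by
    simp only [List.mem_cons, List.not_mem_nil, or_false, forall_eq_or_imp, forall_eq]
    omega) r2
  obtain ⟨n₄, s₄, σ₄, e4, r4, c4, h1, h2, h3⟩ := H₄ N B B.area M T X l hX hl hmat hmin q3 q4 q5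
    (by omega) (by omega) (T - 1) 0 _ σ₃ (by omega) g7 g8 g9 r3
  obtain ⟨n₅, σ₅, e5, r5, c5⟩ := H₅ N _ σ₄ (by
    simp only [List.mem_cons, List.not_mem_nil, or_false, forall_eq_or_imp, forall_eq]
    rw [h1.tt, h1.na, h1.nm]
    omega) r4
  obtain ⟨R, k1, k2, k3, k4⟩ := writeOutput_spec hB hX hl h1 h2 hT h3
  obtain ⟨n₆, σ₆, e6, c6, ho⟩ := exec_collect r5 _ k3 k4
  have q8 := length_encodeRoutes_le R T k1.inTime
  rw [k2] at q8
  refine ⟨T, R, _, ⟨k1, hopt⟩,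
    ⟨σ₆, .seq e0 (.seq e1 (.seq e2 (.seq e3 (.seq e4 (.seq e5 e6))))), ho⟩, ?_⟩
  simp only [Polynomial.eval_add, Polynomial.eval_mul, Polynomial.eval_pow, Polynomial.eval_C,
    Polynomial.eval_one, Polynomial.eval_ofNat, ← hS, hNdef]
  have c4' : (T - 1 + 1) * (K₄ * (N + 1) ^ d₄) ≤ N * (K₄ * (N + 1) ^ d₄) :=
    Nat.mul_le_mul_right _ (by omega)
  omega

end Solver

end Evac

theorem mainTheorem5 :
    (∃ (prog : RAM.Prog) (p : Polynomial ℕ), ∀ B : Evac.Building, B.IsValid →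
      ∃ (T : ℕ) (R : List (List Evac.Square)) (n : ℕ),
        Evac.IsOptimalEvacuation B T R ∧
        RAM.Computes prog B.encode n (Evac.encodeRoutes R) ∧
        n ≤ p.eval (B.area + T)) ∧
    (∀ B : Evac.Building, B.IsValid → ∀ T : ℕ,
      (∃ R, Evac.IsEvacuation B T R) ↔
        ∃ f : Evac.NetVertex × Evac.NetVertex → ℝ,
          (Evac.timeExpanded B T).IsMaxFlow f ∧
          (Evac.timeExpanded B T).IsIntegral f ∧
          (Evac.timeExpanded B T).value f = B.area) :=
  ⟨⟨Evac.Solver.program, Evac.Solver.exec_program⟩,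
    fun _ hB T => Evac.exists_isEvacuation_iff_exists_flow hB T⟩
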